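/- **Conventions.** For a partial order $M$ let $M^D$ be its Dedekind–MacNeille completion without added end points (nonempty, bounded-above sets equal to the set of lower bounds of their upper bounds). A *connecting set* from $a$ to $b$ ($a,b\in M$) is a finite sequence $a=c_0,\dots,c_n=b$ in $M^D$, $n\ge 1$, whose consecutive members are comparable and whose inner members $c_i$ satisfy $c_{i-1}<c_i>c_{i+1}$ or $c_{i-1}>c_i<c_{i+1}$. A *path* from $a$ to $b$ is a union of maximal chains $\sigma_i$ of $M^D$ between $c_i$ and $c_{i+1}$ such that two different $\sigma_i$ meet only if they are consecutive, and then only in their common end point. $M$ is a (connected) *cycle-free partial order* (CFPO) if there is exactly one path $\langle a,b\rangle$ between any two points $a,b\in M$; it is *path complete* if the connecting sets of all these paths lie in $M$. For $x<y$ (resp. $y<x$) the *upwards* (resp. *downwards*) *cone* of $x$ containing $y$ is $\{t\in M: x\notin\langle t,y\rangle\}$; $ro\uparrow(x)$ and $ro\downarrow(x)$ are the numbers (cardinals) of upwards and downwards cones of $x$. $M$ is *cone transitive* if $\mathrm{Aut}(M)$ is transitive on $M$ and, whenever $C,D$ are both upwards or both downwards cones of the same $x$, some automorphism maps $C$ onto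 $D$; then $ro\uparrow(M):=ro\uparrow(x)$ and $ro\downarrow(M):=ro\downarrow(x)$ do not depend on $x$. Let $K_{Cone}$ be the class of nonempty path-complete cone-transitive CFPOs $M$ with $5\le ro\uparrow(M)\le ro\downarrow(M)$. The betweenness relation of $M$ is $B(z;x,y):\iff x<z<y$ or $y<z<x$. A 60-tuple $\bar f=(f_i)_{i\in A_5}$ of elements of a group is an *$A_5$-tuple* if for all $i,j,k \in A_5$ we have $f_if_j=f_k\iff ij=k$. It is *indecomposable* if it is an $A_5$-tuple and there are no $A_5$-tuples $\bar g,\bar h$ that commute elementwise with $f_i=g_ih_i$ for all $i$. For a tuple $\bar f$ from $\mathrm{Aut}(M)$ let $\mathrm{supp}(\bar f)$ be the set of points moved by some $f_i$. We say that $\bar f$ *acts upwards* (resp. *downwards*) *at* $x\in M$ if $\bar f$ is indecomposable, $x$ is the one and only point of $M$ lying on all paths $\langle t,s\rangle$ with $t\in\mathrm{supp}(\bar f)$, $s\in M\setminus \mathrm{supp}(\bar f)$, and $\mathrm{supp}(\bar f)$ contains a point above (resp. below) $x$. A pair $(\bar f_0,\bar f_1)$ *represents* $x$ if one of its members acts upwards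 at $x$ and the other acts downwards at $x$. **Theorem ($K_{Cone}$ is faithful).** 1. There are first-order formulas $\mathrm{RepPoint}(\bar f_0,\bar f_1)$, $\mathrm{EqRepPoint}(\bar f_0,\bar f_1;\bar g_0,\bar g_1)$ and $B(\bar h_0,\bar h_1;\bar f_0,\bar f_1;\bar g_0,\bar g_1)$ without parameters in the language of groups, where all the arguments are 60-tuples of variables, such that for every $M\in K_{Cone}$: $\mathrm{RepPoint}$ defines in $\mathrm{Aut}(M)$ exactly the set of pairs that represent a point of $M$; each such pair represents a unique point, and every point of $M$ is represented; two such pairs satisfy $\mathrm{EqRepPoint}$ if and only if they represent the same point; and three such pairs satisfy $B$ if and only if the point represented by the first is between the points represented by the other two. In particular the single first-order interpretation $\Phi$ with domain $\mathrm{RepPoint}$, equality $\mathrm{EqRepPoint}$ and relation $B$ satisfies $\Phi(\mathrm{Aut}(M))\cong\langle M,B\rangle$ for all $M\in K_{Cone}$. 2. For $M,N\in K_{Cone}$ the following are equivalent: $\mathrm{Aut}(M)\cong\mathrm{Aut}(N)$ as abstract groups; $\langle M,B\rangle\cong\langle N,B\rangle$; $M$ is isomorphic to $N$ or to the reverse order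 $N^*$. If $\mathrm{Aut}(M)\cong\mathrm{Aut}(N)$ and $ro\uparrow(M)<ro\downarrow(M)$, then $M\cong N$. -/

import Mathlib

universe u

namespace CFPO

/-! ### The Dedekind–MacNeille completion (without added end points) and paths -/

section Paths

variable (M : Type u) [PartialOrder M]

/-- The completion `M^D`: the Dedekind cuts of `M` with both sides nonempty, i.e. the nonempty
bounded above sets which equal the set of lower bounds of their upper bounds. -/
def Completion : Type u :=
  {A : DedekindCut M // A.left.Nonempty ∧ A.right.Nonempty}

instance : PartialOrder (Completion M) :=
  inferInstanceAs (PartialOrder {A : DedekindCut M // A.left.Nonempty ∧ A.right.Nonempty})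

variable {M}

/-- The canonical embedding of `M` in `M^D`. -/
def toCompletion (a : M) : Completion M :=
  ⟨DedekindCut.principal a, ⟨a, le_refl a⟩, ⟨a, le_refl a⟩⟩

/-- `c 0, …, c n` (with `n ≥ 1`) is a connecting set from `a` to `b`: consecutive members are
comparable, and every inner member is strictly above both or strictly below both neighbours. -/
structure IsConnectingSet (a b : M) (n : ℕ) (c : ℕ → Completion M) : Prop where
  pos : 1 ≤ n
  first : c 0 = toCompletion a
  last : c n = toCompletion b
  comparable : ∀ i < n, c i ≤ c (i + 1) ∨ c (i + 1) ≤ c i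
  alternating : ∀ i, i + 2 ≤ n →
    (c i < c (i + 1) ∧ c (i + 2) < c (i + 1)) ∨ (c (i + 1) < c i ∧ c (i + 1) < c (i + 2))

/-- `P` is a path from `a` to `b` with connecting set `c 0, …, c n`: it is the union of maximal
chains `σ i` of `M^D` between `c i` and `c (i + 1)`, two of which meet only if they are consecutive,
and then only in the common end point. -/
def IsPathAlong (a b : M) (n : ℕ) (c : ℕ → Completion M) (P : Set (Completion M)) : Prop :=
  IsConnectingSet a b n c ∧ ∃ σ : ℕ → Set (Completion M),
    (∀ i < n, Maximal (fun s : Set (Completion M) => IsChain (· ≤ ·) s ∧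
      s ⊆ Set.Icc (c i) (c (i + 1)) ∪ Set.Icc (c (i + 1)) (c i)) (σ i)) ∧
    (∀ i j, i < j → j < n → ∀ x ∈ σ i ∩ σ j, j = i + 1 ∧ x = c (i + 1)) ∧
    P = ⋃ i < n, σ i

def IsPath (a b : M) (P : Set (Completion M)) : Prop :=
  ∃ n c, IsPathAlong a b n c P

variable (M)

/-- Connected cycle-free partial orders: between two points of `M` there is exactly one path. -/
def IsCFPO : Prop := ∀ a b : M, ∃! P, IsPath a b P

/-- The connecting set of every path between points of `M` lies in `M`. -/
def IsPathComplete : Prop :=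
  ∀ (a b : M) (n : ℕ) (c : ℕ → Completion M) (P : Set (Completion M)),
    IsPathAlong a b n c P → ∀ i ≤ n, c i ∈ Set.range (toCompletion (M := M))

variable {M}

/-- `x` lies on the path from `a` to `b`. -/
def OnPath (x a b : M) : Prop := ∃ P, IsPath a b P ∧ toCompletion x ∈ P

/-! ### Cones, ramification orders and the class `K_Cone` -/

/-- The cone of `x` that contains `y`. -/
def cone (x y : M) : Set M := {t | ¬ OnPath x t y}

def IsUpCone (x : M) (C : Set M) : Prop := ∃ y, x < y ∧ C = cone x y

def IsDownCone (x : M) (C : Set M) : Prop := ∃ z, z < x ∧ C = cone x z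

/-- The upwards ramification order of `x`. -/
noncomputable def roUp (x : M) : Cardinal.{u} := Cardinal.mk {C : Set M // IsUpCone x C}

/-- The downwards ramification order of `x`. -/
noncomputable def roDown (x : M) : Cardinal.{u} := Cardinal.mk {C : Set M // IsDownCone x C}

variable (M)

def IsOneTransitive : Prop := ∀ x y : M, ∃ φ : M ≃o M, φ x = y

def IsConeTransitive : Prop :=
  IsOneTransitive M ∧ ∀ (x : M) (C D : Set M),
    (IsUpCone x C ∧ IsUpCone x D) ∨ (IsDownCone x C ∧ IsDownCone x D) →
      ∃ φ : M ≃o M, φ '' C = D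

/-- The class `K_Cone`. By transitivity the ramification orders do not depend on the point. -/
structure KCone : Prop where
  nonempty : Nonempty M
  cfpo : IsCFPO M
  pathComplete : IsPathComplete M
  coneTransitive : IsConeTransitive M
  five_le : ∀ x : M, 5 ≤ roUp x
  up_le_down : ∀ x : M, roUp x ≤ roDown x

variable {M}

/-- The betweenness relation of the order: `z` is between `x` and `y`. -/
def Between (z x y : M) : Prop := (x < z ∧ z < y) ∨ (y < z ∧ z < x)

end Paths

/-! ### The language of groups -/

inductive GroupFunc : ℕ → Type
  | one : GroupFunc 0
  | inv : GroupFunc 1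
  | mul : GroupFunc 2

/-- The first-order language of groups. -/
def groupLang : FirstOrder.Language.{0, 0} := ⟨GroupFunc, fun _ => Empty⟩

instance groupLangStructure (G : Type u) [Group G] : groupLang.Structure G where
  funMap := fun {_} F => match F with
    | GroupFunc.one => fun _ => 1
    | GroupFunc.inv => fun v => (v 0)⁻¹
    | GroupFunc.mul => fun v => v 0 * v 1
  RelMap := fun R => nomatch R

/-! ### Sixty-tuples of group elements listing a copy of `A₅` -/

/-- The alternating group on five elements; its elements index the 60-tuples. -/
abbrev A5 : Type := alternatingGroup (Fin 5)

section Group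

variable {G : Type u} [Group G]

/-- The 60-tuple `f` satisfies the (fixed) multiplication table of `A₅`, positive and negative. -/
def IsA5 (f : A5 → G) : Prop := ∀ i j k, f i * f j = f k ↔ i * j = k

def Comm (f g : A5 → G) : Prop := IsA5 f ∧ IsA5 g ∧ ∀ i j, f i * g j = g j * f i

/-- `f` lists a copy of `A₅` and is not the coordinatewise product of two commuting copies. -/
def Indec (f : A5 → G) : Prop :=
  IsA5 f ∧ ¬ ∃ g h : A5 → G, (∀ i, g i * h i = f i) ∧ Comm g h

end Group

/-- Variables for `n` pairs of 60-tuples. -/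
abbrev Vars (n : ℕ) : Type := Fin n × Fin 2 × A5

/-- The group formula `φ` holds of the `n` pairs of 60-tuples `p 0, …, p (n - 1)`. -/
def Holds {G : Type u} [Group G] {n : ℕ} (φ : groupLang.Formula (Vars n))
    (p : Fin n → Fin 2 → A5 → G) : Prop :=
  φ.Realize (fun v : Vars n => p v.1 v.2.1 v.2.2)

/-! ### How a pair of 60-tuples of automorphisms represents a point -/

section Represent

variable {M : Type u} [PartialOrder M]

/-- The support of a 60-tuple of automorphisms. -/
def supp (f : A5 → (M ≃o M)) : Set M := {x | ∃ i, f i x ≠ x}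

/-- `x` is the one point lying on every path from the support of `f` to its complement. -/
def IsBase (f : A5 → (M ≃o M)) (x : M) : Prop :=
  {z : M | ∀ t ∈ supp f, ∀ s ∉ supp f, OnPath z t s} = {x}

def ActsUpAt (f : A5 → (M ≃o M)) (x : M) : Prop :=
  Indec f ∧ IsBase f x ∧ ∃ y ∈ supp f, x < y

def ActsDownAt (f : A5 → (M ≃o M)) (x : M) : Prop :=
  Indec f ∧ IsBase f x ∧ ∃ y ∈ supp f, y < x

/-- The pair `p` represents `x`: both members are indecomposable copies of `A₅` based at `x`, and
they act in different directions. -/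
def Represents (p : Fin 2 → A5 → (M ≃o M)) (x : M) : Prop :=
  (ActsUpAt (p 0) x ∧ ActsDownAt (p 1) x) ∨ (ActsDownAt (p 0) x ∧ ActsUpAt (p 1) x)

end Represent

/-- The triple of group formulas (domain `rep`, equality `eqRep`, relation `btw`) interprets
`⟨M, B⟩` in `Aut(M)`, with coordinate map `r` taking a pair to the point it represents. The domain
consists of all pairs that represent a point. -/
def InterpretsBetweenness (rep : groupLang.Formula (Vars 1)) (eqRep : groupLang.Formula (Vars 2))
    (btw : groupLang.Formula (Vars 3)) (M : Type u) [PartialOrder M] : Prop :=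
  ∃ r : {q : Fin 2 → A5 → (M ≃o M) // Holds rep ![q]} → M,
    Function.Surjective r ∧
    (∀ p, Represents p.1 (r p)) ∧
    (∀ (p : Fin 2 → A5 → (M ≃o M)) (x : M), Represents p x → Holds rep ![p]) ∧
    (∀ p q, Holds eqRep ![p.1, q.1] ↔ r p = r q) ∧
    (∀ s p q, Holds btw ![s.1, p.1, q.1] ↔ Between (r s) (r p) (r q))

/-- Isomorphism of the betweenness reducts. -/
def BetweennessIso (M N : Type u) [PartialOrder M] [PartialOrder N] : Prop :=
  ∃ e : M ≃ N, ∀ z x y, Between z x y ↔ Between (e z) (e x) (e y)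

end CFPO

/-!
The points of `M` are recovered from the group `Aut(M)` through the copies of `A₅` it contains.

*Geometry.* In a path complete cycle-free partial order, lying on a path is a separation property:
`x` is on the path from `a` to `b` if and only if every sequence of comparabilities from `a` to `b`
jumps over or meets `x` (`onPath_iff`). It follows that the points form a median pretree in which
every cone of a point lies above or below that point (`Pretree`, `pretree`), and only these
properties are used afterwards. The main step is the gate property `TreeLike.gate` of intervals.

*Indecomposable tuples.* An action of `A₅` fixes a point, because `A₅` has no subgroup of index two
(`exists_fixed`). If an `A₅`-tuple acts at several places, it is the product of its restrictions to
one of them and to the rest; so an indecomposable tuple permutes transitively a set of cones on one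
side of one point, its base (`Indec.exists_based`, `Based`). Conversely, cone transitivity and five
cones on either side of `p` yield natural tuples, which permute five cones of `p` as `A₅` permutes
five letters (`exists_natural`), and by counting these are indecomposable (`Natural.indec`).

*Definability.* Tuples with different bases commute if neither moves the base of the other, and so
do tuples with the same base acting on different sides of it; commuting tuples fix each other's
bases. So for a pair `p` representing `x`, an indecomposable tuple commutes with neither member of
`p` if and only if it moves `x` (`RepAt.detects_iff`). This defines equality of points; combined
with the existence of natural tuples it also separates the pairs that represent a point from all other
pairs (`isRep_iff`). A point lies on the path from `x` to `y` if and only if it is fixed by all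
automorphisms of order three fixing `x` and `y` (`onPath_iff_forall_fixed`). Two points are
comparable if and only if the path between them does not turn, and at a turning point some tuple
moves both end points and fixes the turning point (`between_iff`). All of this is first-order over
the group (`exists_formulas`).

*Isomorphisms.* The formulas are preserved by group isomorphisms, so an isomorphism of the
automorphism groups induces one of the betweenness relations. As there are no end points and `M` is
connected, the latter preserves or reverses the order (`orderIso_or_dual_of_betweennessIso`), and
reversing the order exchanges the two ramification orders.
-/

namespace CFPO

/-! ### Paths in a tree-like order and the gate property -/

section Abstract

/-- The sequence `c` with all terms from the `k`-th on replaced by `p`. -/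
def cut {X : Type*} (c : ℕ → X) (k : ℕ) (p : X) : ℕ → X := fun j => if j < k then c j else p

theorem cut_lt {X : Type*} {c : ℕ → X} {k : ℕ} {p : X} {j : ℕ} (h : j < k) :
    cut c k p j = c j := if_pos h

theorem cut_self {X : Type*} {c : ℕ → X} {k : ℕ} {p : X} : cut c k p k = p := if_neg (lt_irrefl k)

variable {X : Type*} [PartialOrder X]

/-- The order interval between two points, in either order of the end points. -/
def Seg (d e : X) : Set X := Set.Icc d e ∪ Set.Icc e d

theorem Seg.subset_of_mem {d e p : X} (hp : p ∈ Seg d e) : Seg d p ⊆ Seg d e := by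
  rintro x (⟨h1, h2⟩ | ⟨h1, h2⟩) <;> rcases hp with ⟨h3, h4⟩ | ⟨h3, h4⟩
  · exact Or.inl ⟨h1, h2.trans h4⟩
  · have : d = p := le_antisymm (h1.trans h2) h4
    subst this
    exact Or.inr ⟨h3.trans h1, h2⟩
  · have : d = p := le_antisymm h3 (h1.trans h2)
    subst this
    exact Or.inl ⟨h1, h2.trans h4⟩
  · exact Or.inr ⟨h3.trans h1, h2⟩

/-- A zigzag `c 0, …, c n` whose consecutive intervals are chains that meet only where they have
to. The union of these intervals is the path along `c`. -/
structure Geo (n : ℕ) (c : ℕ → X) : Prop where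
  pos : 1 ≤ n
  comparable : ∀ i < n, c i ≤ c (i + 1) ∨ c (i + 1) ≤ c i
  alternating : ∀ i, i + 2 ≤ n →
    (c i < c (i + 1) ∧ c (i + 2) < c (i + 1)) ∨ (c (i + 1) < c i ∧ c (i + 1) < c (i + 2))
  chain : ∀ i < n, IsChain (· ≤ ·) (Seg (c i) (c (i + 1)))
  disjoint : ∀ i j, i < j → j < n → ∀ x, x ∈ Seg (c i) (c (i + 1)) →
    x ∈ Seg (c j) (c (j + 1)) → j = i + 1 ∧ x = c (i + 1)

/-- The points of the path along `c`. -/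
def pts (n : ℕ) (c : ℕ → X) : Set X := {x | ∃ i < n, x ∈ Seg (c i) (c (i + 1))}

theorem Seg.dual {d e : X} :
    Seg (OrderDual.toDual d) (OrderDual.toDual e) = OrderDual.ofDual ⁻¹' Seg d e := by
  ext x
  simp only [Seg, Set.mem_union, Set.mem_Icc, Set.mem_preimage]
  constructor
  · rintro (⟨h1, h2⟩ | ⟨h1, h2⟩)
    · exact Or.inr ⟨h2, h1⟩
    · exact Or.inl ⟨h2, h1⟩
  · rintro (⟨h1, h2⟩ | ⟨h1, h2⟩)
    · exact Or.inr ⟨h2, h1⟩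
    · exact Or.inl ⟨h2, h1⟩

theorem Geo.dual {n : ℕ} {c : ℕ → X} (h : Geo n c) :
    Geo n (fun i => OrderDual.toDual (c i)) where
  pos := h.pos
  comparable i hi := (h.comparable i hi).symm
  alternating i hi := (h.alternating i hi).symm
  chain i hi := by
    rw [Seg.dual]
    intro x hx y hy hxy
    exact (h.chain i hi hx hy hxy).symm
  disjoint i j hij hj x hx hy := by
    rw [Seg.dual] at hx hy
    exact h.disjoint i j hij hj x hx hy

theorem Geo.of_dual {n : ℕ} {c : ℕ → Xᵒᵈ} (h : Geo n c) :
    Geo n (fun i => OrderDual.ofDual (c i)) :=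
  h.dual

theorem pts_dual {n : ℕ} {c : ℕ → X} :
    pts n (fun i => OrderDual.toDual (c i)) = OrderDual.ofDual ⁻¹' pts n c := by
  ext x
  simp only [pts, Seg.dual, Set.mem_preimage, Set.mem_ofPred_eq]

theorem mem_pts_ofDual {n : ℕ} {c : ℕ → Xᵒᵈ} {x : X} :
    x ∈ pts n (fun i => OrderDual.ofDual (c i)) ↔ OrderDual.toDual x ∈ pts n c :=
  Iff.of_eq (congrArg (OrderDual.toDual x ∈ ·)
    (pts_dual (n := n) (c := fun i => OrderDual.ofDual (c i))).symm)

/-- A path can be stopped at any of its points. -/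
theorem Geo.truncate {n : ℕ} {c : ℕ → X} (h : Geo n c) {i : ℕ} (hi : i < n) {p : X}
    (hp : p ∈ Seg (c i) (c (i + 1))) (hpc : p ≠ c i) : Geo (i + 1) (cut c (i + 1) p) := by
  have hsub : ∀ j < i + 1, Seg (cut c (i + 1) p j) (cut c (i + 1) p (j + 1)) ⊆
      Seg (c j) (c (j + 1)) := by
    intro j hj
    rw [cut_lt hj]
    rcases Nat.lt_succ_iff_lt_or_eq.1 hj with hj | rfl
    · rw [cut_lt (by omega)]
    · rw [cut_self]
      exact Seg.subset_of_mem hp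
  refine ⟨by omega, ?_, ?_, fun j hj => (h.chain j (by omega)).mono (hsub j hj), ?_⟩
  · intro j hj
    rw [cut_lt hj]
    rcases Nat.lt_succ_iff_lt_or_eq.1 hj with hj | rfl
    · rw [cut_lt (by omega)]
      exact h.comparable j (by omega)
    · rw [cut_self]
      rcases hp with hp | hp
      · exact Or.inl hp.1
      · exact Or.inr hp.2
  · intro j hj
    rw [cut_lt (by omega), cut_lt (by omega : j + 1 < i + 1)]
    rcases Nat.lt_or_ge (j + 2) (i + 1) with hj' | hj'
    · rw [cut_lt hj']
      exact h.alternating j (by omega)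
    · obtain rfl : i = j + 1 := by omega
      rw [cut_self]
      rcases h.alternating j (by omega) with ⟨h1, h2⟩ | ⟨h1, h2⟩
      · refine Or.inl ⟨h1, lt_of_le_of_ne ?_ hpc⟩
        rcases hp with hp | hp
        · exact absurd (hp.1.trans hp.2) (not_le_of_gt h2)
        · exact hp.2
      · refine Or.inr ⟨h1, lt_of_le_of_ne ?_ hpc.symm⟩
        rcases hp with hp | hp
        · exact hp.1
        · exact absurd (hp.1.trans hp.2) (not_le_of_gt h2)
  · intro j k hjk hk x hx hy
    have := h.disjoint j k hjk (by omega) x (hsub j (by omega) hx) (hsub k hk hy)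
    rwa [cut_lt (by omega)]

/-- A path can be continued by a segment that leaves its end point in the opposite direction. -/
theorem Geo.extend {m : ℕ} {c : ℕ → X} (h : Geo (m + 1) c) {v : X}
    (hv : (c m < c (m + 1) ∧ v < c (m + 1)) ∨ (c (m + 1) < c m ∧ c (m + 1) < v))
    (hch : IsChain (· ≤ ·) (Seg (c (m + 1)) v))
    (hd : ∀ x ∈ Seg (c (m + 1)) v, x ∈ pts (m + 1) c → x = c (m + 1)) :
    Geo (m + 2) (cut c (m + 2) v) := by
  refine ⟨by omega, ?_, ?_, ?_, ?_⟩
  · intro j hj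
    rw [cut_lt hj]
    rcases Nat.lt_succ_iff_lt_or_eq.1 hj with hj | rfl
    · rw [cut_lt (by omega)]
      exact h.comparable j (by omega)
    · rw [cut_self]
      rcases hv with hv | hv
      · exact Or.inr hv.2.le
      · exact Or.inl hv.2.le
  · intro j hj
    rw [cut_lt (by omega), cut_lt (by omega : j + 1 < m + 2)]
    rcases Nat.lt_or_ge (j + 2) (m + 2) with hj' | hj'
    · rw [cut_lt hj']
      exact h.alternating j (by omega)
    · obtain rfl : j = m := by omega
      rw [cut_self]
      exact hv
  · intro j hj
    rw [cut_lt hj]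
    rcases Nat.lt_succ_iff_lt_or_eq.1 hj with hj | rfl
    · rw [cut_lt (by omega)]
      exact h.chain j (by omega)
    · rw [cut_self]
      exact hch
  · intro j k hjk hk x hx hy
    rw [cut_lt (by omega), cut_lt (by omega)] at hx
    rw [cut_lt (by omega)] at hy ⊢
    rcases Nat.lt_succ_iff_lt_or_eq.1 hk with hk | rfl
    · rw [cut_lt (by omega)] at hy
      exact h.disjoint j k hjk hk x hx hy
    · rw [cut_self] at hy
      have hx' := hd x hy ⟨j, hjk, hx⟩
      rcases Nat.lt_succ_iff_lt_or_eq.1 hjk with hjm | rfl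
      · exfalso
        have hm : x ∈ Seg (c m) (c (m + 1)) := by
          rw [hx']
          rcases h.comparable m (by omega) with h1 | h1
          · exact Or.inl ⟨h1, le_rfl⟩
          · exact Or.inr ⟨le_rfl, h1⟩
        obtain ⟨rfl, h2⟩ := h.disjoint j m hjm (by omega) x hx hm
        rw [hx'] at h2
        rcases hv with hv | hv
        · exact hv.1.ne h2.symm
        · exact hv.1.ne h2
      · exact ⟨rfl, hx'⟩

/-- A path ending upwards can be prolonged upwards. -/
theorem Geo.prolong {m : ℕ} {c : ℕ → X} (h : Geo (m + 1) c) {v : X}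
    (h1 : c m ≤ c (m + 1)) (h2 : c (m + 1) ≤ v)
    (hch : IsChain (· ≤ ·) (Set.Icc (c m) v))
    (hd : ∀ x ∈ Set.Icc (c (m + 1)) v, x ∈ pts (m + 1) c → x = c (m + 1)) :
    Geo (m + 1) (cut c (m + 1) v) := by
  have hseg : Seg (c m) v = Set.Icc (c m) v := by
    refine Set.union_eq_self_of_subset_right ?_
    rintro x ⟨h3, h4⟩
    exact ⟨(h1.trans h2).trans h3, h4.trans (h1.trans h2)⟩
  refine ⟨by omega, ?_, ?_, ?_, ?_⟩
  · intro j hj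
    rw [cut_lt hj]
    rcases Nat.lt_succ_iff_lt_or_eq.1 hj with hj | rfl
    · rw [cut_lt (by omega)]
      exact h.comparable j (by omega)
    · rw [cut_self]
      exact Or.inl (h1.trans h2)
  · intro j hj
    rw [cut_lt (by omega), cut_lt (by omega : j + 1 < m + 1)]
    rcases Nat.lt_or_ge (j + 2) (m + 1) with hj' | hj'
    · rw [cut_lt hj']
      exact h.alternating j (by omega)
    · obtain rfl : m = j + 1 := by omega
      rw [cut_self]
      rcases h.alternating j (by omega) with ⟨h3, h4⟩ | ⟨h3, h4⟩
      · exact absurd h1 (not_le_of_gt h4)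
      · exact Or.inr ⟨h3, h4.trans_le h2⟩
  · intro j hj
    rw [cut_lt hj]
    rcases Nat.lt_succ_iff_lt_or_eq.1 hj with hj | rfl
    · rw [cut_lt (by omega)]
      exact h.chain j (by omega)
    · rw [cut_self, hseg]
      exact hch
  · intro j k hjk hk x hx hy
    rw [cut_lt (by omega), cut_lt (by omega)] at hx
    rw [cut_lt (by omega)] at hy ⊢
    rcases Nat.lt_succ_iff_lt_or_eq.1 hk with hk | rfl
    · rw [cut_lt (by omega)] at hy
      exact h.disjoint j k hjk (by omega) x hx hy
    · rw [cut_self, hseg] at hy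
      refine h.disjoint j k hjk (by omega) x hx (Or.inl ⟨hy.1, ?_⟩)
      rcases hch.total hy ⟨h1, h2⟩ with h3 | h3
      · exact h3
      · exact (hd x ⟨h3, hy.2⟩ ⟨j, by omega, hx⟩).le

theorem pts_cut_succ {m : ℕ} {c : ℕ → X} {v x : X} (h : x ∈ pts (m + 1) (cut c (m + 1) v)) :
    x ∈ pts m c ∨ x ∈ Seg (c m) v := by
  obtain ⟨i, hi, hx⟩ := h
  rw [cut_lt hi] at hx
  rcases Nat.lt_succ_iff_lt_or_eq.1 hi with hi | rfl
  · rw [cut_lt (by omega)] at hx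
    exact Or.inl ⟨i, hi, hx⟩
  · rw [cut_self] at hx
    exact Or.inr hx

theorem mem_pts_cut {m : ℕ} {c : ℕ → X} {v x : X} (h : x ∈ pts m c ∨ x ∈ Seg (c m) v) :
    x ∈ pts (m + 1) (cut c (m + 1) v) := by
  rcases h with ⟨i, hi, hx⟩ | hx
  · refine ⟨i, by omega, ?_⟩
    rwa [cut_lt (by omega), cut_lt (by omega)]
  · refine ⟨m, by omega, ?_⟩
    rwa [cut_lt (by omega), cut_self]

theorem pts_mono {m n : ℕ} (h : m ≤ n) {c : ℕ → X} : pts m c ⊆ pts n c :=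
  fun _ ⟨i, hi, hx⟩ => ⟨i, hi.trans_le h, hx⟩

/-- The order-theoretic content of "`D` is a path complete cycle-free partial order with completion
`X`". The notion is self-dual. -/
structure TreeLike (D : Set X) : Prop where
  mem : ∀ n c, Geo n c → c 0 ∈ D → c n ∈ D → ∀ i ≤ n, c i ∈ D
  connected : ∀ a ∈ D, ∀ b ∈ D, ∃ n c, Geo n c ∧ c 0 = a ∧ c n = b
  unique : ∀ n c m d, Geo n c → Geo m d → c 0 ∈ D → c n ∈ D → c 0 = d 0 → c n = d m →
    pts n c = pts m d
  chain : ∀ d ∈ D, ∀ e ∈ D, d ≤ e → IsChain (· ≤ ·) (Set.Icc d e)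
  glb : ∀ l x y : X, l ≤ x → l ≤ y → ∃ g, ∀ z, z ≤ g ↔ z ≤ x ∧ z ≤ y
  lub : ∀ l x y : X, x ≤ l → y ≤ l → ∃ g, ∀ z, g ≤ z ↔ x ≤ z ∧ y ≤ z

theorem TreeLike.dual {D : Set X} (h : TreeLike D) : TreeLike (X := Xᵒᵈ) D where
  mem n c hc h0 hn := h.mem n _ hc.of_dual h0 hn
  connected a ha b hb := by
    obtain ⟨n, c, hc, h0, hn⟩ := h.connected a ha b hb
    exact ⟨n, _, hc.dual, h0, hn⟩
  unique n c m d hc hd h0 hn h0' hn' := by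
    have := h.unique n _ m _ hc.of_dual hd.of_dual h0 hn h0' hn'
    have h1 := pts_dual (n := n) (c := fun i => OrderDual.ofDual (c i))
    have h2 := pts_dual (n := m) (c := fun i => OrderDual.ofDual (d i))
    rw [this] at h1
    exact h1.trans h2.symm
  chain d hd e he hde := by
    intro x hx y hy hxy
    exact (h.chain e he d hd hde ⟨hx.2, hx.1⟩ ⟨hy.2, hy.1⟩ hxy).symm
  glb l x y hx hy := h.lub l x y hx hy
  lub l x y hx hy := h.glb l x y hx hy

theorem Seg.eq_Icc {d e : X} (h : d ≤ e) : Seg d e = Set.Icc d e := by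
  refine Set.union_eq_self_of_subset_right ?_
  rintro x ⟨h3, h4⟩
  exact ⟨h.trans h3, h4.trans h⟩

theorem Seg.comm (d e : X) : Seg d e = Seg e d := Set.union_comm _ _

theorem geo_one {c : ℕ → X} (h : c 0 ≤ c 1 ∨ c 1 ≤ c 0)
    (hch : IsChain (· ≤ ·) (Seg (c 0) (c 1))) : Geo 1 c where
  pos := le_rfl
  comparable i hi := by
    obtain rfl : i = 0 := by omega
    exact h
  alternating i hi := by omega
  chain i hi := by
    obtain rfl : i = 0 := by omega
    exact hch
  disjoint i j hij hj := by omega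

theorem TreeLike.chain_seg {D : Set X} (hD : TreeLike D) {d e : X} (hd : d ∈ D) (he : e ∈ D)
    (h : d ≤ e ∨ e ≤ d) : IsChain (· ≤ ·) (Seg d e) := by
  rcases h with h | h
  · rw [Seg.eq_Icc h]
    exact hD.chain d hd e he h
  · rw [Seg.comm, Seg.eq_Icc h]
    exact hD.chain e he d hd h

/-- The first point of a path in an interval of `D`, when the path enters it on an ascending
segment. -/
theorem TreeLike.gate_up {D : Set X} (hD : TreeLike D) {n : ℕ} {c : ℕ → X} (hc : Geo n c)
    (h0 : c 0 ∈ D) (hn : c n ∈ D) {u v : X} (hu : u ∈ D) (hv : v ∈ D) {i : ℕ}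
    (hi : i < n) (hmin : ∀ j < i, ∀ x ∈ Seg (c j) (c (j + 1)), x ∉ Set.Icc u v)
    {y : X} (hy : y ∈ Set.Icc u v) (hy' : y ∈ Set.Icc (c i) (c (i + 1))) :
    ∃ p ∈ D, p ∈ Set.Icc u v ∧ p ∈ pts n c ∧ ∀ w, w = u ∨ w = v →
      ∃ m d, Geo m d ∧ d 0 = c 0 ∧ d m = w ∧ p ∈ pts m d ∧ pts m d ⊆ pts n c ∪ Set.Icc u v := by
  obtain ⟨p, hp⟩ := hD.lub y (c i) u hy'.1 hy.1
  have hcp : c i ≤ p := ((hp p).1 le_rfl).1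
  have hup : u ≤ p := ((hp p).1 le_rfl).2
  have hpy : p ≤ y := (hp y).2 ⟨hy'.1, hy.1⟩
  have hpuv : p ∈ Set.Icc u v := ⟨hup, hpy.trans hy.2⟩
  have hpi : p ∈ Seg (c i) (c (i + 1)) := Or.inl ⟨hcp, hpy.trans hy'.2⟩
  have huv : u ≤ v := hy.1.trans hy.2
  have hci : ∀ j ≤ n, c j ∈ D := hD.mem n c hc h0 hn
  -- `p` is a corner of the path only at the start, since the previous segment misses the interval
  by_cases hpc : p = c i
  · rcases Nat.eq_zero_or_pos i with rfl | hipos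
    · refine ⟨p, hpc ▸ h0, hpuv, ⟨0, hi, hpi⟩, ?_⟩
      intro w hw
      have hcw : c 0 ≤ w ∨ w ≤ c 0 := by
        rw [← hpc]
        rcases hw with rfl | rfl
        · exact Or.inr hup
        · exact Or.inl hpuv.2
      have hwD : w ∈ D := by rcases hw with rfl | rfl <;> assumption
      refine ⟨1, cut c 1 w, geo_one ?_ ?_, rfl, rfl, ?_, ?_⟩
      · exact hcw
      · exact hD.chain_seg h0 hwD hcw
      · refine ⟨0, by omega, ?_⟩
        rw [hpc]
        rcases hcw with h | h
        · exact Or.inl ⟨le_rfl, h⟩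
        · exact Or.inr ⟨h, le_rfl⟩
      · rintro x ⟨j, hj, hx⟩
        obtain rfl : j = 0 := by omega
        right
        have hx : x ∈ Seg (c 0) w := hx
        rw [← hpc] at hx
        rcases hw with rfl | rfl
        · rw [Seg.comm, Seg.eq_Icc hup] at hx
          exact ⟨hx.1, hx.2.trans hpuv.2⟩
        · rw [Seg.eq_Icc hpuv.2] at hx
          exact ⟨hup.trans hx.1, hx.2⟩
    · exfalso
      obtain ⟨k, rfl⟩ : ∃ k, i = k + 1 := ⟨i - 1, by omega⟩
      refine hmin k (by omega) p ?_ hpuv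
      rw [hpc]
      rcases hc.comparable k (by omega) with h | h
      · exact Or.inl ⟨h, le_rfl⟩
      · exact Or.inr ⟨le_rfl, h⟩
  have hlt : c i < p := lt_of_le_of_ne hcp (Ne.symm hpc)
  have ht := hc.truncate hi hpi hpc
  have hti : cut c (i + 1) p i = c i := cut_lt (by omega)
  have htp : cut c (i + 1) p (i + 1) = p := cut_self
  have ht0 : cut c (i + 1) p 0 = c 0 := cut_lt (by omega)
  have htsub : pts (i + 1) (cut c (i + 1) p) ⊆ pts n c := by
    intro x hx
    rcases pts_cut_succ hx with h | h
    · exact pts_mono hi.le h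
    · exact ⟨i, hi, Seg.subset_of_mem hpi h⟩
  -- the truncated path meets the interval in its end point only
  have hfirst : ∀ x ∈ Set.Icc u v, x ∈ pts (i + 1) (cut c (i + 1) p) → x = p := by
    intro x hx hx'
    rcases pts_cut_succ hx' with ⟨j, hj, h⟩ | h
    · exact absurd hx (hmin j hj x h)
    · rw [Seg.eq_Icc hcp] at h
      exact le_antisymm h.2 ((hp x).2 ⟨h.1, hx.1⟩)
  have hpt : p ∈ pts (i + 1) (cut c (i + 1) p) :=
    mem_pts_cut (Or.inr (Or.inl ⟨hcp, le_rfl⟩))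
  have hdown : u ≠ p → Geo (i + 2) (cut (cut c (i + 1) p) (i + 2) u) := by
    intro hne
    refine ht.extend (Or.inl ?_) ?_ ?_
    · rw [hti, htp]
      exact ⟨hlt, lt_of_le_of_ne hup hne⟩
    · rw [htp, Seg.comm, Seg.eq_Icc hup]
      exact (hD.chain u hu v hv huv).mono (Set.Icc_subset_Icc le_rfl hpuv.2)
    · rw [htp, Seg.comm, Seg.eq_Icc hup]
      exact fun x hx => hfirst x ⟨hx.1, hx.2.trans hpuv.2⟩
  -- `p` is the point `u` itself or the last corner of a path from `c 0` to `u`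
  refine ⟨p, ?_, hpuv, htsub hpt, ?_⟩
  · by_cases hne : u = p
    · exact hne ▸ hu
    · have := hD.mem _ _ (hdown hne) (by rw [cut_lt (by omega), ht0]; exact h0)
        (by rw [cut_self]; exact hu) (i + 1) (by omega)
      rwa [cut_lt (by omega), htp] at this
  rintro w (rfl | rfl)
  · by_cases hne : w = p
    · exact ⟨i + 1, _, ht, ht0, htp.trans hne.symm, hpt, fun x hx => Or.inl (htsub hx)⟩
    · refine ⟨i + 2, _, hdown hne, (cut_lt (by omega)).trans ht0, cut_self, ?_, ?_⟩
      · exact mem_pts_cut (Or.inl hpt)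
      · intro x hx
        rcases pts_cut_succ hx with h | h
        · exact Or.inl (htsub h)
        · rw [htp, Seg.comm, Seg.eq_Icc hup] at h
          exact Or.inr ⟨h.1, h.2.trans hpuv.2⟩
  · have hcw : c i ≤ w := hcp.trans hpuv.2
    have hch := hD.chain (c i) (hci i hi.le) w hv hcw
    have hg : Geo (i + 1) (cut (cut c (i + 1) p) (i + 1) w) := by
      refine ht.prolong ?_ ?_ ?_ ?_
      · rw [hti, htp]
        exact hcp
      · rw [htp]
        exact hpuv.2
      · rw [hti]
        exact hch
      · rw [htp]
        exact fun x hx => hfirst x ⟨hup.trans hx.1, hx.2⟩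
    refine ⟨i + 1, _, hg, (cut_lt (by omega)).trans ht0, cut_self, ?_, ?_⟩
    · refine mem_pts_cut (Or.inr ?_)
      rw [hti]
      exact Or.inl ⟨hcp, hpuv.2⟩
    · intro x hx
      rcases pts_cut_succ hx with h | h
      · exact Or.inl (htsub (pts_mono (by omega) h))
      · rw [hti, Seg.eq_Icc hcw] at h
        rcases hch.total h ⟨hcp, hpuv.2⟩ with h3 | h3
        · exact Or.inl ⟨i, hi, Seg.subset_of_mem hpi (Or.inl ⟨h.1, h3⟩)⟩
        · exact Or.inr ⟨hup.trans h3, h.2⟩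

/-- A path that meets an interval `[u, v]` of `D` has a first point `p` in it; the point `p` belongs
to `D`, and the paths to `u` and to `v` go through `p`. -/
theorem TreeLike.gate {D : Set X} (hD : TreeLike D) {n : ℕ} {c : ℕ → X} (hc : Geo n c)
    (h0 : c 0 ∈ D) (hn : c n ∈ D) {u v : X} (hu : u ∈ D) (hv : v ∈ D)
    (hmeet : ∃ x ∈ pts n c, x ∈ Set.Icc u v) :
    ∃ p ∈ D, p ∈ Set.Icc u v ∧ p ∈ pts n c ∧ ∀ w, w = u ∨ w = v →
      ∃ m d, Geo m d ∧ d 0 = c 0 ∧ d m = w ∧ p ∈ pts m d ∧ pts m d ⊆ pts n c ∪ Set.Icc u v := by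
  classical
  have hex : ∃ i, i < n ∧ ∃ x ∈ Seg (c i) (c (i + 1)), x ∈ Set.Icc u v := by
    obtain ⟨x, ⟨i, hi, hx⟩, hx'⟩ := hmeet
    exact ⟨i, hi, x, hx, hx'⟩
  obtain ⟨hi, y, hy', hy⟩ := Nat.find_spec hex
  have hmin : ∀ j < Nat.find hex, ∀ x ∈ Seg (c j) (c (j + 1)), x ∉ Set.Icc u v :=
    fun j hj x hx hx' => Nat.find_min hex hj ⟨hj.trans hi, x, hx, hx'⟩
  rcases hy' with hy' | hy'
  · exact hD.gate_up hc h0 hn hu hv hi hmin hy hy'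
  · obtain ⟨p, hp, hp1, hp2, hp3⟩ := hD.dual.gate_up (u := OrderDual.toDual v)
      (v := OrderDual.toDual u) hc.dual h0 hn hv hu hi (y := OrderDual.toDual y)
      (by
        intro j hj x hx hx'
        rw [Seg.dual] at hx
        exact hmin j hj (OrderDual.ofDual x) hx ⟨hx'.2, hx'.1⟩)
      ⟨hy.2, hy.1⟩ ⟨hy'.2, hy'.1⟩
    rw [pts_dual] at hp2
    refine ⟨p, hp, ⟨hp1.2, hp1.1⟩, hp2, fun w hw => ?_⟩
    obtain ⟨m, d, hd, hd0, hdm, hpd, hsub⟩ := hp3 w hw.symm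
    refine ⟨m, _, hd.of_dual, hd0, hdm, ?_, ?_⟩
    · exact mem_pts_ofDual.2 hpd
    · intro x hx
      rw [pts_dual] at hsub
      have h2 := mem_pts_ofDual.1 hx
      rcases hsub h2 with h | h
      · exact Or.inl h
      · exact Or.inr ⟨h.2, h.1⟩

end Abstract

/-! ### Path complete cycle-free partial orders are tree-like -/

section Bridge

variable {M : Type u} [PartialOrder M]

theorem toCompletion_le {a b : M} : toCompletion a ≤ toCompletion b ↔ a ≤ b :=
  DedekindCut.principal_le_principal

theorem toCompletion_injective : Function.Injective (toCompletion (M := M)) := fun _ _ h =>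
  le_antisymm (toCompletion_le.1 h.le) (toCompletion_le.1 h.ge)

theorem toCompletion_lt {a b : M} : toCompletion a < toCompletion b ↔ a < b := by
  rw [lt_iff_le_not_ge, lt_iff_le_not_ge, toCompletion_le, toCompletion_le]

theorem exists_maximal_chain {X : Type*} [PartialOrder X] (S : Set X) {x : X} (hx : x ∈ S) :
    ∃ σ, x ∈ σ ∧ Maximal (fun s : Set X => IsChain (· ≤ ·) s ∧ s ⊆ S) σ := by
  obtain ⟨σ, h1, h2⟩ := zorn_subset_nonempty {s : Set X | IsChain (· ≤ ·) s ∧ s ⊆ S} (by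
    intro C hC hch _
    refine ⟨⋃₀ C, ⟨?_, Set.sUnion_subset fun s hs => (hC hs).2⟩, fun s hs =>
      Set.subset_sUnion_of_mem hs⟩
    rintro y ⟨s, hs, hy⟩ z ⟨t, ht, hz⟩ hyz
    rcases hch.total hs ht with h | h
    · exact (hC ht).1 (h hy) hz hyz
    · exact (hC hs).1 hy (h hz) hyz) {x} ⟨IsChain.singleton, Set.singleton_subset_iff.2 hx⟩
  exact ⟨σ, h1 rfl, h2⟩

/-- Any maximal chain between comparable points is a path, so by uniqueness there is only one. -/
theorem isChain_Icc (hM : IsCFPO M) {d e : M} (hde : d ≤ e) :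
    IsChain (· ≤ ·) (Set.Icc (toCompletion d) (toCompletion e)) := by
  have key : ∀ x ∈ Set.Icc (toCompletion d) (toCompletion e), ∃ σ, x ∈ σ ∧
      IsChain (· ≤ ·) σ ∧ IsPath d e σ := by
    intro x hx
    obtain ⟨σ, h1, h2⟩ := exists_maximal_chain
      (Set.Icc (toCompletion d) (toCompletion e) ∪ Set.Icc (toCompletion e) (toCompletion d))
      (Or.inl hx)
    refine ⟨σ, h1, h2.prop.1, 1, fun i => if i = 0 then toCompletion d else toCompletion e,
      ⟨le_rfl, rfl, rfl, ?_, fun i hi => by omega⟩, fun _ => σ, ?_, fun i j _ _ => by omega, ?_⟩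
    · intro i hi
      obtain rfl : i = 0 := by omega
      exact Or.inl (toCompletion_le.2 hde)
    · intro i hi
      obtain rfl : i = 0 := by omega
      exact h2
    · ext y
      simp
  intro x hx y hy hxy
  obtain ⟨σ, h1, h2, h3⟩ := key x hx
  obtain ⟨τ, h4, h5, h6⟩ := key y hy
  obtain rfl : σ = τ := (hM d e).unique h3 h6
  exact h2 h1 h4 hxy

theorem Geo.isPathAlong {n : ℕ} {c : ℕ → Completion M} (h : Geo n c) {a b : M}
    (h0 : c 0 = toCompletion a) (hn : c n = toCompletion b) : IsPathAlong a b n c (pts n c) := by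
  refine ⟨⟨h.pos, h0, hn, h.comparable, h.alternating⟩, fun i => Seg (c i) (c (i + 1)), ?_, ?_, ?_⟩
  · intro i hi
    exact ⟨⟨h.chain i hi, subset_rfl⟩, fun s hs _ => hs.2⟩
  · intro i j hij hj x hx
    exact h.disjoint i j hij hj x hx.1 hx.2
  · ext x
    simp [pts]

/-- In the path complete case the maximal chains of a path are whole intervals. -/
theorem IsPathAlong.geo (hM : IsCFPO M) (hM' : IsPathComplete M) {a b : M} {n : ℕ}
    {c : ℕ → Completion M} {P : Set (Completion M)} (h : IsPathAlong a b n c P) :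
    Geo n c ∧ P = pts n c := by
  have hD := hM' a b n c P h
  obtain ⟨⟨h1, h2, h3, h4, h5⟩, σ, h6, h7, h8⟩ := h
  have hch : ∀ i < n, IsChain (· ≤ ·) (Seg (c i) (c (i + 1))) := by
    intro i hi
    obtain ⟨d, hd⟩ := hD i hi.le
    obtain ⟨e, he⟩ := hD (i + 1) hi
    rw [← hd, ← he]
    rcases h4 i hi with h | h
    · rw [Seg.eq_Icc (by rwa [hd, he])]
      rw [← hd, ← he, toCompletion_le] at h
      exact isChain_Icc hM h
    · rw [Seg.comm, Seg.eq_Icc (by rwa [hd, he])]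
      rw [← hd, ← he, toCompletion_le] at h
      exact isChain_Icc hM h
  have hσ : ∀ i < n, σ i = Seg (c i) (c (i + 1)) := fun i hi =>
    Set.Subset.antisymm (h6 i hi).prop.2
      ((h6 i hi).le_of_ge ⟨hch i hi, subset_rfl⟩ (h6 i hi).prop.2)
  refine ⟨⟨h1, h4, h5, hch, ?_⟩, ?_⟩
  · intro i j hij hj x hx hy
    refine h7 i j hij hj x ⟨?_, ?_⟩
    · rwa [hσ i (by omega)]
    · rwa [hσ j hj]
  · rw [h8]
    ext x
    simp only [Set.mem_iUnion, pts, Set.mem_ofPred_eq, exists_prop]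
    exact exists_congr fun i => and_congr_right fun hi => by rw [hσ i hi]

theorem treeLike (hM : IsCFPO M) (hM' : IsPathComplete M) :
    TreeLike (Set.range (toCompletion (M := M))) where
  mem := by
    rintro n c hc ⟨a, ha⟩ ⟨b, hb⟩
    exact hM' a b n c _ (hc.isPathAlong ha.symm hb.symm)
  connected := by
    rintro _ ⟨a, rfl⟩ _ ⟨b, rfl⟩
    obtain ⟨P, ⟨n, c, h⟩, -⟩ := hM a b
    exact ⟨n, c, (h.geo hM hM').1, h.1.first, h.1.last⟩
  unique := by
    rintro n c m d hc hd ⟨a, ha⟩ ⟨b, hb⟩ h0 hn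
    exact (hM a b).unique ⟨n, c, hc.isPathAlong ha.symm hb.symm⟩
      ⟨m, d, hd.isPathAlong (h0 ▸ ha.symm) (hn ▸ hb.symm)⟩
  chain := by
    rintro _ ⟨a, rfl⟩ _ ⟨b, rfl⟩ h
    exact isChain_Icc hM (toCompletion_le.1 h)
  glb := by
    intro l x y hx hy
    have hl : l.1 ≤ x.1 ⊓ y.1 := le_inf hx hy
    refine ⟨⟨x.1 ⊓ y.1, ?_, ?_⟩, fun z =>
      (le_inf_iff : z.1 ≤ x.1 ⊓ y.1 ↔ z.1 ≤ x.1 ∧ z.1 ≤ y.1)⟩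
    · exact l.2.1.mono (Concept.extent_subset_extent_iff.2 hl)
    · exact x.2.2.mono (Concept.intent_subset_intent_iff.2 inf_le_left)
  lub := by
    intro l x y hx hy
    have hl : x.1 ⊔ y.1 ≤ l.1 := sup_le hx hy
    refine ⟨⟨x.1 ⊔ y.1, ?_, ?_⟩, fun z =>
      (sup_le_iff : x.1 ⊔ y.1 ≤ z.1 ↔ x.1 ≤ z.1 ∧ y.1 ≤ z.1)⟩
    · exact x.2.1.mono (Concept.extent_subset_extent_iff.2 le_sup_left)
    · exact l.2.2.mono (Concept.intent_subset_intent_iff.2 hl)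

/-- `u` and `v` are comparable, and `x` is not in the interval between them. -/
def Adj (x u v : M) : Prop := (u ≤ v ∨ v ≤ u) ∧ ¬ (u ≤ x ∧ x ≤ v) ∧ ¬ (v ≤ x ∧ x ≤ u)

theorem Adj.symm {x u v : M} (h : Adj x u v) : Adj x v u := ⟨h.1.symm, h.2.2, h.2.1⟩

/-- `u` and `v` are joined by a sequence of comparabilities that avoids `x`. -/
def Linked (x : M) : M → M → Prop := Relation.TransGen (Adj x)

theorem mem_seg_iff {x u v : M} :
    toCompletion x ∈ Seg (toCompletion u) (toCompletion v) ↔ (u ≤ x ∧ x ≤ v) ∨ (v ≤ x ∧ x ≤ u) := by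
  simp only [Seg, Set.mem_union, Set.mem_Icc, toCompletion_le]

theorem Geo.linked {n : ℕ} {c : ℕ → Completion M} (h : Geo n c)
    (hD : ∀ i ≤ n, c i ∈ Set.range (toCompletion (M := M))) {x u v : M} {i k : ℕ} (hik : i < k)
    (hk : k ≤ n) (hx : ∀ j, i ≤ j → j < k → toCompletion x ∉ Seg (c j) (c (j + 1)))
    (hu : c i = toCompletion u) (hv : c k = toCompletion v) : Linked x u v := by
  have hadj : ∀ j, i ≤ j → j < k → ∀ s t : M, c j = toCompletion s →
      c (j + 1) = toCompletion t → Adj x s t := by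
    intro j hij hjk s t hs ht
    have h1 := hx j hij hjk
    have h2 := h.comparable j (by omega)
    rw [hs, ht] at h1 h2
    rw [toCompletion_le, toCompletion_le] at h2
    rw [mem_seg_iff, not_or] at h1
    exact ⟨h2, h1⟩
  induction k, hik using Nat.le_induction generalizing v with
  | base => exact .single (hadj i le_rfl (by omega) u v hu hv)
  | succ k hik ih =>
    obtain ⟨w, hw⟩ := hD k (by omega)
    exact .tail (ih (by omega) (fun j h1 h2 => hx j h1 (by omega)) hw.symm
      (fun j h1 h2 => hadj j h1 (by omega))) (hadj k (by omega) (by omega) w v hw.symm hv)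

theorem end_mem_pts {X : Type*} [PartialOrder X] {n : ℕ} {c : ℕ → X} (h : Geo n c) :
    c n ∈ pts n c := by
  obtain ⟨m, rfl⟩ : ∃ m, n = m + 1 := ⟨n - 1, by have := h.pos; omega⟩
  refine ⟨m, by omega, ?_⟩
  rcases h.comparable m (by omega) with h | h
  · exact Or.inl ⟨h, le_rfl⟩
  · exact Or.inr ⟨le_rfl, h⟩

theorem onPath_iff_geo (hM : IsCFPO M) {a b x : M} {n : ℕ} {c : ℕ → Completion M} (h : Geo n c)
    (h0 : c 0 = toCompletion a) (hn : c n = toCompletion b) :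
    OnPath x a b ↔ toCompletion x ∈ pts n c := by
  refine ⟨?_, fun hx => ⟨_, ⟨n, c, h.isPathAlong h0 hn⟩, hx⟩⟩
  rintro ⟨Q, hQ, hx⟩
  rwa [(hM a b).unique ⟨n, c, h.isPathAlong h0 hn⟩ hQ]

theorem onPath_of_le (hM : IsCFPO M) {x a b : M} (hab : a ≤ b) : OnPath x a b ↔ a ≤ x ∧ x ≤ b := by
  have hg : Geo 1 (fun i => if i = 0 then toCompletion a else toCompletion b) := by
    refine geo_one (Or.inl (toCompletion_le.2 hab)) ?_
    change IsChain _ (Seg (toCompletion a) (toCompletion b))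
    rw [Seg.eq_Icc (toCompletion_le.2 hab)]
    exact isChain_Icc hM hab
  rw [onPath_iff_geo hM hg rfl rfl]
  constructor
  · rintro ⟨i, hi, hx⟩
    obtain rfl : i = 0 := by omega
    rcases mem_seg_iff.1 hx with h | h
    · exact h
    · exact ⟨hab.trans h.1, h.2.trans hab⟩
  · intro h
    exact ⟨0, by omega, mem_seg_iff.2 (Or.inl h)⟩

variable (hM : IsCFPO M) (hM' : IsPathComplete M)

include hM hM'

theorem exists_geo (a b : M) : ∃ n, ∃ c : ℕ → Completion M, Geo n c ∧ c 0 = toCompletion a ∧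
    c n = toCompletion b ∧ (∀ i ≤ n, c i ∈ Set.range (toCompletion (M := M))) ∧
    ∀ x, OnPath x a b ↔ toCompletion x ∈ pts n c := by
  obtain ⟨P, ⟨n, c, h⟩, hu⟩ := hM a b
  obtain ⟨h1, h2⟩ := h.geo hM hM'
  refine ⟨n, c, h1, h.1.first, h.1.last, hM' _ _ _ _ _ h, fun x => ⟨?_, fun hx => ?_⟩⟩
  · rintro ⟨Q, hQ, hx⟩
    rwa [← h2, ← hu Q hQ]
  · exact ⟨P, ⟨n, c, h⟩, h2 ▸ hx⟩

/-- Seen from `a`, the interval `[u, v]` has a gate `p`, and the paths from `a` to `u` and to `v`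
differ from each other only inside the interval. -/
theorem exists_gate (a : M) {u v : M} (w : M) (hw : w = u ∨ w = v) (huv : u ≤ v) :
    ∃ p, u ≤ p ∧ p ≤ v ∧ OnPath p a u ∧ OnPath p a v ∧
      ∀ x, (OnPath x a u ∨ OnPath x a v) → OnPath x a w ∨ (u ≤ x ∧ x ≤ v) := by
  obtain ⟨n, c, hc, h0, hn, hD, hon⟩ := exists_geo hM hM' a w
  obtain ⟨_, ⟨p, rfl⟩, h1, h2, h3⟩ := (treeLike hM hM').gate hc ⟨a, h0.symm⟩ ⟨w, hn.symm⟩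
    ⟨u, rfl⟩ ⟨v, rfl⟩ ⟨c n, end_mem_pts hc, by
      rw [hn, Set.mem_Icc, toCompletion_le, toCompletion_le]
      rcases hw with rfl | rfl
      · exact ⟨le_rfl, huv⟩
      · exact ⟨huv, le_rfl⟩⟩
  rw [Set.mem_Icc, toCompletion_le, toCompletion_le] at h1
  obtain ⟨m, d, hd, hd0, hdm, hpd, hsub⟩ := h3 _ (Or.inl rfl)
  obtain ⟨m', d', hd', hd0', hdm', hpd', hsub'⟩ := h3 _ (Or.inr rfl)
  rw [h0] at hd0 hd0'
  have hx : ∀ x : M, toCompletion x ∈ pts n c ∪ Set.Icc (toCompletion u) (toCompletion v) →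
      OnPath x a w ∨ (u ≤ x ∧ x ≤ v) := by
    rintro x (h | h)
    · exact Or.inl ((hon x).2 h)
    · rw [Set.mem_Icc, toCompletion_le, toCompletion_le] at h
      exact Or.inr h
  refine ⟨p, h1.1, h1.2, (onPath_iff_geo hM hd hd0 hdm).2 hpd,
    (onPath_iff_geo hM hd' hd0' hdm').2 hpd', ?_⟩
  rintro x (h | h)
  · exact hx x (hsub ((onPath_iff_geo hM hd hd0 hdm).1 h))
  · exact hx x (hsub' ((onPath_iff_geo hM hd' hd0' hdm').1 h))

/-- Lying on a path is a separation property: it refers to no completion, and it is visibly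
invariant under automorphisms and under reversal of the order. -/
theorem onPath_iff {x a b : M} : OnPath x a b ↔ ¬ Linked x a b := by
  constructor
  · intro h hl
    induction hl with
    | single hab =>
      rcases hab.1 with h1 | h1
      · exact hab.2.1 ((onPath_of_le hM h1).1 h)
      · obtain ⟨p, -, -, -, -, hp⟩ := exists_gate hM hM' a a (Or.inr rfl) h1
        rcases hp x (Or.inl h) with h2 | h2
        · obtain rfl : x = a := by
            have := (onPath_of_le hM le_rfl).1 h2
            exact le_antisymm this.2 this.1
          exact hab.2.2 ⟨h1, le_rfl⟩
        · exact hab.2.2 h2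
    | @tail v w _ hvw ih =>
      refine ih ?_
      rcases hvw.1 with h1 | h1
      · obtain ⟨p, -, -, -, -, hp⟩ := exists_gate hM hM' a v (Or.inl rfl) h1
        exact (hp x (Or.inr h)).resolve_right hvw.2.1
      · obtain ⟨p, -, -, -, -, hp⟩ := exists_gate hM hM' a v (Or.inr rfl) h1
        exact (hp x (Or.inl h)).resolve_right hvw.2.2
  · intro h
    by_contra hx
    obtain ⟨n, c, hc, h0, hn, hD, hon⟩ := exists_geo hM hM' a b
    rw [hon] at hx
    exact h (hc.linked hD hc.pos le_rfl (fun j _ hj hxj => hx ⟨j, hj, hxj⟩) h0 hn)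

end Bridge

/-! ### The pretree of a cycle-free partial order -/

section Pretree

variable {M : Type u} [PartialOrder M]

theorem Linked.symm {x a b : M} (h : Linked x a b) : Linked x b a := by
  induction h with
  | single h => exact .single h.symm
  | tail _ h ih => exact .head h.symm ih

/-- `t` lies in an upwards cone of `x`. -/
def Above (x t : M) : Prop := ∃ y, x < y ∧ ¬ OnPath x t y

/-- `t` lies in a downwards cone of `x`. -/
def Below (x t : M) : Prop := ∃ y, y < x ∧ ¬ OnPath x t y

/-- The properties of the relation `OnPath` in path complete cycle-free partial orders on which
everything else rests: it is the betweenness relation of a median pretree, and every cone lies on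
exactly one side of its base. -/
class Pretree (M : Type u) [PartialOrder M] : Prop where
  iff_linked : ∀ {x a b : M}, OnPath x a b ↔ ¬ Linked x a b
  of_le : ∀ {x a b : M}, a ≤ b → (OnPath x a b ↔ a ≤ x ∧ x ≤ b)
  antisymm : ∀ {a x y : M}, OnPath x a y → OnPath y a x → x = y
  above_or_below : ∀ {x t : M}, t ≠ x → Above x t ∨ Below x t
  gate : ∀ (a : M) {u v : M}, u ≤ v → ∃ p, OnPath p a u ∧ OnPath p a v ∧ OnPath p u v
  connected : ∀ a b : M, Relation.ReflTransGen (fun u v => u ≤ v ∨ v ≤ u) a b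
  turn : ∀ {x y : M}, ¬ x ≤ y → ¬ y ≤ x → ∃ w, OnPath w x y ∧ w ≠ x ∧ w ≠ y ∧
    ((Above w x ∧ Above w y) ∨ (Below w x ∧ Below w y))

theorem eq_of_mem_seg {X : Type*} [PartialOrder X] {d x y : X} (h1 : x ∈ Seg d y)
    (h2 : y ∈ Seg d x) : x = y := by
  rcases h1 with h1 | h1 <;> rcases h2 with h2 | h2
  · exact le_antisymm h1.2 h2.2
  · exact le_antisymm h1.2 (h2.2.trans h1.1)
  · exact le_antisymm (h1.2.trans h2.1) h2.2
  · exact le_antisymm h2.1 h1.1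

theorem left_mem_seg {X : Type*} [PartialOrder X] {d e : X} (h : d ≤ e ∨ e ≤ d) : d ∈ Seg d e := by
  rcases h with h | h
  · exact Or.inl ⟨le_rfl, h⟩
  · exact Or.inr ⟨h, le_rfl⟩

theorem right_mem_seg {X : Type*} [PartialOrder X] {d e : X} (h : d ≤ e ∨ e ≤ d) :
    e ∈ Seg d e := by
  rw [Seg.comm]
  exact left_mem_seg h.symm

theorem Geo.succ_ne {X : Type*} [PartialOrder X] {n : ℕ} {c : ℕ → X} (h : Geo n c) (hn : 2 ≤ n)
    {i : ℕ} (hi : i < n) : c (i + 1) ≠ c i := by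
  rcases Nat.lt_or_ge (i + 1) n with h1 | h1
  · rcases h.alternating i h1 with h2 | h2
    · exact h2.1.ne'
    · exact h2.1.ne
  · obtain ⟨j, rfl⟩ : ∃ j, i = j + 1 := ⟨i - 1, by omega⟩
    rcases h.alternating j (by omega) with h2 | h2
    · exact h2.2.ne
    · exact h2.2.ne'

theorem pretree (hM : IsCFPO M) (hM' : IsPathComplete M) : Pretree M := by
  have hself : ∀ {x a : M}, OnPath x a a → x = a := fun h => by
    have := (onPath_of_le hM le_rfl).1 h
    exact le_antisymm this.2 this.1
  refine ⟨onPath_iff hM hM', onPath_of_le hM, ?_, ?_, ?_, ?_, ?_⟩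
  · intro a x y hx hy
    classical
    obtain ⟨n, c, hc, h0, hn, hD, hon⟩ := exists_geo hM hM' a x
    have hex : ∃ i, i < n ∧ toCompletion y ∈ Seg (c i) (c (i + 1)) := (hon y).1 hy
    obtain ⟨hi, hyi⟩ := Nat.find_spec hex
    set i := Nat.find hex with hi_def
    have hmin : ∀ j < i, toCompletion y ∉ Seg (c j) (c (j + 1)) :=
      fun j hj h => Nat.find_min hex hj ⟨hj.trans hi, h⟩
    by_cases hyc : toCompletion y = c i
    · rcases Nat.eq_zero_or_pos i with h | h
      · rw [h, h0] at hyc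
        obtain rfl := toCompletion_injective hyc
        exact hself hx
      · obtain ⟨j, hj⟩ : ∃ j, i = j + 1 := ⟨i - 1, by omega⟩
        refine absurd ?_ (hmin j (by omega))
        rw [hyc, hj]
        exact right_mem_seg (hc.comparable j (by omega))
    have hx' := (onPath_iff_geo hM (hc.truncate hi hyi hyc) ((cut_lt (by omega)).trans h0)
      cut_self).1 hx
    have hlast : ∀ j < n, toCompletion x ∈ Seg (c j) (c (j + 1)) → j + 1 = n := by
      intro j hj hxj
      by_contra hne
      rw [← hn] at hxj
      obtain ⟨k, rfl⟩ : ∃ k, n = k + 1 := ⟨n - 1, by omega⟩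
      obtain ⟨rfl, h2⟩ := hc.disjoint j k (by omega) (by omega) _ hxj
        (right_mem_seg (hc.comparable k (by omega)))
      exact hc.succ_ne (by omega) (by omega) h2
    rcases pts_cut_succ hx' with ⟨j, hj, hxj⟩ | h
    · have := hlast j (by omega) hxj
      omega
    · have := hlast i hi (Seg.subset_of_mem hyi h)
      rw [this, hn] at hyi
      exact toCompletion_injective (eq_of_mem_seg h hyi)
  · intro x t htx
    obtain ⟨n, c, hc, h0, hn, hD, hon⟩ := exists_geo hM hM' x t
    obtain ⟨y, hy⟩ := hD 1 hc.pos
    have hne : c 1 ≠ c 0 := by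
      rcases Nat.lt_or_ge n 2 with h | h
      · obtain rfl : n = 1 := by have := hc.pos; omega
        rw [h0, hn]
        exact fun h => htx (toCompletion_injective h)
      · exact hc.succ_ne h (by omega)
    have hyt : ¬ OnPath x t y := by
      rw [onPath_iff hM hM', not_not]
      rcases Nat.lt_or_ge n 2 with h | h
      · obtain rfl : n = 1 := by have := hc.pos; omega
        obtain rfl : y = t := toCompletion_injective (hy.trans hn)
        exact .single ⟨Or.inl le_rfl, fun h => htx (le_antisymm h.1 h.2),
          fun h => htx (le_antisymm h.1 h.2)⟩
      · refine (hc.linked hD (i := 1) (k := n) h le_rfl ?_ hy.symm hn).symm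
        intro j hj1 hj2 hx
        rw [← h0] at hx
        obtain ⟨rfl, h2⟩ := hc.disjoint 0 j (by omega) hj2 _
          (left_mem_seg (hc.comparable 0 (by omega))) hx
        exact hne h2.symm
    rw [h0, ← hy] at hne
    have h1 := hc.comparable 0 hc.pos
    rw [h0, zero_add, ← hy, toCompletion_le, toCompletion_le] at h1
    have hne' : y ≠ x := fun h => hne (h ▸ rfl)
    rcases h1 with h1 | h1
    · exact Or.inl ⟨y, lt_of_le_of_ne h1 hne'.symm, hyt⟩
    · exact Or.inr ⟨y, lt_of_le_of_ne h1 hne', hyt⟩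
  · intro a u v huv
    obtain ⟨p, h1, h2, h3, h4, -⟩ := exists_gate hM hM' a u (Or.inl rfl) huv
    exact ⟨p, h3, h4, (onPath_of_le hM huv).2 ⟨h1, h2⟩⟩
  · intro a b
    obtain ⟨n, c, hc, h0, hn, hD, -⟩ := exists_geo hM hM' a b
    have : ∀ k ≤ n, ∀ v : M, c k = toCompletion v →
        Relation.ReflTransGen (fun u v => u ≤ v ∨ v ≤ u) a v := by
      intro k
      induction k with
      | zero =>
        intro _ v hv
        obtain rfl := toCompletion_injective (h0.symm.trans hv)
        exact .refl
      | succ k ih =>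
        intro hk v hv
        obtain ⟨w, hw⟩ := hD k (by omega)
        have h1 := hc.comparable k (by omega)
        rw [hv, ← hw, toCompletion_le, toCompletion_le] at h1
        exact (ih (by omega) w hw.symm).tail h1
    exact this n le_rfl b hn
  · intro x y hxy hyx
    obtain ⟨n, c, hc, h0, hn, hD, hon⟩ := exists_geo hM hM' x y
    have hn2 : 2 ≤ n := by
      by_contra hlt
      obtain rfl : n = 1 := by have := hc.pos; omega
      have h1 := hc.comparable 0 (by omega)
      rw [h0, zero_add, hn, toCompletion_le, toCompletion_le] at h1
      exact h1.elim hxy hyx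
    obtain ⟨w, hw⟩ := hD 1 hc.pos
    obtain ⟨z, hz⟩ := hD 2 hn2
    have hwx : w ≠ x := by
      rintro rfl
      exact hc.succ_ne hn2 (i := 0) (by omega) (hw.symm.trans h0.symm)
    have hnot : ∀ j, 2 ≤ j → j < n → toCompletion w ∉ Seg (c j) (c (j + 1)) := by
      intro j hj2 hjn hwj
      rw [hw] at hwj
      have := hc.disjoint 0 j (by omega) hjn _ (right_mem_seg (hc.comparable 0 (by omega))) hwj
      omega
    have hzw : z ≠ w := by
      rintro rfl
      exact hc.succ_ne hn2 (i := 1) (by omega) (hz.symm.trans hw)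
    have hyz : ¬ OnPath w y z := by
      rw [onPath_iff hM hM', not_not]
      rcases Nat.lt_or_ge 2 n with h | h
      · exact (hc.linked hD (i := 2) (k := n) h le_rfl hnot hz.symm hn).symm
      · obtain rfl : n = 2 := by omega
        obtain rfl : z = y := toCompletion_injective (hz.trans hn)
        exact .single ⟨Or.inl le_rfl, fun h => hzw (le_antisymm h.1 h.2),
          fun h => hzw (le_antisymm h.1 h.2)⟩
    have hwy : w ≠ y := by
      rintro rfl
      refine hyz ?_
      rw [onPath_iff hM hM']
      intro h
      obtain ⟨s, hs, -⟩ := Relation.TransGen.head'_iff.1 h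
      rcases hs.1 with h1 | h1
      · exact hs.2.1 ⟨le_rfl, h1⟩
      · exact hs.2.2 ⟨h1, le_rfl⟩
    refine ⟨w, (hon w).2 ⟨0, by omega, ?_⟩, hwx, hwy, ?_⟩
    · rw [hw]
      exact right_mem_seg (hc.comparable 0 (by omega))
    · have h1 := hc.alternating 0 (by omega)
      simp only [zero_add] at h1
      rw [h0, ← hw, ← hz] at h1
      simp only [toCompletion_lt] at h1
      have hxx : ¬ OnPath w x x := fun h => hwx (hself h)
      rcases h1 with h1 | h1
      · exact Or.inr ⟨⟨x, h1.1, hxx⟩, ⟨z, h1.2, hyz⟩⟩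
      · exact Or.inl ⟨⟨x, h1.1, hxx⟩, ⟨z, h1.2, hyz⟩⟩

end Pretree

/-! ### Invariance of paths under isomorphisms -/

section Transport

variable {M N : Type u} [PartialOrder M] [PartialOrder N]

theorem Linked.map {e : M → N} (he : ∀ x u v, Adj x u v → Adj (e x) (e u) (e v)) {x a b : M}
    (h : Linked x a b) : Linked (e x) (e a) (e b) :=
  Relation.TransGen.lift e (fun u v => he x u v) _ _ h

theorem adj_map (e : M ≃o N) (x u v : M) (h : Adj x u v) : Adj (e x) (e u) (e v) := by
  simpa only [Adj, e.le_iff_le] using h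

theorem adj_map_dual (e : M ≃o Nᵒᵈ) (x u v : M) (h : Adj x u v) :
    Adj (M := N) (e x) (e u) (e v) := by
  have key : ∀ s t : M, (OrderDual.ofDual (e s) ≤ OrderDual.ofDual (e t)) ↔ t ≤ s :=
    fun s t => e.le_iff_le
  change Adj (M := N) (OrderDual.ofDual (e x)) (OrderDual.ofDual (e u)) (OrderDual.ofDual (e v))
  simp only [Adj, key]
  exact ⟨h.1.symm, fun h' => h.2.2 h'.symm, fun h' => h.2.1 h'.symm⟩

theorem adj_map_dual_symm (e : M ≃o Nᵒᵈ) (x u v : N) (h : Adj x u v) :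
    Adj (e.symm x) (e.symm u) (e.symm v) := by
  have key : ∀ s t : N, e.symm s ≤ e.symm t ↔ t ≤ s := fun s t => e.symm.le_iff_le
  simp only [Adj, key]
  exact ⟨h.1.symm, fun h' => h.2.2 h'.symm, fun h' => h.2.1 h'.symm⟩

variable [Pretree M] [Pretree N]

theorem onPath_map_iff {e : M ≃ N} (he : ∀ x u v, Adj x u v → Adj (e x) (e u) (e v))
    (he' : ∀ x u v, Adj x u v → Adj (e.symm x) (e.symm u) (e.symm v)) {x a b : M} :
    OnPath (e x) (e a) (e b) ↔ OnPath x a b := by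
  rw [Pretree.iff_linked, Pretree.iff_linked, not_iff_not]
  refine ⟨fun h => ?_, fun h => h.map he⟩
  simpa using h.map he'

end Transport

/-! ### Paths, medians and sides of a point -/

section Basic

variable {M : Type u} [PartialOrder M] [Pretree M]

theorem onPath_map (φ : M ≃o M) {x a b : M} : OnPath (φ x) (φ a) (φ b) ↔ OnPath x a b :=
  onPath_map_iff (e := φ.toEquiv) (adj_map φ) (adj_map φ.symm)

theorem OnPath.symm {x a b : M} (h : OnPath x a b) : OnPath x b a := by
  rw [Pretree.iff_linked] at h ⊢
  exact fun h' => h h'.symm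

theorem onPath_self {x a : M} : OnPath x a a ↔ x = a := by
  rw [Pretree.of_le le_rfl]
  exact ⟨fun h => le_antisymm h.2 h.1, fun h => h ▸ ⟨le_rfl, le_rfl⟩⟩

theorem onPath_left (a b : M) : OnPath a a b := by
  rw [Pretree.iff_linked]
  intro h
  obtain ⟨s, hs, -⟩ := Relation.TransGen.head'_iff.1 h
  rcases hs.1 with h1 | h1
  · exact hs.2.1 ⟨le_rfl, h1⟩
  · exact hs.2.2 ⟨h1, le_rfl⟩

theorem onPath_right (a b : M) : OnPath b a b := (onPath_left b a).symm

theorem OnPath.trans_or {x a c : M} (h : OnPath x a c) (b : M) : OnPath x a b ∨ OnPath x b c := by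
  simp only [Pretree.iff_linked] at h ⊢
  by_contra h'
  rw [not_or, not_not, not_not] at h'
  exact h (h'.1.trans h'.2)

theorem eq_of_onPath_of_onPath {a x y : M} (h : OnPath x a y) (h' : OnPath y a x) : x = y :=
  Pretree.antisymm h h'

/-- A point on both halves of a path is its middle point. -/
theorem eq_mid {a b x y : M} (h1 : OnPath y a x) (h2 : OnPath y x b) (h : OnPath x a b) :
    y = x := by
  rcases h.trans_or y with h3 | h3
  · exact eq_of_onPath_of_onPath h1 h3
  · exact eq_of_onPath_of_onPath h2.symm h3.symm

theorem OnPath.sub {a b x y : M} (h : OnPath x a b) (h' : OnPath y a x) : OnPath y a b := by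
  rcases h'.trans_or b with h1 | h1
  · exact h1
  · obtain rfl := eq_mid h' h1.symm h
    exact h

/-- The points of a path are linearly ordered by their distance from its origin. -/
theorem OnPath.total {a b u v : M} (hu : OnPath u a b) (hv : OnPath v a b) :
    OnPath u a v ∨ OnPath v a u := by
  rcases hu.trans_or v with h1 | h1
  · exact Or.inl h1
  rcases hv.trans_or u with h2 | h2
  · exact Or.inr h2
  obtain rfl := eq_of_onPath_of_onPath h1.symm h2.symm
  exact Or.inl (onPath_right _ _)

/-- `m` is the median of `a`, `b` and `c`. -/
def IsMedian (m a b c : M) : Prop := OnPath m a b ∧ OnPath m b c ∧ OnPath m a c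

theorem exists_median (a b c : M) : ∃ m, IsMedian m a b c := by
  induction Pretree.connected b c generalizing a with
  | refl => exact ⟨b, onPath_right _ _, onPath_right _ _, onPath_right _ _⟩
  | @tail c d _ hcd ih =>
    have gate : ∀ a, ∃ p, OnPath p a c ∧ OnPath p a d ∧ OnPath p c d := by
      intro a
      rcases hcd with h | h
      · exact Pretree.gate a h
      · obtain ⟨p, h1, h2, h3⟩ := Pretree.gate a h
        exact ⟨p, h2, h1, h3.symm⟩
    obtain ⟨m, m1, m2, m3⟩ := ih a
    obtain ⟨n, n1, n2, n3⟩ := gate b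
    obtain ⟨r, r1, r2, r3⟩ := gate a
    -- the median is one of `m`, `n`, `r`, according to the leg on which `a` branches off
    have hmn : m = n → ∃ q, IsMedian q a b d := by
      rintro rfl
      rcases r3.trans_or m with h | h
      · have : r = m := by
          rcases r2.trans_or m with h' | h'
          · exact eq_mid h' h.symm m3
          · exact eq_mid h h' n3
        subst this
        exact ⟨r, m1, n2, r2⟩
      · refine ⟨r, ?_, (n2.symm.sub h.symm).symm, r2⟩
        rcases r1.trans_or b with h' | h'
        · exact h'
        · have : r = m := by
            rcases h'.trans_or m with h'' | h''
            · exact eq_mid h'' h n2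
            · exact eq_mid h''.symm h n3
          rwa [this]
    rcases m2.total n1 with h | h
    · rcases m3.trans_or d with h' | h'
      · exact ⟨m, m1, n2.sub h, h'⟩
      · refine hmn ?_
        rcases h'.symm.trans_or n with h'' | h''
        · exact eq_mid h h''.symm n1
        · exact eq_mid h h'' n2
    · rcases n3.trans_or a with h' | h'
      · refine hmn (Eq.symm ?_)
        rcases h'.symm.trans_or m with h'' | h''
        · exact eq_mid h'' h.symm m1
        · exact eq_mid h h'' m2
      · exact ⟨n, (m1.symm.sub h).symm, n2, h'⟩

theorem IsMedian.unique {m n a b c : M} (hm : IsMedian m a b c) (hn : IsMedian n a b c) :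
    m = n := by
  obtain ⟨m1, m2, m3⟩ := hm
  obtain ⟨n1, n2, n3⟩ := hn
  rcases m1.total n1 with h | h
  · rcases m2.symm.trans_or n with h1 | h1
    · rcases m3.trans_or n with h2 | h2
      · exact eq_mid h2 h1.symm n3
      · exact eq_mid h h2 n3
    · exact eq_mid h h1 n1
  · rcases n2.symm.trans_or m with h1 | h1
    · rcases n3.trans_or m with h2 | h2
      · exact (eq_mid h2 h1.symm m3).symm
      · exact (eq_mid h h2 m3).symm
    · exact (eq_mid h h1 m1).symm

/-- The paths from `a` to the points of a finite set have a last common point, which lies in the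
same cone of `a` as the set if the set lies in one cone. -/
theorem exists_last_common (a : M) {S : Set M} (hS : S.Finite) (hne : S.Nonempty) :
    ∃ m, (∀ s ∈ S, OnPath m a s) ∧ (∀ q, (∀ s ∈ S, OnPath q a s) → OnPath q a m) ∧
      ((∀ s ∈ S, ∀ t ∈ S, ¬ OnPath a s t) → ∀ s ∈ S, ¬ OnPath a s m) := by
  induction S, hS using Set.Finite.induction_on with
  | empty => exact absurd hne Set.not_nonempty_empty
  | @insert s S _ _ ih =>
    rcases S.eq_empty_or_nonempty with rfl | hne'
    · refine ⟨s, ?_, fun q hq => hq s (Set.mem_insert _ _),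
        fun h t ht => h t ht s (Set.mem_insert _ _)⟩
      rintro t (rfl | ht)
      · exact onPath_right _ _
      · exact absurd ht (Set.notMem_empty _)
    · obtain ⟨m, h1, h2, h3⟩ := ih hne'
      obtain ⟨n, n1, n2, n3⟩ := exists_median a s m
      refine ⟨n, ?_, ?_, ?_⟩
      · rintro t (rfl | ht)
        · exact n1
        · exact (h1 t ht).sub n3
      · intro q hq
        have hs := hq s (Set.mem_insert _ _)
        have hm := h2 q fun t ht => hq t (Set.mem_insert_of_mem _ ht)
        rcases hs.total n1 with h | h
        · exact h
        · rcases hm.total n3 with h' | h'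
          · exact h'
          · -- `q` lies beyond `n` on both branches, so it is `n`
            rcases hs.trans_or n with h3 | h3
            · exact h3
            rcases hm.trans_or n with h4 | h4
            · exact h4
            rw [eq_mid h3.symm h4 n2]
            exact onPath_right _ _
      · intro h
        obtain ⟨t, ht⟩ := hne'
        have hsm : ¬ OnPath a s m := fun h' => (h'.trans_or t).elim
          (h s (Set.mem_insert _ _) t (Set.mem_insert_of_mem _ ht))
          (h3 (fun u hu v hv => h u (Set.mem_insert_of_mem _ hu) v (Set.mem_insert_of_mem _ hv))
            t ht)
        have hsn : ¬ OnPath a s n := fun h' => hsm (n2.sub h')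
        exact fun u hu hun => (hun.trans_or s).elim (h u hu s (Set.mem_insert _ _)) hsn

theorem Above.congr {x s t : M} (h : Above x s) (hst : ¬ OnPath x s t) : Above x t := by
  obtain ⟨y, hy, h⟩ := h
  refine ⟨y, hy, fun h' => ?_⟩
  rcases h'.trans_or s with h1 | h1
  · exact hst h1.symm
  · exact h h1

theorem Above.not_below {x t : M} (h : Above x t) : ¬ Below x t := by
  rintro ⟨z, hz, h'⟩
  obtain ⟨y, hy, h⟩ := h
  rcases ((Pretree.of_le (hz.trans hy).le).2 ⟨hz.le, hy.le⟩).trans_or t with h1 | h1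
  · exact h' h1.symm
  · exact h h1

theorem not_above_iff {x t : M} (h : t ≠ x) : ¬ Above x t ↔ Below x t :=
  ⟨(Pretree.above_or_below h).resolve_left, fun h1 h2 => h2.not_below h1⟩

theorem above_map (φ : M ≃o M) {x t : M} : Above (φ x) (φ t) ↔ Above x t := by
  constructor
  · rintro ⟨y, hy, h⟩
    refine ⟨φ.symm y, by rwa [OrderIso.lt_symm_apply], ?_⟩
    rwa [← onPath_map φ, φ.apply_symm_apply]
  · rintro ⟨y, hy, h⟩
    exact ⟨φ y, φ.lt_iff_lt.2 hy, by rwa [onPath_map]⟩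

theorem above_of_lt {x y : M} (h : x < y) : Above x y :=
  ⟨y, h, fun h' => h.ne (onPath_self.1 h')⟩

theorem below_of_lt {x y : M} (h : y < x) : Below x y :=
  ⟨y, h, fun h' => h.ne' (onPath_self.1 h')⟩

/-- An automorphism of finite order that fixes the end points of a path fixes every point of it. -/
theorem fixed_of_onPath {φ : M ≃o M} {n : ℕ} (hn : 0 < n) (hφ : φ ^ n = 1) {x y w : M}
    (hx : φ x = x) (hy : φ y = y) (hw : OnPath w x y) : φ w = w := by
  have hw' : OnPath (φ w) x y := by
    have := (onPath_map φ).2 hw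
    rwa [hx, hy] at this
  have hstep : ∀ {u v : M}, OnPath u x v → OnPath (φ u) x (φ v) := by
    intro u v h
    have := (onPath_map φ).2 h
    rwa [hx] at this
  have hpow : ∀ k, (φ ^ (k + 1)) w = φ ((φ ^ k) w) := fun k => by rw [pow_succ']; rfl
  have hend : (φ ^ n) w = w := by rw [hφ]; rfl
  obtain ⟨k, rfl⟩ : ∃ k, n = k + 1 := ⟨n - 1, by omega⟩
  rcases hw.total hw' with h | h
  · have : ∀ k, OnPath (φ w) x ((φ ^ (k + 1)) w) := by
      intro k
      induction k with
      | zero =>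
        rw [hpow]
        exact onPath_right _ _
      | succ k ih =>
        rw [hpow]
        have h1 : OnPath (φ (φ w)) x (φ ((φ ^ (k + 1)) w)) := hstep ih
        exact h1.sub (hstep h)
    have h1 := this k
    rw [hend] at h1
    exact eq_of_onPath_of_onPath h1 h
  · have : ∀ k, OnPath ((φ ^ (k + 1)) w) x (φ w) := by
      intro k
      induction k with
      | zero =>
        rw [hpow]
        exact onPath_right _ _
      | succ k ih =>
        rw [hpow]
        have h1 : OnPath (φ ((φ ^ (k + 1)) w)) x (φ (φ w)) := hstep ih
        exact (hstep h).sub h1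
    have h1 := this k
    rw [hend] at h1
    exact eq_of_onPath_of_onPath h h1

/-- Automorphisms that fix `p` and are chosen separately on each cone of `p` fit together to a
monotone map. -/
theorem glue_monotone {p : M} {lab : M → M ≃o M} (hp : ∀ t, lab t p = p)
    (hlab : ∀ s t, ¬ OnPath p s t → lab s = lab t) : Monotone fun t => lab t t := by
  intro s t hst
  by_cases h : OnPath p s t
  · obtain ⟨h1, h2⟩ := (Pretree.of_le hst).1 h
    calc lab s s ≤ lab s p := (lab s).monotone h1
      _ = lab t p := by rw [hp, hp]
      _ ≤ lab t t := (lab t).monotone h2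
  · change lab s s ≤ lab t t
    rw [hlab s t h]
    exact (lab t).monotone hst

end Basic

/-! ### The group `A₅` and its tuples -/

section A5

theorem A5.card : Nat.card A5 = 60 := by
  have := two_mul_nat_card_alternatingGroup (α := Fin 5)
  rw [Nat.card_perm, Nat.card_eq_fintype_card (α := Fin 5), Fintype.card_fin] at this
  have h : Nat.factorial 5 = 120 := rfl
  rw [h] at this
  exact Nat.eq_of_mul_eq_mul_left two_pos this

theorem A5.normal_eq_top {K : Subgroup A5} (hK : K.Normal) {a : A5} (ha : a ∈ K) (ha1 : a ≠ 1) :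
    K = ⊤ := by
  rcases hK.eq_bot_or_eq_top with h | h
  · rw [h, Subgroup.mem_bot] at ha
    exact absurd ha ha1
  · exact h

/-- A proper subgroup of `A₅` has at least three left cosets. -/
theorem A5.three_cosets {H : Subgroup A5} (hH : H ≠ ⊤) :
    ∃ i j, i ∉ H ∧ j ∉ H ∧ i⁻¹ * j ∉ H := by
  obtain ⟨i, hi⟩ : ∃ i, i ∉ H := by
    by_contra! h
    exact hH (eq_top_iff.2 fun x _ => h x)
  by_contra! h
  have h2 : H.index = 2 := by
    rw [Subgroup.index_eq_two_iff]
    refine ⟨i, fun b => ?_⟩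
    by_cases hb : b ∈ H
    · refine Or.inr ⟨hb, fun h' => hi ?_⟩
      simpa using H.mul_mem (H.inv_mem hb) h'
    · refine Or.inl ⟨?_, hb⟩
      have h1 := h b⁻¹ i (fun h' => hb (by simpa using H.inv_mem h')) hi
      simpa using h1
  have h3 := Subgroup.normal_of_index_eq_two h2
  rcases h3.eq_bot_or_eq_top with h4 | h4
  · rw [h4, Subgroup.index_bot, A5.card] at h2
    omega
  · exact hH h4

theorem A5.exists_ne_one : ∃ a : A5, a ≠ 1 := by
  have : Nontrivial A5 := Finite.one_lt_card_iff_nontrivial.1 (by rw [A5.card]; omega)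
  exact exists_ne 1

/-- `A₅` has trivial centre. -/
theorem A5.eq_one_of_comm {a : A5} (h : ∀ b, a * b = b * a) : a = 1 := by
  by_contra ha
  have hc : Subgroup.center A5 = ⊤ :=
    A5.normal_eq_top inferInstance (Subgroup.mem_center_iff.2 fun b => (h b).symm) ha
  have h1 : ∀ b c : A5, b * c = c * b := fun b c =>
    (Subgroup.mem_center_iff.1 (hc ▸ Subgroup.mem_top c) b)
  have : (⟨Equiv.swap 0 1 * Equiv.swap 1 2, by simp [Equiv.Perm.mem_alternatingGroup]⟩ : A5) *
      ⟨Equiv.swap 1 2 * Equiv.swap 2 3, by simp [Equiv.Perm.mem_alternatingGroup]⟩ =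
      ⟨Equiv.swap 1 2 * Equiv.swap 2 3, by simp [Equiv.Perm.mem_alternatingGroup]⟩ *
      ⟨Equiv.swap 0 1 * Equiv.swap 1 2, by simp [Equiv.Perm.mem_alternatingGroup]⟩ := h1 _ _
  revert this
  decide

variable {G : Type u} [Group G]

theorem IsA5.mul {f : A5 → G} (h : IsA5 f) (i j : A5) : f i * f j = f (i * j) := (h i j _).2 rfl

/-- An `A₅`-tuple as a homomorphism. -/
def IsA5.hom {f : A5 → G} (h : IsA5 f) : A5 →* G := MonoidHom.mk' f fun i j => (h.mul i j).symm

theorem IsA5.hom_apply {f : A5 → G} (h : IsA5 f) (i : A5) : h.hom i = f i := rfl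

theorem IsA5.one {f : A5 → G} (h : IsA5 f) : f 1 = 1 := h.hom.map_one

theorem IsA5.pow_card {f : A5 → G} (h : IsA5 f) (i : A5) : f i ^ 60 = 1 := by
  rw [← h.hom_apply, ← map_pow, ← A5.card, pow_card_eq_one', map_one]

theorem IsA5.injective {f : A5 → G} (h : IsA5 f) : Function.Injective f := by
  intro i j hij
  have := (h i 1 j).1 (by rw [h.one, mul_one, hij])
  rwa [mul_one] at this

/-- A nontrivial homomorphism from `A₅` is an `A₅`-tuple. -/
theorem isA5_of_ne (F : A5 →* G) (h : ∃ i, F i ≠ 1) : IsA5 F := by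
  have hinj : Function.Injective F := by
    rw [injective_iff_map_eq_one]
    intro a ha
    by_contra ha1
    have := A5.normal_eq_top F.normal_ker (F.mem_ker.2 ha) ha1
    obtain ⟨i, hi⟩ := h
    exact hi (F.mem_ker.1 (this ▸ Subgroup.mem_top i))
  intro i j k
  rw [← map_mul]
  exact hinj.eq_iff

theorem IsA5.conj {f : A5 → G} (h : IsA5 f) (φ : G) : IsA5 fun i => φ * f i * φ⁻¹ := by
  intro i j k
  rw [← h i j k, show φ * f i * φ⁻¹ * (φ * f j * φ⁻¹) = φ * (f i * f j) * φ⁻¹ by group]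
  simp

end A5

/-! ### Fixed points of actions of `A₅` -/

section FixedPoint

variable {M : Type u} [PartialOrder M] [Pretree M]

theorem IsMedian.map {m a b c : M} (h : IsMedian m a b c) (φ : M ≃o M) :
    IsMedian (φ m) (φ a) (φ b) (φ c) :=
  ⟨(onPath_map φ).2 h.1, (onPath_map φ).2 h.2.1, (onPath_map φ).2 h.2.2⟩

/-- The finite sets closed under medians and under the action. -/
def IsMedianClosed (F : A5 →* (M ≃o M)) (S : Finset M) : Prop :=
  S.Nonempty ∧ (∀ i, ∀ s ∈ S, F i s ∈ S) ∧
    ∀ a ∈ S, ∀ b ∈ S, ∀ c ∈ S, ∀ m, IsMedian m a b c → m ∈ S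

/-- A point of the path from `a` to `b`, seen from another point `m`, lies in the cone of `a` or in
the cone of `b`. -/
theorem exists_same_cone {m u a b : M} (h : OnPath u a b) (hne : m ≠ u) :
    ¬ OnPath m a u ∨ ¬ OnPath m b u := by
  by_contra! h'
  exact hne (eq_mid h'.1 h'.2.symm h)

/-- The medians of the points of an orbit form a closed set. -/
theorem exists_isMedianClosed (F : A5 →* (M ≃o M)) (x : M) : ∃ S, IsMedianClosed F S := by
  classical
  choose med hmed using exists_median (M := M)
  obtain ⟨o, ho⟩ : ∃ o : A5 → M, ∀ i j, F i (o j) = o (i * j) :=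
    ⟨fun i => F i x, fun i j => by
      change F i (F j x) = F (i * j) x
      rw [map_mul, RelIso.mul_apply]⟩
  have hfin : {m | ∃ i j k, IsMedian m (o i) (o j) (o k)}.Finite := by
    refine (Set.finite_range fun t : A5 × A5 × A5 => med (o t.1) (o t.2.1) (o t.2.2)).subset ?_
    rintro m ⟨i, j, k, h⟩
    exact ⟨(i, j, k), (hmed _ _ _).unique h⟩
  obtain ⟨S, hS⟩ : ∃ S : Finset M, ∀ m, m ∈ S ↔ ∃ i j k, IsMedian m (o i) (o j) (o k) :=
    ⟨hfin.toFinset, fun m => hfin.mem_toFinset⟩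
  have hone : IsMedian (o 1) (o 1) (o 1) (o 1) :=
    ⟨onPath_left _ _, onPath_left _ _, onPath_left _ _⟩
  refine ⟨S, ⟨o 1, (hS (o 1)).2 ⟨1, 1, 1, hone⟩⟩, ?_, ?_⟩
  · intro i s hs
    obtain ⟨a, b, c, h⟩ := (hS s).1 hs
    have := h.map (F i)
    rw [ho, ho, ho] at this
    exact (hS _).2 ⟨_, _, _, this⟩
  · intro a ha b hb c hc m hm
    have key : ∀ u ∈ S, m ≠ u → ∃ i, ¬ OnPath m (o i) u := by
      intro u hu hne
      obtain ⟨i, j, k, h⟩ := (hS u).1 hu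
      rcases exists_same_cone h.1 hne with h1 | h1
      · exact ⟨i, h1⟩
      · exact ⟨j, h1⟩
    by_cases ha' : m = a
    · exact ha' ▸ ha
    by_cases hb' : m = b
    · exact hb' ▸ hb
    by_cases hc' : m = c
    · exact hc' ▸ hc
    obtain ⟨i, hi⟩ := key a ha ha'
    obtain ⟨j, hj⟩ := key b hb hb'
    obtain ⟨k, hk⟩ := key c hc hc'
    have htr : ∀ {u v s t}, OnPath m u v → ¬ OnPath m s u → ¬ OnPath m t v → OnPath m s t := by
      intro u v s t h h1 h2
      rcases h.trans_or s with h3 | h3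
      · exact absurd h3.symm h1
      rcases h3.trans_or t with h4 | h4
      · exact h4
      · exact absurd h4 h2
    exact (hS m).2 ⟨i, j, k, htr hm.1 hi hj, htr hm.2.1 hj hk, htr hm.2.2 hi hk⟩

/-- A point of a finite set that is on no path between two others. -/
theorem exists_leaf {S : Finset M} (hS : S.Nonempty) :
    ∃ v ∈ S, ∀ a ∈ S, ∀ b ∈ S, OnPath v a b → v = a ∨ v = b := by
  classical
  obtain ⟨r, hr⟩ := hS
  -- a point with the longest path from `r`
  obtain ⟨v, hv, hmax⟩ :=
    S.exists_max_image (fun v => (S.filter fun u => OnPath u r v).card) ⟨r, hr⟩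
  have key : ∀ a ∈ S, OnPath v r a → v = a := by
    intro a ha h
    by_contra hne
    refine absurd (hmax a ha) (not_le_of_gt (Finset.card_lt_card ?_))
    refine Finset.ssubset_iff_of_subset ?_ |>.2 ⟨a, ?_, ?_⟩
    · intro u hu
      rw [Finset.mem_filter] at hu ⊢
      exact ⟨hu.1, h.sub hu.2⟩
    · exact Finset.mem_filter.2 ⟨ha, onPath_right _ _⟩
    · intro h'
      exact hne (eq_of_onPath_of_onPath h (Finset.mem_filter.1 h').2)
  refine ⟨v, hv, fun a ha b hb h => ?_⟩
  rcases h.trans_or r with h1 | h1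
  · exact Or.inl (key a ha h1.symm)
  · exact Or.inr (key b hb h1)

/-- Every action of `A₅` has a fixed point: in a minimal finite invariant set closed under medians
every point is a leaf, so the set has at most two points, and `A₅` fixes both of them because it
has no subgroup of index two. -/
theorem exists_fixed (F : A5 →* (M ≃o M)) (x : M) : ∃ z, ∀ i, F i z = z := by
  classical
  obtain ⟨S, hS, hmin⟩ : ∃ S, IsMedianClosed F S ∧
      ∀ T, IsMedianClosed F T → ¬ T.card < S.card :=
    (measure Finset.card).wf.has_min {S | IsMedianClosed F S} (exists_isMedianClosed F x)
  obtain ⟨hne, hinv, hmed⟩ := hS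
  have hinv' : ∀ i s, F i s ∈ S → s ∈ S := by
    intro i s hs
    have := hinv i⁻¹ _ hs
    rwa [map_inv, RelIso.inv_apply_self] at this
  let IsLeaf : M → Prop := fun v => ∀ a ∈ S, ∀ b ∈ S, OnPath v a b → v = a ∨ v = b
  have hleaf_map : ∀ i v, IsLeaf (F i v) → IsLeaf v := by
    intro i v hv a ha b hb h
    simpa using hv _ (hinv i a ha) _ (hinv i b hb) ((onPath_map _).2 h)
  have hall : ∀ v ∈ S, IsLeaf v := by
    by_contra! h
    obtain ⟨w, hw, hw'⟩ := h
    refine hmin (S.filter fun v => ¬ IsLeaf v) ⟨⟨w, Finset.mem_filter.2 ⟨hw, hw'⟩⟩, ?_, ?_⟩ ?_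
    · intro i s hs
      rw [Finset.mem_filter] at hs ⊢
      exact ⟨hinv i s hs.1, fun h => hs.2 (hleaf_map i s h)⟩
    · intro a ha b hb c hc m hm
      have hmS := hmed a (Finset.mem_filter.1 ha).1 b (Finset.mem_filter.1 hb).1 c
        (Finset.mem_filter.1 hc).1 m hm
      refine Finset.mem_filter.2 ⟨hmS, fun hl => ?_⟩
      rcases hl a (Finset.mem_filter.1 ha).1 b (Finset.mem_filter.1 hb).1 hm.1 with rfl | rfl
      · exact (Finset.mem_filter.1 ha).2 hl
      · exact (Finset.mem_filter.1 hb).2 hl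
    · obtain ⟨v, hv, hl⟩ := exists_leaf hne
      exact Finset.card_lt_card ((Finset.ssubset_iff_of_subset (Finset.filter_subset _ _)).2
        ⟨v, hv, fun h => (Finset.mem_filter.1 h).2 hl⟩)
  obtain ⟨z, hz⟩ := hne
  let H : Subgroup A5 :=
    { carrier := {i | F i z = z}
      mul_mem' := fun {a b} ha hb => by
        simp only [Set.mem_ofPred_eq] at ha hb ⊢
        rw [map_mul, RelIso.mul_apply, hb, ha]
      one_mem' := by simp
      inv_mem' := fun {a} ha => by
        simp only [Set.mem_ofPred_eq] at ha ⊢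
        rw [map_inv]
        nth_rewrite 1 [← ha]
        rw [RelIso.inv_apply_self] }
  have hH : ∀ i, i ∈ H ↔ F i z = z := fun i => Iff.rfl
  refine ⟨z, fun i => (hH i).1 ?_⟩
  suffices H = ⊤ from this ▸ Subgroup.mem_top i
  by_contra hne
  obtain ⟨i, j, hi, hj, hij⟩ := A5.three_cosets hne
  rw [hH] at hi hj hij
  have hij' : F i z ≠ F j z := by
    intro h
    refine hij ?_
    rw [map_mul, RelIso.mul_apply, ← h, map_inv, RelIso.inv_apply_self]
  obtain ⟨m, hm⟩ := exists_median z (F i z) (F j z)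
  have hl := hall m (hmed _ hz _ (hinv i z hz) _ (hinv j z hz) m hm)
  rcases hl _ hz _ (hinv i z hz) hm.1 with h | h
  · rcases hl _ (hinv i z hz) _ (hinv j z hz) hm.2.1 with h' | h'
    · exact hi (h'.symm.trans h)
    · exact hj (h'.symm.trans h)
  · rcases hl _ hz _ (hinv j z hz) hm.2.2 with h' | h'
    · exact hi (h.symm.trans h')
    · exact hij' (h.symm.trans h')

end FixedPoint

/-! ### Tuples acting on the cones of a point -/

section Tuples

variable {M : Type u} [PartialOrder M]

/-- An action of `A₅` by monotone maps, as a homomorphism to the automorphism group. -/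
def actionHom (act : A5 → M → M) (hmono : ∀ i, Monotone (act i)) (hone : ∀ t, act 1 t = t)
    (hmul : ∀ i j t, act (i * j) t = act i (act j t)) : A5 →* (M ≃o M) where
  toFun i :=
    { toFun := act i
      invFun := act i⁻¹
      left_inv := fun t => by rw [← hmul, inv_mul_cancel, hone]
      right_inv := fun t => by rw [← hmul, mul_inv_cancel, hone]
      map_rel_iff' := fun {s t} => by
        refine ⟨fun h => ?_, fun h => hmono i h⟩
        have := hmono i⁻¹ h
        simpa only [Equiv.coe_fn_mk, ← hmul, inv_mul_cancel, hone] using this }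
  map_one' := by
    ext t
    exact hone t
  map_mul' i j := by
    ext t
    exact hmul i j t

theorem Indec.trivial_of_split {G : Type u} [Group G] {f : A5 → G} (hf : Indec f)
    {g h : A5 →* G} (hgh : ∀ i, g i * h i = f i) (hcomm : ∀ i j, g i * h j = h j * g i) :
    (∀ i, g i = 1) ∨ ∀ i, h i = 1 := by
  by_contra! h'
  exact hf.2 ⟨g, h, hgh, isA5_of_ne g h'.1, isA5_of_ne h h'.2, hcomm⟩

/-- The tuple `f` acts on the cones of the fixed point `x`: its support is a union of cones of `x`,
which are permuted transitively and nontrivially. -/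
structure Based (f : A5 → (M ≃o M)) (x : M) : Prop where
  isA5 : IsA5 f
  fixed : ∀ i, f i x = x
  cone : ∀ s t, s ∈ supp f → ¬ OnPath x s t → t ∈ supp f
  trans : ∀ s ∈ supp f, ∀ t ∈ supp f, ∃ i, ¬ OnPath x (f i s) t
  moved : ∀ s ∈ supp f, ∃ i, OnPath x s (f i s)

theorem notMem_supp {f : A5 → (M ≃o M)} {x : M} : x ∉ supp f ↔ ∀ i, f i x = x := by
  simp [supp]

theorem IsA5.mul_apply {f : A5 → (M ≃o M)} (hf : IsA5 f) (i j : A5) (t : M) :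
    f (i * j) t = f i (f j t) := by
  rw [← hf.mul]
  rfl

theorem IsA5.inv_apply {f : A5 → (M ≃o M)} (hf : IsA5 f) (i : A5) (t : M) :
    f i⁻¹ (f i t) = t := by
  rw [← hf.mul_apply, inv_mul_cancel, hf.one]
  rfl

theorem IsA5.apply_inv {f : A5 → (M ≃o M)} (hf : IsA5 f) (i : A5) (t : M) :
    f i (f i⁻¹ t) = t := by
  rw [← hf.mul_apply, mul_inv_cancel, hf.one]
  rfl

theorem IsA5.apply_mem_supp {f : A5 → (M ≃o M)} (hf : IsA5 f) {s : M} (hs : s ∈ supp f) (i : A5) :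
    f i s ∈ supp f := by
  by_contra h
  rw [notMem_supp] at h
  have h1 : f i s = s := by
    have := h i⁻¹
    rwa [hf.inv_apply, eq_comm] at this
  rw [h1] at h
  exact notMem_supp.2 h hs

theorem IsA5.supp_nonempty {f : A5 → (M ≃o M)} (hf : IsA5 f) : (supp f).Nonempty := by
  by_contra! h
  obtain ⟨a, ha⟩ := A5.exists_ne_one
  refine ha (hf.injective ?_)
  rw [hf.one]
  ext t
  exact notMem_supp.1 (h ▸ Set.notMem_empty t) a

variable {f g : A5 → (M ≃o M)} {x : M}

theorem Based.notMem (hf : Based f x) : x ∉ supp f := notMem_supp.2 hf.fixed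

theorem Based.onPath (hf : Based f x) {s t : M} (hs : s ∈ supp f) (ht : t ∉ supp f) :
    OnPath x s t := by
  by_contra h
  exact ht (hf.cone s t hs h)

theorem mem_supp_conj {φ : M ≃o M} {t : M} :
    φ t ∈ supp (fun i => φ * f i * φ⁻¹) ↔ t ∈ supp f := by
  simp [supp]

theorem Comm.symm {G : Type u} [Group G] {f g : A5 → G} (h : Comm f g) : Comm g f :=
  ⟨h.2.1, h.1, fun i j => (h.2.2 j i).symm⟩

theorem Comm.conj {G : Type u} [Group G] {f g : A5 → G} (h : Comm f g) (φ : G) :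
    Comm (fun i => φ * f i * φ⁻¹) fun i => φ * g i * φ⁻¹ := by
  refine ⟨h.1.conj φ, h.2.1.conj φ, fun i j => ?_⟩
  rw [show φ * f i * φ⁻¹ * (φ * g j * φ⁻¹) = φ * (f i * g j) * φ⁻¹ by group, h.2.2]
  group

theorem Comm.apply (h : Comm f g) (i j : A5) (t : M) : f i (g j t) = g j (f i t) := by
  rw [← RelIso.mul_apply, h.2.2, RelIso.mul_apply]

theorem comm_of_disjoint (hf : IsA5 f) (hg : IsA5 g) (h : ∀ t, t ∈ supp f → t ∉ supp g) :
    Comm f g := by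
  refine ⟨hf, hg, fun i j => ?_⟩
  ext t
  rw [RelIso.mul_apply, RelIso.mul_apply]
  by_cases ht : t ∈ supp f
  · rw [notMem_supp.1 (h t ht), notMem_supp.1 (h _ (hf.apply_mem_supp ht i))]
  · rw [notMem_supp.1 ht]
    by_cases ht' : t ∈ supp g
    · exact notMem_supp.1 (fun h' => h _ h' (hg.apply_mem_supp ht' j)) i
    · rw [notMem_supp.1 ht', notMem_supp.1 ht]

theorem Based.ne (hf : Based f x) {s : M} (hs : s ∈ supp f) : s ≠ x := by
  rintro rfl
  exact hf.notMem hs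

/-- Commuting tuples with the same base and overlapping supports have the same support. -/
theorem Comm.supp_subset (h : Comm f g) (hf : Based f x) (hg : Based g x) {s : M}
    (hs : s ∈ supp f) (hs' : s ∈ supp g) : supp f ⊆ supp g := by
  intro t ht
  obtain ⟨i, hi⟩ := hf.trans s hs t ht
  refine hg.cone _ _ ?_ hi
  by_contra h'
  refine notMem_supp.2 (fun j => ?_) hs'
  have := notMem_supp.1 h' j
  rw [← h.apply] at this
  exact (f i).injective this

end Tuples

/-! ### Indecomposable tuples have a base -/

section Based

variable {M : Type u} [PartialOrder M] [Pretree M]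

/-- An action can be cut down to an invariant union of cones of a fixed point. -/
theorem exists_restriction {F : A5 →* (M ≃o M)} {p : M} (hp : ∀ i, F i p = p) {U : Set M}
    (hU : ∀ s t, s ∈ U → ¬ OnPath p s t → t ∈ U) (hinv : ∀ i, ∀ s ∈ U, F i s ∈ U) :
    ∃ G : A5 →* (M ≃o M), (∀ i, ∀ t ∈ U, G i t = F i t) ∧ ∀ i, ∀ t ∉ U, G i t = t := by
  classical
  let lab : A5 → M → M ≃o M := fun i t => if t ∈ U then F i else 1
  have hlab : ∀ i t, t ∈ U → lab i t t = F i t := fun i t h => by simp only [lab, if_pos h]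
  have hlab' : ∀ i t, t ∉ U → lab i t t = t := fun i t h => by
    simp only [lab, if_neg h]
    rfl
  refine ⟨actionHom (fun i t => lab i t t) ?_ ?_ ?_, hlab, hlab'⟩
  · intro i
    refine glue_monotone (p := p) (fun t => ?_) (fun s t h => ?_)
    · by_cases ht : t ∈ U
      · simp only [lab, if_pos ht, hp]
      · simp only [lab, if_neg ht]
        rfl
    · have : s ∈ U ↔ t ∈ U := ⟨fun hs => hU s t hs h, fun ht => hU t s ht fun h' => h h'.symm⟩
      simp only [lab, this]
  · intro t
    by_cases ht : t ∈ U
    · rw [hlab _ _ ht, map_one]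
      rfl
    · exact hlab' _ _ ht
  · intro i j t
    by_cases ht : t ∈ U
    · rw [hlab _ _ ht, hlab _ _ ht, hlab _ _ (hinv j t ht), map_mul]
      rfl
    · rw [hlab' _ _ ht, hlab' _ _ ht, hlab' _ _ ht]

theorem IsA5.fixed_of_onPath {f : A5 → (M ≃o M)} (hf : IsA5 f) {i : A5} {x y w : M}
    (hx : f i x = x) (hy : f i y = y) (hw : OnPath w x y) : f i w = w :=
  CFPO.fixed_of_onPath (n := 60) (by omega) (hf.pow_card i) hx hy hw

/-- An indecomposable tuple acts at a single point: otherwise it is the product of its restrictions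
to the cones at one of its points of action and to everything else. -/
theorem Indec.exists_based {f : A5 → (M ≃o M)} (hf : Indec f) : ∃ x, Based f x := by
  have hA := hf.1
  obtain ⟨t₀, ht₀⟩ := hA.supp_nonempty
  obtain ⟨z, hz⟩ := exists_fixed hA.hom t₀
  simp only [hA.hom_apply] at hz
  -- the last common point of the paths from a fixed point to an orbit is fixed
  have hlast : ∀ {a b q : M}, (∀ i, f i a = a) → (∀ s ∈ Set.range fun i => f i b, OnPath q a s) →
      (∀ r, (∀ s ∈ Set.range fun i => f i b, OnPath r a s) → OnPath r a q) → ∀ i, f i q = q := by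
    intro a b q ha h1 h2
    have h3 : ∀ i, OnPath (f i q) a q := by
      intro i
      refine h2 _ ?_
      rintro _ ⟨j, rfl⟩
      have := (onPath_map (f i)).2 (h1 _ ⟨i⁻¹ * j, rfl⟩)
      rwa [ha, ← hA.mul_apply, mul_inv_cancel_left] at this
    intro i
    have h4 := (onPath_map (f i)).2 (h3 i⁻¹)
    rw [ha, hA.apply_inv] at h4
    exact eq_of_onPath_of_onPath (h3 i) h4
  obtain ⟨p, hp1, hp2, -⟩ := exists_last_common z (Set.finite_range fun i => f i t₀)
    (Set.range_nonempty _)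
  have hp : ∀ i, f i p = p := hlast hz hp1 hp2
  let U : Set M := {t | ∃ i, ¬ OnPath p (f i t₀) t}
  have hUinv : ∀ i, ∀ s ∈ U, f i s ∈ U := by
    rintro i s ⟨j, hj⟩
    refine ⟨i * j, ?_⟩
    rwa [hA.mul_apply, ← hp i, onPath_map]
  have hUcone : ∀ s t, s ∈ U → ¬ OnPath p s t → t ∈ U := by
    rintro s t ⟨j, hj⟩ h
    exact ⟨j, fun h' => (h'.trans_or s).elim hj h⟩
  have ht₀U : t₀ ∈ U := by
    refine ⟨1, ?_⟩
    rw [hA.one]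
    intro h
    have h' : p = t₀ := onPath_self.1 h
    exact notMem_supp.2 (h' ▸ hp) ht₀
  have hUfix : ∀ q ∈ U, ¬ ∀ i, f i q = q := by
    rintro q ⟨i, hi⟩ hq
    have hi' : ¬ OnPath p t₀ q := by
      rwa [← hp i, ← hq i, onPath_map] at hi
    obtain ⟨m, m1, m2, m3⟩ := exists_median p t₀ q
    have hm : ∀ j, f j m = m := fun j => hA.fixed_of_onPath (hp j) (hq j) m3
    have hpz : OnPath p z t₀ := by
      have : OnPath p z (f 1 t₀) := hp1 _ ⟨1, rfl⟩
      rwa [hA.one] at this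
    have hmz : OnPath m z t₀ := (hpz.symm.sub m1.symm).symm
    have hmp : OnPath m z p := by
      refine hp2 m ?_
      rintro _ ⟨j, rfl⟩
      have := (onPath_map (f j)).2 hmz
      rwa [hm, hz] at this
    have : m = p := eq_mid hmp m1 hpz
    exact hi' (this ▸ m2)
  have hsuppU : ∀ t, t ∈ supp f ↔ t ∈ U := by
    have hU' : ∀ t ∈ U, t ∈ supp f := fun t ht => by
      by_contra h
      exact hUfix t ht (notMem_supp.1 h)
    refine fun t => ⟨fun ht => ?_, hU' t⟩
    have hinv' : ∀ i, ∀ s ∈ Uᶜ, f i s ∈ Uᶜ := by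
      intro i s hs h
      have := hUinv i⁻¹ _ h
      rw [hA.inv_apply] at this
      exact hs this
    obtain ⟨g, hg1, hg2⟩ := exists_restriction (F := hA.hom) hp hUcone hUinv
    obtain ⟨h, hh1, hh2⟩ := exists_restriction (F := hA.hom) hp (U := Uᶜ)
      (fun s t hs hst ht => hs (hUcone t s ht fun h' => hst h'.symm)) hinv'
    have hsplit := hf.trivial_of_split (g := g) (h := h) (fun i => by
      ext t
      rw [RelIso.mul_apply]
      by_cases ht : t ∈ U
      · rw [hh2 i t (fun h' => h' ht), hg1 i t ht, hA.hom_apply]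
      · rw [hh1 i t ht, hA.hom_apply, hg2 i _ (hinv' i t ht)]) (fun i j => by
      ext t
      rw [RelIso.mul_apply, RelIso.mul_apply]
      by_cases ht : t ∈ U
      · rw [hh2 j t (fun h' => h' ht), hh2 j _ (fun h' => h' ?_)]
        rw [hg1 i t ht]
        exact hUinv i t ht
      · rw [hg2 i t ht, hg2 i]
        rw [hh1 j t ht]
        exact hinv' j t ht)
    rcases hsplit with h1 | h1
    · exfalso
      refine notMem_supp.2 (fun i => ?_) ht₀
      rw [← hA.hom_apply, ← hg1 i t₀ ht₀U, h1]
      rfl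
    · by_contra htU
      refine notMem_supp.2 (fun i => ?_) ht
      rw [← hA.hom_apply, ← hh1 i t htU, h1]
      rfl
  refine ⟨p, hA, hp, ?_, ?_, ?_⟩
  · intro s t hs h
    rw [hsuppU] at hs ⊢
    exact hUcone s t hs h
  · intro s hs t ht
    obtain ⟨i, hi⟩ := (hsuppU s).1 hs
    obtain ⟨j, hj⟩ := (hsuppU t).1 ht
    refine ⟨j * i⁻¹, fun h => (h.trans_or (f j t₀)).elim (fun h' => hi ?_) hj⟩
    rw [← onPath_map (f (j * i⁻¹)), hp, ← hA.mul_apply, inv_mul_cancel_right]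
    exact h'.symm
  · intro s hs
    by_contra! h
    obtain ⟨m, m1, m2, m3⟩ := exists_last_common p (Set.finite_range fun i => f i s)
      (Set.range_nonempty _)
    have hm := hlast hp m1 m2
    have hsm : ¬ OnPath p s m := by
      refine m3 ?_ s ⟨1, by simp [hA.one]⟩
      rintro _ ⟨i, rfl⟩ _ ⟨j, rfl⟩ h'
      refine h (i⁻¹ * j) ?_
      rw [← onPath_map (f i), hp, ← hA.mul_apply, mul_inv_cancel_left]
      exact h'
    exact hUfix m (hUcone s m ((hsuppU s).1 hs) hsm) hm

variable {f g h : A5 → (M ≃o M)} {x y z : M}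

theorem Based.isBase (hf : Based f x) : IsBase f x := by
  ext z
  simp only [Set.mem_ofPred_eq, Set.mem_singleton_iff]
  constructor
  · intro hz
    obtain ⟨t, ht⟩ := hf.isA5.supp_nonempty
    by_cases hzs : z ∈ supp f
    · exfalso
      refine notMem_supp.2 (fun i => ?_) hzs
      have h1 : ∀ i, OnPath z (f i z) x := fun i =>
        hz _ (hf.isA5.apply_mem_supp hzs i) x hf.notMem
      have h2 := (onPath_map (f i)).2 (h1 i⁻¹)
      rw [hf.isA5.apply_inv, hf.fixed] at h2
      exact eq_of_onPath_of_onPath h2.symm (h1 i).symm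
    · exact eq_of_onPath_of_onPath (hz t ht x hf.notMem) (hf.onPath ht hzs)
  · rintro rfl t ht s hs
    exact hf.onPath ht hs

theorem Based.unique (hf : Based f x) (hf' : Based f y) : x = y := by
  have h1 := hf.isBase
  rw [IsBase, hf'.isBase] at h1
  exact (Set.singleton_eq_singleton_iff.1 h1).symm

/-- The support lies on one side of the base. -/
theorem Based.side (hf : Based f x) {s t : M} (hs : s ∈ supp f) (ht : t ∈ supp f) :
    Above x s ↔ Above x t := by
  obtain ⟨i, hi⟩ := hf.trans s hs t ht
  rw [← above_map (f i), hf.fixed]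
  exact ⟨fun h => h.congr hi, fun h => h.congr fun h' => hi h'.symm⟩

/-- The support consists of at least three cones. -/
theorem Based.three (hf : Based f x) {s : M} (hs : s ∈ supp f) :
    ∃ i j, OnPath x s (f i s) ∧ OnPath x s (f j s) ∧ OnPath x (f i s) (f j s) := by
  have hA := hf.isA5
  let H : Subgroup A5 :=
    { carrier := {i | ¬ OnPath x s (f i s)}
      mul_mem' := fun {a b} ha hb h => by
        rw [hA.mul_apply] at h
        refine (h.trans_or (f a s)).elim ha fun h' => hb ?_
        rwa [← onPath_map (f a), hf.fixed]
      one_mem' := fun h => by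
        rw [hA.one] at h
        exact hf.ne hs (onPath_self.1 h).symm
      inv_mem' := fun {a} ha h => ha (by
        rw [← onPath_map (f a), hf.fixed, hA.apply_inv] at h
        exact h.symm) }
  have hH : ∀ i, i ∉ H ↔ OnPath x s (f i s) := fun i => not_not
  have hne : H ≠ ⊤ := by
    intro h
    obtain ⟨i, hi⟩ := hf.moved s hs
    exact (hH i).2 hi (h ▸ Subgroup.mem_top i)
  obtain ⟨i, j, hi, hj, hij⟩ := A5.three_cosets hne
  rw [hH] at hi hj hij
  refine ⟨i, j, hi, hj, ?_⟩
  rwa [← onPath_map (f i), hf.fixed, ← hA.mul_apply, mul_inv_cancel_left] at hij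

theorem Based.conj (hf : Based f x) (φ : M ≃o M) : Based (fun i => φ * f i * φ⁻¹) (φ x) := by
  have hφ : ∀ t, ∃ s, t = φ s := fun t => ⟨φ.symm t, by simp⟩
  have happ : ∀ i t, (φ * f i * φ⁻¹) (φ t) = φ (f i t) := fun i t => by simp
  refine ⟨hf.isA5.conj φ, fun i => ?_, fun s t hs h => ?_, fun s hs t ht => ?_, fun s hs => ?_⟩
  · rw [happ, hf.fixed]
  · obtain ⟨s, rfl⟩ := hφ s
    obtain ⟨t, rfl⟩ := hφ t
    rw [mem_supp_conj] at hs ⊢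
    rw [onPath_map] at h
    exact hf.cone s t hs h
  · obtain ⟨s, rfl⟩ := hφ s
    obtain ⟨t, rfl⟩ := hφ t
    rw [mem_supp_conj] at hs ht
    obtain ⟨i, hi⟩ := hf.trans s hs t ht
    exact ⟨i, by rwa [happ, onPath_map]⟩
  · obtain ⟨s, rfl⟩ := hφ s
    rw [mem_supp_conj] at hs
    obtain ⟨i, hi⟩ := hf.moved s hs
    exact ⟨i, by rwa [happ, onPath_map]⟩

end Based

/-! ### Commuting tuples -/

section Commuting

variable {M : Type u} [PartialOrder M] [Pretree M] {f g h : A5 → (M ≃o M)} {x y z : M}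

/-- Commuting tuples fix each other's bases. -/
theorem Comm.notMem (h : Comm f g) (hg : Based g x) : x ∉ supp f := by
  rw [notMem_supp]
  intro i
  have h1 := hg.conj (f i)
  have h2 : (fun j => f i * g j * (f i)⁻¹) = g := by
    funext j
    rw [h.2.2, mul_inv_cancel_right]
  rw [h2] at h1
  exact h1.unique hg

theorem comm_of_ne (hf : Based f x) (hg : Based g y) (hxy : x ≠ y) (hx : x ∉ supp g)
    (hy : y ∉ supp f) : Comm f g :=
  comm_of_disjoint hf.isA5 hg.isA5 fun _ ht ht' =>
    hxy (eq_of_onPath_of_onPath (hf.onPath ht hy) (hg.onPath ht' hx))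

theorem comm_of_side (hf : Based f x) (hg : Based g x) {s t : M} (hs : s ∈ supp f)
    (ht : t ∈ supp g) (hst : ¬ (Above x s ↔ Above x t)) : Comm f g :=
  comm_of_disjoint hf.isA5 hg.isA5 fun _ hu hu' =>
    hst ((hf.side hs hu).trans (hg.side hu' ht))

/-- The elements that map every cone of `x` in an invariant set to itself form a normal subgroup. -/
theorem exists_coneKernel (hg : IsA5 g) (hx : ∀ i, g i x = x) {U : Set M}
    (hU : ∀ i, ∀ s ∈ U, g i s ∈ U) (hxU : x ∉ U) :
    ∃ K : Subgroup A5, K.Normal ∧ ∀ a, a ∈ K ↔ ∀ s ∈ U, ¬ OnPath x (g a s) s := by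
  have map : ∀ a {u v : M}, ¬ OnPath x u v → ¬ OnPath x (g a u) (g a v) := by
    intro a u v huv
    rwa [← hx a, onPath_map]
  refine ⟨{ carrier := {a | ∀ s ∈ U, ¬ OnPath x (g a s) s}
            mul_mem' := fun {a b} ha hb s hs h => ?_
            one_mem' := fun s hs h => ?_
            inv_mem' := fun {a} ha s hs h => ?_ }, ⟨fun a ha b s hs => ?_⟩, fun a => Iff.rfl⟩
  · rw [hg.mul_apply] at h
    exact (h.trans_or (g a s)).elim (map a (hb s hs)) (ha s hs)
  · rw [hg.one] at h
    have h' : x = s := onPath_self.1 h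
    exact hxU (h' ▸ hs)
  · have := map a⁻¹ (ha s hs)
    rw [hg.inv_apply] at this
    exact this h.symm
  · rw [hg.mul_apply, hg.mul_apply]
    have := map b (ha _ (hU b⁻¹ s hs))
    rwa [hg.apply_inv] at this

/-- Three pairwise commuting tuples cannot all act on the same cones. As `f` is transitive on the
cones, a map commuting with `f` is determined on the cones by one value; so some `g j` that moves a
cone agrees on the cones with some `h k` and is central in the action of `g`. -/
theorem no_three_commuting (hf : Based f x) (hg : Based g x) (hh : Based h x) (hfg : Comm f g)
    (hfh : Comm f h) (hgh : Comm g h) (h1 : supp f = supp g) (h2 : supp f = supp h) : False := by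
  obtain ⟨t, ht⟩ := hf.isA5.supp_nonempty
  obtain ⟨i, hi⟩ := hf.moved t ht
  have htg : t ∈ supp g := h1 ▸ ht
  have hth : t ∈ supp h := h2 ▸ ht
  have hit := hf.isA5.apply_mem_supp ht i
  obtain ⟨j, hj⟩ := hg.trans t htg _ (h1 ▸ hit)
  obtain ⟨k, hk⟩ := hh.trans t hth _ (h2 ▸ hit)
  have mapg : ∀ a {u v : M}, ¬ OnPath x u v → ¬ OnPath x (g a u) (g a v) := by
    intro a u v huv
    rwa [← hg.fixed a, onPath_map]
  have mapf : ∀ a {u v : M}, ¬ OnPath x u v → ¬ OnPath x (f a u) (f a v) := by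
    intro a u v huv
    rwa [← hf.fixed a, onPath_map]
  have maph : ∀ a {u v : M}, ¬ OnPath x u v → ¬ OnPath x (h a u) (h a v) := by
    intro a u v huv
    rwa [← hh.fixed a, onPath_map]
  have tr : ∀ {a b c : M}, ¬ OnPath x a b → ¬ OnPath x b c → ¬ OnPath x a c :=
    fun h1 h2 h' => (h'.trans_or _).elim h1 h2
  have sy : ∀ {a b : M}, ¬ OnPath x a b → ¬ OnPath x b a := fun h h' => h h'.symm
  -- `g j` and `h k` agree on all cones
  have hjk : ∀ s ∈ supp f, ¬ OnPath x (g j s) (h k s) := by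
    intro s hs
    obtain ⟨l, hl⟩ := hf.trans t ht s hs
    have h3 : ¬ OnPath x (g j (f l t)) (h k (f l t)) := by
      rw [← hfg.apply, ← hfh.apply]
      exact mapf l (tr hj (sy hk))
    exact tr (sy (mapg j hl)) (tr h3 (maph k hl))
  have hcomm : ∀ l, ∀ s ∈ supp f, ¬ OnPath x (g l (g j s)) (g j (g l s)) := by
    intro l s hs
    have h3 := mapg l (hjk s hs)
    rw [hgh.apply] at h3
    have h4 := hjk (g l s) (h1 ▸ hg.isA5.apply_mem_supp (h1 ▸ hs) l)
    exact tr h3 (sy h4)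
  obtain ⟨K, hK, hmem⟩ := exists_coneKernel hg.isA5 hg.fixed (U := supp f)
    (fun i s hs => h1 ▸ hg.isA5.apply_mem_supp (h1 ▸ hs) i) hf.notMem
  have hKtop : K ≠ ⊤ := by
    intro hK
    obtain ⟨a, ha⟩ := hg.moved t htg
    exact (hmem a).1 (hK ▸ Subgroup.mem_top a) t ht ha.symm
  have hj1 : j = 1 := by
    refine A5.eq_one_of_comm fun l => ?_
    by_contra hne
    refine hKtop (A5.normal_eq_top hK (a := (l * j)⁻¹ * (j * l)) ((hmem _).2 fun s hs => ?_) ?_)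
    · have := hcomm l s hs
      rw [← hg.isA5.mul_apply, ← hg.isA5.mul_apply] at this
      replace this := mapg (l * j)⁻¹ (sy this)
      rw [← hg.isA5.mul_apply, ← hg.isA5.mul_apply, inv_mul_cancel, hg.isA5.one] at this
      exact this
    · rw [Ne, inv_mul_eq_one]
      exact fun h' => hne h'.symm
  rw [hj1, hg.isA5.one] at hj
  exact hj hi

end Commuting

/-! ### Some elements of `A₅` -/

section Elements

/-- The cycle `a ↦ b ↦ c ↦ a`. -/
def threeCycle (a b c : Fin 5) (hab : a ≠ b) (hbc : b ≠ c) : A5 :=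
  ⟨Equiv.swap a b * Equiv.swap b c, by
    simp [Equiv.Perm.mem_alternatingGroup, Equiv.Perm.sign_swap hab, Equiv.Perm.sign_swap hbc]⟩

theorem A5.exists_apply_eq (a b : Fin 5) : ∃ i : A5, i.1 a = b := by
  by_cases hab : a = b
  · exact ⟨1, hab⟩
  · have : ∀ a b : Fin 5, ∃ c, c ≠ a ∧ c ≠ b := by decide
    obtain ⟨c, hca, hcb⟩ := this a b
    refine ⟨threeCycle a b c hab hcb.symm, ?_⟩
    simp [threeCycle, Equiv.swap_apply_of_ne_of_ne hab hca.symm]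

/-- A fixed-point-free element. -/
def fiveCycle : A5 :=
  ⟨Equiv.swap 0 1 * Equiv.swap 1 2 * (Equiv.swap 2 3 * Equiv.swap 3 4), by
    simp [Equiv.Perm.mem_alternatingGroup]⟩

theorem fiveCycle_apply_ne : ∀ a, fiveCycle.1 a ≠ a := by decide

theorem A5.exists_fix_not_commute (b : Fin 5) :
    ∃ i j : A5, i.1 b = b ∧ j.1 b = b ∧ i * j ≠ j * i := by
  have h : ∀ b : Fin 5, b + 1 ≠ b + 2 ∧ b + 2 ≠ b + 3 ∧ b + 2 ≠ b + 4 := by decide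
  have h' : ∀ b : Fin 5, (Equiv.swap (b + 1) (b + 2) * Equiv.swap (b + 2) (b + 3)) b = b ∧
      (Equiv.swap (b + 1) (b + 2) * Equiv.swap (b + 2) (b + 4)) b = b ∧
      (Equiv.swap (b + 1) (b + 2) * Equiv.swap (b + 2) (b + 3) *
        (Equiv.swap (b + 1) (b + 2) * Equiv.swap (b + 2) (b + 4))) (b + 1) ≠
      (Equiv.swap (b + 1) (b + 2) * Equiv.swap (b + 2) (b + 4) *
        (Equiv.swap (b + 1) (b + 2) * Equiv.swap (b + 2) (b + 3))) (b + 1) := by decide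
  refine ⟨threeCycle (b + 1) (b + 2) (b + 3) (h b).1 (h b).2.1,
    threeCycle (b + 1) (b + 2) (b + 4) (h b).1 (h b).2.2, (h' b).1, (h' b).2.1, fun h'' => ?_⟩
  exact (h' b).2.2 (congrArg (fun i : A5 => i.1 (b + 1)) h'')

/-- Two sets of three points out of five meet. -/
theorem A5.exists_three_meet (i : A5) :
    ∃ a b : Fin 5, (a = 0 ∨ a = 1 ∨ a = 2) ∧ (b = 0 ∨ b = 1 ∨ b = 2) ∧ i.1 a = b := by
  by_contra! h
  have key : ∀ c : Fin 5, (c ≠ 0 ∧ c ≠ 1 ∧ c ≠ 2) → c = 3 ∨ c = 4 := by decide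
  have h' : ∀ a : Fin 5, (a = 0 ∨ a = 1 ∨ a = 2) → i.1 a = 3 ∨ i.1 a = 4 := fun a ha =>
    key _ ⟨h a 0 ha (Or.inl rfl), h a 1 ha (Or.inr (Or.inl rfl)), h a 2 ha (Or.inr (Or.inr rfl))⟩
  have h0 := h' 0 (Or.inl rfl)
  have h1 := h' 1 (Or.inr (Or.inl rfl))
  have h2 := h' 2 (Or.inr (Or.inr rfl))
  have e1 : i.1 0 ≠ i.1 1 := fun h => absurd (i.1.injective h) (by decide)
  have e2 : i.1 0 ≠ i.1 2 := fun h => absurd (i.1.injective h) (by decide)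
  have e3 : i.1 1 ≠ i.1 2 := fun h => absurd (i.1.injective h) (by decide)
  rcases h0 with h0 | h0 <;> rcases h1 with h1 | h1 <;> rcases h2 with h2 | h2 <;>
    simp_all

end Elements

/-! ### Natural tuples -/

section Natural

variable {M : Type u} [PartialOrder M]

/-- The tuple `f` permutes the distinct cones of `y 0, …, y 4` at `p` as `A₅` permutes the indices;
an element that fixes an index fixes the corresponding cone pointwise. -/
structure Natural (f : A5 → (M ≃o M)) (p : M) (y : Fin 5 → M) : Prop where
  isA5 : IsA5 f
  ne : ∀ a, y a ≠ p
  distinct : ∀ a b, a ≠ b → OnPath p (y a) (y b)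
  off : ∀ i t, (∀ a, OnPath p t (y a)) → f i t = t
  move : ∀ i t a, ¬ OnPath p t (y a) → ¬ OnPath p (f i t) (y (i.1 a))
  fix : ∀ i t a, ¬ OnPath p t (y a) → i.1 a = a → f i t = t

variable [Pretree M]

theorem cone_image (φ : M ≃o M) (x y : M) : φ '' cone x y = cone (φ x) (φ y) := by
  ext t
  constructor
  · rintro ⟨s, hs, rfl⟩
    exact fun h => hs ((onPath_map φ).1 h)
  · intro h
    refine ⟨φ.symm t, fun h' => h ?_, φ.apply_symm_apply t⟩
    rwa [← onPath_map φ, φ.apply_symm_apply] at h'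

theorem cone_eq_iff {x s t : M} (hs : s ≠ x) : cone x s = cone x t ↔ ¬ OnPath x s t := by
  constructor
  · intro h
    have : s ∈ cone x s := fun h' => hs (onPath_self.1 h').symm
    rw [h] at this
    exact this
  · intro h
    ext u
    exact ⟨fun hu hu' => (hu'.trans_or s).elim hu h,
      fun hu hu' => (hu'.trans_or t).elim hu fun h' => h h'.symm⟩

/-- A cone determines its base. -/
theorem base_unique {x y s t : M} (hs : s ≠ x) (h : cone x s = cone y t) : x = y := by
  have h1 : s ∈ cone y t := by
    rw [← h]
    exact fun h' => hs (onPath_self.1 h').symm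
  have hys : y ≠ s := fun h' => h1 (h' ▸ onPath_left _ _)
  have h2 : cone y t = cone y s := ((cone_eq_iff hys.symm).2 h1).symm
  have hx : x ∉ cone y s := by
    rw [← h2, ← h]
    exact fun h' => h' (onPath_left _ _)
  have hy : y ∉ cone x s := by
    rw [h]
    exact fun h' => h' (onPath_left _ _)
  exact eq_of_onPath_of_onPath (not_not.1 hy).symm (not_not.1 hx).symm

theorem isUpCone_of_above {x s : M} (h : Above x s) : IsUpCone x (cone x s) := by
  obtain ⟨y, hy, h⟩ := h
  exact ⟨y, hy, ((cone_eq_iff hy.ne').2 fun h' => h h'.symm).symm⟩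

theorem isDownCone_of_below {x s : M} (h : Below x s) : IsDownCone x (cone x s) := by
  obtain ⟨y, hy, h⟩ := h
  exact ⟨y, hy, ((cone_eq_iff hy.ne).2 fun h' => h h'.symm).symm⟩

/-- Cones on the same side of `p` are conjugate over `p`. -/
theorem exists_cone_map (hK : KCone M) {p s t : M} (hs : s ≠ p) (ht : t ≠ p)
    (hst : Above p s ↔ Above p t) :
    ∃ φ : M ≃o M, φ p = p ∧ ∀ u, OnPath p u s ↔ OnPath p (φ u) t := by
  obtain ⟨φ, hφ⟩ : ∃ φ : M ≃o M, φ '' cone p s = cone p t := by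
    by_cases h : Above p s
    · exact hK.coneTransitive.2 p _ _ (Or.inl ⟨isUpCone_of_above h, isUpCone_of_above (hst.1 h)⟩)
    · refine hK.coneTransitive.2 p _ _ (Or.inr ⟨isDownCone_of_below ((not_above_iff hs).1 h),
        isDownCone_of_below ((not_above_iff ht).1 fun h' => h (hst.2 h'))⟩)
  rw [cone_image] at hφ
  have hp : φ p = p := base_unique (fun h => hs (φ.injective h)) hφ
  refine ⟨φ, hp, fun u => ?_⟩
  rw [hp] at hφ
  have : φ u ∈ cone p (φ s) ↔ φ u ∈ cone p t := by rw [hφ]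
  have h2 : OnPath p (φ u) (φ s) ↔ OnPath p (φ u) t := not_iff_not.1 this
  rw [← h2]
  nth_rewrite 2 [← hp]
  rw [onPath_map]

/-- There are cones on either side of `p` that avoid four given points. -/
theorem exists_avoiding (hK : KCone M) (p s : M) (S : Finset M) (hS : S.card ≤ 4) :
    ∃ y, y ≠ p ∧ (Above p y ↔ Above p s) ∧ ∀ t ∈ S, OnPath p y t := by
  have key : ∀ (Q : Set M → Prop), 5 ≤ Cardinal.mk {C : Set M // Q C} →
      ∃ C, Q C ∧ ∀ t ∈ S, C ≠ cone p t := by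
    intro Q hQ
    by_contra! h
    choose t ht htC using fun C : {C : Set M // Q C} => h C.1 C.2
    have hinj : Function.Injective fun C : {C : Set M // Q C} => (⟨t C, ht C⟩ : S) := by
      intro C D hCD
      have : t C = t D := congrArg Subtype.val hCD
      exact Subtype.ext ((htC C).trans (this ▸ (htC D).symm))
    have h1 := hQ.trans (Cardinal.mk_le_of_injective hinj)
    rw [Cardinal.mk_coe_finset] at h1
    have h2 : (5 : ℕ) ≤ S.card := by exact_mod_cast h1
    omega
  by_cases h : Above p s
  · obtain ⟨_, ⟨y, hy, rfl⟩, hC⟩ := key (IsUpCone p) (hK.five_le p)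
    refine ⟨y, hy.ne', iff_of_true (above_of_lt hy) h, fun t ht => ?_⟩
    by_contra h'
    exact hC t ht ((cone_eq_iff hy.ne').2 h')
  · obtain ⟨_, ⟨y, hy, rfl⟩, hC⟩ := key (IsDownCone p) ((hK.five_le p).trans (hK.up_le_down p))
    refine ⟨y, hy.ne, iff_of_false (fun h' => h'.not_below (below_of_lt hy)) h, fun t ht => ?_⟩
    by_contra h'
    exact hC t ht ((cone_eq_iff hy.ne).2 h')

theorem exists_natural (hK : KCone M) {p : M} {y : Fin 5 → M} (hy : ∀ a, y a ≠ p)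
    (hside : ∀ a, Above p (y a) ↔ Above p (y 0))
    (hdist : ∀ a b, a ≠ b → OnPath p (y a) (y b)) : ∃ f, Natural f p y := by
  classical
  choose φ hφp hφ using fun a => exists_cone_map hK (hy 0) (hy a) (hside a).symm
  have hφ' : ∀ a b u, ¬ OnPath p u (y a) → ¬ OnPath p (φ b ((φ a).symm u)) (y b) := by
    intro a b u h h'
    rw [← hφ b, hφ a, OrderIso.apply_symm_apply] at h'
    exact h h'
  have huniq : ∀ {a b u}, ¬ OnPath p u (y a) → ¬ OnPath p u (y b) → a = b := by
    intro a b u ha hb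
    by_contra hne
    exact ((hdist a b hne).trans_or u).elim (fun h => ha h.symm) hb
  let lab : A5 → M → M ≃o M := fun i t =>
    if h : ∃ a, ¬ OnPath p t (y a) then φ (i.1 h.choose) * (φ h.choose)⁻¹ else 1
  have hlab : ∀ i t a, ¬ OnPath p t (y a) → lab i t = φ (i.1 a) * (φ a)⁻¹ := by
    intro i t a ha
    have h : ∃ a, ¬ OnPath p t (y a) := ⟨a, ha⟩
    have : h.choose = a := huniq h.choose_spec ha
    simp only [lab, dif_pos h, this]
  have hlab' : ∀ i t, (∀ a, OnPath p t (y a)) → lab i t = 1 := by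
    intro i t h
    have h' : ¬ ∃ a, ¬ OnPath p t (y a) := by
      rintro ⟨a, ha⟩
      exact ha (h a)
    simp only [lab, dif_neg h']
  have hsymm : ∀ a, (φ a).symm p = p := fun a => by
    rw [OrderIso.symm_apply_eq, hφp]
  have hval : ∀ i t a, ¬ OnPath p t (y a) → lab i t t = φ (i.1 a) ((φ a).symm t) := by
    intro i t a ha
    rw [hlab i t a ha]
    rfl
  have hmono : ∀ i, Monotone fun t => lab i t t := by
    intro i
    refine glue_monotone (p := p) (fun t => ?_) (fun s t h => ?_)
    · by_cases h : ∃ a, ¬ OnPath p t (y a)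
      · obtain ⟨a, ha⟩ := h
        rw [hlab i t a ha]
        change φ (i.1 a) ((φ a).symm p) = p
        rw [hsymm, hφp]
      · push Not at h
        rw [hlab' i t h]
        rfl
    · by_cases hs : ∃ a, ¬ OnPath p s (y a)
      · obtain ⟨a, ha⟩ := hs
        rw [hlab i s a ha, hlab i t a fun h' => (h'.trans_or s).elim (fun h'' => h h''.symm) ha]
      · push Not at hs
        rw [hlab' i s hs, hlab' i t fun a => ((hs a).trans_or t).resolve_left h]
  let F := actionHom (fun i t => lab i t t) hmono (fun t => by
      by_cases h : ∃ a, ¬ OnPath p t (y a)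
      · obtain ⟨a, ha⟩ := h
        rw [hval 1 t a ha]
        exact (φ a).apply_symm_apply t
      · push Not at h
        rw [hlab' 1 t h]
        rfl) (fun i j t => by
      by_cases h : ∃ a, ¬ OnPath p t (y a)
      · obtain ⟨a, ha⟩ := h
        have h1 := hφ' a (j.1 a) t ha
        rw [hval _ t a ha, hval j t a ha, hval i _ (j.1 a) h1, OrderIso.symm_apply_apply]
        rfl
      · push Not at h
        rw [hlab' _ t h, hlab' j t h]
        change t = lab i t t
        rw [hlab' i t h]
        rfl)
  have hF : ∀ i t, F i t = lab i t t := fun i t => rfl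
  have hmove : ∀ i t a, ¬ OnPath p t (y a) → ¬ OnPath p (F i t) (y (i.1 a)) := by
    intro i t a ha
    rw [hF, hval i t a ha]
    exact hφ' a (i.1 a) t ha
  have hself : ∀ a, ¬ OnPath p (y a) (y a) := fun a h => hy a (onPath_self.1 h).symm
  refine ⟨F, isA5_of_ne F ⟨fiveCycle, fun h => ?_⟩, hy, hdist, ?_, hmove, ?_⟩
  · have := hmove fiveCycle (y 0) 0 (hself 0)
    rw [h] at this
    exact fiveCycle_apply_ne 0 (huniq (hself 0) this).symm
  · intro i t h
    rw [hF, hlab' i t h]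
    rfl
  · intro i t a ha hia
    rw [hF, hval i t a ha, hia]
    exact (φ a).apply_symm_apply t

variable {f g h : A5 → (M ≃o M)} {p x : M} {y : Fin 5 → M}

theorem Natural.self (hf : Natural f p y) (a : Fin 5) : ¬ OnPath p (y a) (y a) :=
  fun h => hf.ne a (onPath_self.1 h).symm

theorem Natural.index_unique (hf : Natural f p y) {a b : Fin 5} {u : M}
    (ha : ¬ OnPath p u (y a)) (hb : ¬ OnPath p u (y b)) : a = b := by
  by_contra hne
  exact ((hf.distinct a b hne).trans_or u).elim (fun h => ha h.symm) hb

theorem Natural.moved (hf : Natural f p y) {i : A5} {a : Fin 5} {t : M}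
    (ht : ¬ OnPath p t (y a)) (hia : i.1 a ≠ a) : f i t ≠ t := by
  intro h
  have := hf.move i t a ht
  rw [h] at this
  exact hia (hf.index_unique ht this).symm

theorem Natural.mem_supp (hf : Natural f p y) {t : M} : t ∈ supp f ↔ ∃ a, ¬ OnPath p t (y a) := by
  constructor
  · rintro ⟨i, hi⟩
    by_contra! h
    exact hi (hf.off i t h)
  · rintro ⟨a, ha⟩
    exact ⟨fiveCycle, hf.moved ha (fiveCycle_apply_ne a)⟩

theorem Natural.y_mem (hf : Natural f p y) (a : Fin 5) : y a ∈ supp f :=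
  hf.mem_supp.2 ⟨a, hf.self a⟩

theorem Natural.based (hf : Natural f p y) : Based f p := by
  have hp : ∀ i, f i p = p := fun i => hf.off i p fun a => onPath_left _ _
  refine ⟨hf.isA5, hp, ?_, ?_, ?_⟩
  · intro s t hs h
    obtain ⟨a, ha⟩ := hf.mem_supp.1 hs
    exact hf.mem_supp.2 ⟨a, fun h' => (h'.trans_or s).elim (fun h'' => h h''.symm) ha⟩
  · intro s hs t ht
    obtain ⟨a, ha⟩ := hf.mem_supp.1 hs
    obtain ⟨b, hb⟩ := hf.mem_supp.1 ht
    obtain ⟨i, hi⟩ := A5.exists_apply_eq a b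
    have := hf.move i s a ha
    rw [hi] at this
    exact ⟨i, fun h' => (h'.trans_or (y b)).elim this fun h'' => hb h''.symm⟩
  · intro s hs
    obtain ⟨a, ha⟩ := hf.mem_supp.1 hs
    refine ⟨fiveCycle, ?_⟩
    by_contra h
    have := hf.move fiveCycle s a ha
    refine fiveCycle_apply_ne a (hf.index_unique (u := s) (fun h' => ?_) ha)
    exact (h'.trans_or (f fiveCycle s)).elim h this

/-- A factor of a natural tuple is trivial outside the support. -/
theorem Natural.factor_off (hf : Natural f p y) (hg : IsA5 g) (hgh : ∀ i, g i * h i = f i)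
    (hc : ∀ i j, g i * h j = h j * g i) {t : M} (ht : t ∉ supp f) (a : A5) : g a t = t := by
  have hft := notMem_supp.1 ht
  have hh : ∀ i, h i t = g i⁻¹ t := by
    intro i
    have h1 : g i (h i t) = t := by rw [← RelIso.mul_apply, hgh, hft]
    rw [← hg.inv_apply i (h i t), h1]
  -- on the orbit of `t` the tuple `f` acts by conjugation
  have hconj : ∀ i b, f i (g b t) = g (i * b * i⁻¹) t := by
    intro i b
    rw [← hgh, RelIso.mul_apply, ← RelIso.mul_apply (h i), ← hc, RelIso.mul_apply, hh,
      hg.mul_apply, hg.mul_apply]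
  have hs : g fiveCycle t ∉ supp f := by
    intro h'
    obtain ⟨b, hb⟩ := hf.mem_supp.1 h'
    refine hf.moved hb (fiveCycle_apply_ne b) ?_
    rw [hconj, mul_inv_cancel_right]
  let K : Subgroup A5 :=
    { carrier := {b | g b t = t}
      mul_mem' := fun {b c} hb hc => by
        simp only [Set.mem_ofPred_eq] at hb hc ⊢
        rw [hg.mul_apply, hc, hb]
      one_mem' := by
        simp only [Set.mem_ofPred_eq, hg.one]
        rfl
      inv_mem' := fun {b} hb => by
        simp only [Set.mem_ofPred_eq] at hb ⊢
        nth_rewrite 1 [← hb]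
        exact hg.inv_apply b t }
  have hKmem : ∀ b, b ∈ K ↔ g b t = t := fun b => Iff.rfl
  have hK : K.Normal := by
    refine ⟨fun b hb c => ?_⟩
    rw [hKmem] at hb ⊢
    rw [← hconj, hb, hft]
  obtain ⟨i, hi⟩ : ∃ i, fiveCycle * i ≠ i * fiveCycle := by
    by_contra! h'
    have := A5.eq_one_of_comm h'
    exact fiveCycle_apply_ne 0 (by rw [this]; rfl)
  have hmem : fiveCycle⁻¹ * (i * fiveCycle * i⁻¹) ∈ K := by
    rw [hKmem, hg.mul_apply, ← hconj, notMem_supp.1 hs, hg.inv_apply]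
  have htop := A5.normal_eq_top hK hmem (by
    rw [Ne, inv_mul_eq_one, eq_mul_inv_iff_mul_eq]
    exact hi)
  exact (hKmem a).1 (htop ▸ Subgroup.mem_top a)

/-- A factor of a natural tuple that fixes all cones is trivial. -/
theorem Natural.factor_eq_one (hf : Natural f p y) (hg : IsA5 g) (hh : IsA5 h)
    (hgh : ∀ i, g i * h i = f i) (hc : ∀ i j, g i * h j = h j * g i)
    (hcone : ∀ a, ∀ s ∈ supp f, ¬ OnPath p (h a s) s) : False := by
  have hoff : ∀ a, ∀ t ∉ supp f, h a t = t := fun a t ht =>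
    hf.factor_off (g := h) (h := g) hh (fun i => (hc i i).symm.trans (hgh i))
      (fun i j => (hc j i).symm) ht a
  have hon : ∀ a, ∀ s ∈ supp f, h a s = s := by
    intro a s hs
    obtain ⟨b, hb⟩ := hf.mem_supp.1 hs
    have hcb : ∀ a u, ¬ OnPath p u (y b) → ¬ OnPath p (h a u) (y b) := fun a u hu h' =>
      (h'.trans_or u).elim (hcone a u (hf.mem_supp.2 ⟨b, hu⟩)) hu
    let K : Subgroup A5 :=
      { carrier := {a | ∀ u, ¬ OnPath p u (y b) → h a u = u}
        mul_mem' := fun {a c} ha hc u hu => by rw [hh.mul_apply, hc u hu, ha u hu]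
        one_mem' := fun u _ => by
          rw [hh.one]
          rfl
        inv_mem' := fun {a} ha u hu => by
          nth_rewrite 1 [← ha u hu]
          exact hh.inv_apply a u }
    have hKmem : ∀ a, a ∈ K ↔ ∀ u, ¬ OnPath p u (y b) → h a u = u := fun a => Iff.rfl
    have hK : K.Normal := by
      refine ⟨fun a ha c => ?_⟩
      rw [hKmem] at ha ⊢
      intro u hu
      rw [hh.mul_apply, hh.mul_apply, ha _ (hcb _ u hu), hh.apply_inv]
    obtain ⟨i, j, hi, hj, hij⟩ := A5.exists_fix_not_commute b
    -- an element that fixes the index `b` acts under `h` inversely to `g` on the cone of `y b`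
    have hinv : ∀ i : A5, i.1 b = b → ∀ u, ¬ OnPath p u (y b) → h i u = g i⁻¹ u := by
      intro i hi u hu
      have h1 : g i (h i u) = u := by rw [← RelIso.mul_apply, hgh, hf.fix i u b hu hi]
      rw [← hg.inv_apply i (h i u), h1]
    have hcommute : ∀ u, ¬ OnPath p u (y b) → h i (h j u) = h j (h i u) := by
      intro u hu
      rw [hinv j hj u hu, ← RelIso.mul_apply, ← hc, RelIso.mul_apply, hinv j hj _ (hcb i u hu)]
    have hmem : (j * i)⁻¹ * (i * j) ∈ K := by
      rw [hKmem]
      intro u hu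
      rw [hh.mul_apply, hh.mul_apply i j, hcommute u hu, ← hh.mul_apply j i, hh.inv_apply]
    have htop := A5.normal_eq_top hK hmem (by
      rw [Ne, inv_mul_eq_one]
      exact fun h' => hij h'.symm)
    exact (hKmem a).1 (htop ▸ Subgroup.mem_top a) s hb
  obtain ⟨t, ht⟩ := hh.supp_nonempty
  refine notMem_supp.2 (fun a => ?_) ht
  by_cases hs : t ∈ supp f
  · exact hon a t hs
  · exact hoff a t hs

/-- Natural tuples are indecomposable. If `f` is the product of commuting tuples `g` and `h`, then
both act on the five cones of the support, and as `60 ^ 2 > 5 ^ 5` one of the actions is trivial. -/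
theorem Natural.indec (hf : Natural f p y) : Indec f := by
  refine ⟨hf.isA5, ?_⟩
  rintro ⟨g, h, hgh, hg, hh, hc⟩
  have hhg : ∀ i, h i * g i = f i := fun i => (hc i i).symm.trans (hgh i)
  have hc' : ∀ i j, h i * g j = g j * h i := fun i j => (hc j i).symm
  have hgoff := fun t ht => hf.factor_off (t := t) hg hgh hc ht
  have hhoff := fun t ht => hf.factor_off (t := t) hh hhg hc' ht
  have hp := hf.based.notMem
  have pres : ∀ {k : A5 → (M ≃o M)}, IsA5 k → (∀ t ∉ supp f, ∀ a, k a t = t) →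
      ∀ a, ∀ s ∈ supp f, k a s ∈ supp f := by
    intro k hk hoff a s hs
    by_contra h'
    have := hoff _ h' a⁻¹
    rw [hk.inv_apply] at this
    exact h' (this ▸ hs)
  have hgU := pres hg hgoff
  have hhU := pres hh hhoff
  have mapg : ∀ a {u v : M}, ¬ OnPath p u v → ¬ OnPath p (g a u) (g a v) := by
    intro a u v huv
    rwa [← hgoff p hp a, onPath_map]
  have maph : ∀ a {u v : M}, ¬ OnPath p u v → ¬ OnPath p (h a u) (h a v) := by
    intro a u v huv
    rwa [← hhoff p hp a, onPath_map]
  have tr : ∀ {a b c : M}, ¬ OnPath p a b → ¬ OnPath p b c → ¬ OnPath p a c :=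
    fun h1 h2 h' => (h'.trans_or _).elim h1 h2
  have sy : ∀ {a b : M}, ¬ OnPath p a b → ¬ OnPath p b a := fun h h' => h h'.symm
  obtain ⟨Kg, hKg, hKg'⟩ := exists_coneKernel hg (fun i => hgoff p hp i) hgU hp
  obtain ⟨Kh, hKh, hKh'⟩ := exists_coneKernel hh (fun i => hhoff p hp i) hhU hp
  by_cases hgtop : Kg = ⊤
  · exact hf.factor_eq_one hh hg hhg hc' fun a s hs =>
      (hKg' a).1 (hgtop ▸ Subgroup.mem_top a) s hs
  by_cases hhtop : Kh = ⊤
  · exact hf.factor_eq_one hg hh hgh hc fun a s hs =>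
      (hKh' a).1 (hhtop ▸ Subgroup.mem_top a) s hs
  have hex : ∀ (ij : A5 × A5) (b : Fin 5), ∃ b', ¬ OnPath p (g ij.1 (h ij.2 (y b))) (y b') :=
    fun ij b => hf.mem_supp.1 (hgU _ _ (hhU _ _ (hf.y_mem b)))
  choose l hl using hex
  have hcard : Fintype.card (Fin 5 → Fin 5) < Fintype.card (A5 × A5) := by
    rw [Fintype.card_prod, Fintype.card_fun, Fintype.card_fin, ← Nat.card_eq_fintype_card, A5.card]
    norm_num
  obtain ⟨⟨i, j⟩, ⟨i', j'⟩, hne, hll⟩ := Fintype.exists_ne_map_eq_of_card_lt l hcard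
  have hsame : ∀ s ∈ supp f, ¬ OnPath p (g i (h j s)) (g i' (h j' s)) := by
    intro s hs
    obtain ⟨b, hb⟩ := hf.mem_supp.1 hs
    have h1 := hl (i, j) b
    have h2 := hl (i', j') b
    rw [hll] at h1
    exact tr (mapg i (maph j hb)) (tr (tr h1 (sy h2)) (mapg i' (maph j' (sy hb))))
  have hab : ∀ s ∈ supp f, ¬ OnPath p (g (i'⁻¹ * i) s) (h (j' * j⁻¹) s) := by
    intro s hs
    have h1 := mapg i'⁻¹ (hsame (h j⁻¹ s) (hhU _ _ hs))
    rwa [hh.apply_inv, hg.inv_apply, ← hg.mul_apply, ← hh.mul_apply] at h1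
  have ha : i'⁻¹ * i = 1 := by
    refine A5.eq_one_of_comm fun k => ?_
    by_contra hk
    refine hgtop (A5.normal_eq_top hKg (a := (k * (i'⁻¹ * i))⁻¹ * (i'⁻¹ * i * k))
      ((hKg' _).2 fun s hs => ?_) ?_)
    · have h1 := hab (g k s) (hgU k s hs)
      have h2 := mapg k (hab s hs)
      rw [← RelIso.mul_apply (g k) (h _), hc, RelIso.mul_apply, ← hg.mul_apply] at h2
      rw [← hg.mul_apply] at h1
      have h3 := mapg (k * (i'⁻¹ * i))⁻¹ (tr h1 (sy h2))
      rwa [hg.inv_apply, ← hg.mul_apply] at h3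
    · rw [Ne, inv_mul_eq_one]
      exact fun h' => hk h'.symm
  have hb : j' * j⁻¹ = 1 := by
    by_contra hb
    refine hhtop (A5.normal_eq_top hKh ((hKh' _).2 fun s hs => ?_) hb)
    have := hab s hs
    rw [ha, hg.one] at this
    exact sy this
  rw [inv_mul_eq_one] at ha
  rw [mul_inv_eq_one] at hb
  exact hne (by rw [ha, hb])

/-- A natural tuple commutes with no tuple that acts on some of the same cones. -/
theorem Natural.not_comm (hf : Natural f p y) (hg : Based g p) {s : M} (hs : s ∈ supp f)
    (hs' : s ∈ supp g) : ¬ Comm f g := by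
  intro hc
  have hsub := hc.supp_subset hf.based hg hs hs'
  obtain ⟨j, hj⟩ := hg.trans _ (hsub (hf.y_mem 0)) _ (hsub (hf.y_mem 1))
  let i : A5 := threeCycle 1 2 3 (by decide) (by decide)
  have h0 : i.1 0 = 0 := by decide
  have h1 : i.1 1 ≠ 1 := by decide
  refine hf.moved hj h1 ?_
  rw [hc.apply, hf.fix i _ 0 (hf.self 0) h0]

end Natural

/-! ### Group-theoretic descriptions of points, equality and betweenness -/

section Predicates

variable {G : Type u} [Group G]

/-- The conjugate of a tuple. -/
abbrev conjTuple (a : G) (f : A5 → G) : A5 → G := fun i => a * f i * a⁻¹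

/-- For a pair `p` that represents `x` these are the indecomposable tuples with `x` in their
support. -/
def Detects (p : Fin 2 → A5 → G) (k : A5 → G) : Prop :=
  Indec k ∧ ¬ Comm k (p 0) ∧ ¬ Comm k (p 1)

/-- Two conjugates of `f` by members of `k` commute with `f` and with each other. -/
def CommConj (f k : A5 → G) : Prop :=
  ∃ i j, Comm f (conjTuple (k i) f) ∧ Comm f (conjTuple (k j) f) ∧
    Comm (conjTuple (k i) f) (conjTuple (k j) f)

/-- The group-theoretic property that singles out the pairs which represent a point. The clause on
conjugates by `h` excludes commuting pairs with different bases that act away from each other. The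
last clause excludes the remaining wrong pairs, in which some member acts on the side of its base
where a base of the pair is to be found or where the other member acts as well. -/
def IsRep (p : Fin 2 → A5 → G) : Prop :=
  Indec (p 0) ∧ Indec (p 1) ∧ Comm (p 0) (p 1) ∧
  (∀ h k, Indec h → Comm h (p 0) → Detects p k → ∀ i, ¬ Comm k (conjTuple (h i) (p 1))) ∧
  ∀ k, Detects p k → ∀ m, CommConj (p m) k ∨
    ∃ i, ∀ e, Indec e → ¬ (Comm e k ∧ Comm e (conjTuple (p m i) k))

/-- For pairs that represent points: the points are equal. -/
def SameRep (p q : Fin 2 → A5 → G) : Prop := ∀ k, Detects p k ↔ Detects q k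

/-- For pairs that represent points: the element `a` fixes the point. -/
def RepFixed (p : Fin 2 → A5 → G) (a : G) : Prop := SameRep p fun m => conjTuple a (p m)

/-- For pairs that represent points: the first point lies on the path between the others. -/
def RepPath (r p q : Fin 2 → A5 → G) : Prop :=
  ∀ a : G, a * a * a = 1 → RepFixed p a → RepFixed q a → RepFixed r a

/-- For pairs that represent points: the first point lies between the others. -/
def RepBetween (s p q : Fin 2 → A5 → G) : Prop :=
  ¬ SameRep s p ∧ ¬ SameRep s q ∧ RepPath s p q ∧
    ∀ r, IsRep r → RepPath r p q → ∀ h, Detects p h → Detects q h → Detects r h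

theorem Indec.conj {f : A5 → G} (hf : Indec f) (a : G) : Indec (conjTuple a f) := by
  refine ⟨hf.1.conj a, ?_⟩
  rintro ⟨g, h, hgh, hc⟩
  refine hf.2 ⟨_, _, fun i => ?_, hc.conj a⁻¹⟩
  have := hgh i
  rw [show a⁻¹ * g i * a⁻¹⁻¹ * (a⁻¹ * h i * a⁻¹⁻¹) = a⁻¹ * (g i * h i) * a by group, this]
  group

end Predicates

/-! ### Natural tuples with prescribed cones -/

section Ends

variable {M : Type u} [PartialOrder M]

theorem exists_gt (hK : KCone M) (x : M) : ∃ y, x < y := by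
  have h := hK.five_le x
  by_contra! h'
  have : IsEmpty {C : Set M // IsUpCone x C} := ⟨fun ⟨_, y, hy, _⟩ => h' y hy⟩
  rw [roUp, Cardinal.mk_eq_zero] at h
  norm_num at h

theorem exists_lt (hK : KCone M) (x : M) : ∃ y, y < x := by
  have h := (hK.five_le x).trans (hK.up_le_down x)
  by_contra! h'
  have : IsEmpty {C : Set M // IsDownCone x C} := ⟨fun ⟨_, y, hy, _⟩ => h' y hy⟩
  rw [roDown, Cardinal.mk_eq_zero] at h
  norm_num at h

end Ends

section Existence

variable {M : Type u} [PartialOrder M] [Pretree M] {f g h k : A5 → (M ≃o M)} {x y z p s t : M}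

/-- Natural tuples with three prescribed cones, acting on a further given point. -/
theorem exists_natural_of_three (hK : KCone M) {t : Fin 3 → M} (hs : s ≠ p) (ht : ∀ a, t a ≠ p)
    (hst : ∀ a, Above p (t a) ↔ Above p s) (h01 : OnPath p (t 0) (t 1))
    (h02 : OnPath p (t 0) (t 2)) (h12 : OnPath p (t 1) (t 2)) :
    ∃ f y, Natural f p y ∧ y 0 = t 0 ∧ y 1 = t 1 ∧ y 2 = t 2 ∧ s ∈ supp f := by
  classical
  -- the fourth cone is that of `s`, unless `s` is in one of the three given cones
  obtain ⟨u, hu, hus, hut, hsu⟩ : ∃ u, u ≠ p ∧ (Above p u ↔ Above p s) ∧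
      (∀ a, OnPath p u (t a)) ∧ ((∃ a, ¬ OnPath p s (t a)) ∨ ¬ OnPath p s u) := by
    by_cases h : ∃ a, ¬ OnPath p s (t a)
    · obtain ⟨u, hu, hus, hut⟩ := exists_avoiding hK p s {t 0, t 1, t 2}
        (Finset.card_le_three.trans (by norm_num))
      simp only [Finset.mem_insert, Finset.mem_singleton, forall_eq_or_imp, forall_eq] at hut
      refine ⟨u, hu, hus, fun a => ?_, Or.inl h⟩
      fin_cases a
      exacts [hut.1, hut.2.1, hut.2.2]
    · push Not at h
      exact ⟨s, hs, Iff.rfl, h, Or.inr fun h' => hs (onPath_self.1 h').symm⟩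
  obtain ⟨v, hv, hvs, hvt⟩ := exists_avoiding hK p s {t 0, t 1, t 2, u} Finset.card_le_four
  simp only [Finset.mem_insert, Finset.mem_singleton, forall_eq_or_imp, forall_eq] at hvt
  obtain ⟨hv0, hv1, hv2, hvu⟩ := hvt
  let y : Fin 5 → M := ![t 0, t 1, t 2, u, v]
  have hys : ∀ a, y a ≠ p ∧ (Above p (y a) ↔ Above p s) := by
    intro a
    fin_cases a
    exacts [⟨ht 0, hst 0⟩, ⟨ht 1, hst 1⟩, ⟨ht 2, hst 2⟩, ⟨hu, hus⟩, ⟨hv, hvs⟩]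
  have hd : ∀ a b, a < b → OnPath p (y a) (y b) := by
    intro a b hab
    fin_cases a <;> fin_cases b <;> first
      | exact absurd hab (by decide)
      | exact h01
      | exact h02
      | exact h12
      | exact (hut _).symm
      | exact hv0.symm
      | exact hv1.symm
      | exact hv2.symm
      | exact hvu.symm
  obtain ⟨f, hf⟩ := exists_natural hK (fun a => (hys a).1)
    (fun a => (hys a).2.trans (hys 0).2.symm)
    fun a b hab => (lt_or_gt_of_ne hab).elim (hd a b) fun h => (hd b a h).symm
  refine ⟨f, y, hf, rfl, rfl, rfl, hf.mem_supp.2 ?_⟩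
  rcases hsu with ⟨a, ha⟩ | h
  · fin_cases a
    exacts [⟨0, ha⟩, ⟨1, ha⟩, ⟨2, ha⟩]
  · exact ⟨3, h⟩

/-- Natural tuples that act on the cones of two given points. -/
theorem exists_natural_of_two (hK : KCone M) (hs : s ≠ p) (ht : t ≠ p)
    (hst : Above p s ↔ Above p t) : ∃ f y, Natural f p y ∧ s ∈ supp f ∧ t ∈ supp f := by
  classical
  obtain ⟨u, hu, hus, hut⟩ := exists_avoiding hK p s {s, t} (Finset.card_le_two.trans (by norm_num))
  simp only [Finset.mem_insert, Finset.mem_singleton, forall_eq_or_imp, forall_eq] at hut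
  obtain ⟨v, hv, hvs, hvt⟩ := exists_avoiding hK p s {s, u} (Finset.card_le_two.trans (by norm_num))
  simp only [Finset.mem_insert, Finset.mem_singleton, forall_eq_or_imp, forall_eq] at hvt
  obtain ⟨f, y, hf, h0, -, -, hmem⟩ := exists_natural_of_three hK (t := ![s, u, v]) ht
    (fun a => by fin_cases a; exacts [hs, hu, hv])
    (fun a => by fin_cases a; exacts [hst, hus.trans hst, hvs.trans hst])
    hut.1.symm hvt.1.symm hvt.2.symm
  exact ⟨f, y, hf, by simpa [h0] using hf.y_mem 0, hmem⟩

theorem exists_natural_of_mem (hK : KCone M) (hs : s ≠ p) :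
    ∃ f y, Natural f p y ∧ s ∈ supp f := by
  obtain ⟨f, y, hf, h, -⟩ := exists_natural_of_two hK hs hs Iff.rfl
  exact ⟨f, y, hf, h⟩

theorem exists_other_side (hK : KCone M) (x s : M) :
    ∃ t, t ≠ x ∧ ¬ (Above x t ↔ Above x s) := by
  by_cases h : Above x s
  · obtain ⟨t, ht⟩ := exists_lt hK x
    exact ⟨t, ht.ne, fun h' => (h'.2 h).not_below (below_of_lt ht)⟩
  · obtain ⟨t, ht⟩ := exists_gt hK x
    exact ⟨t, ht.ne', fun h' => h (h'.1 (above_of_lt ht))⟩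

/-- A tuple `f` based at `x`, together with any tuple that acts on the side of `x` where `f` acts,
violates the last clause in the description of the representing pairs. -/
theorem exists_bad_natural (hK : KCone M) (hf : Based f x) (hs : s ≠ x) (ht : t ∈ supp f)
    (hst : Above x s ↔ Above x t) :
    ∃ k y, Natural k x y ∧ s ∈ supp k ∧ ¬ Comm k f ∧ ¬ CommConj f k ∧
      ∀ i, ∃ e, Indec e ∧ Comm e k ∧ Comm e (conjTuple (f i) k) := by
  obtain ⟨i₁, i₂, h1, h2, h3⟩ := hf.three ht
  have hm1 := hf.isA5.apply_mem_supp ht i₁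
  have hm2 := hf.isA5.apply_mem_supp ht i₂
  obtain ⟨k, y, hk, h0, h1', h2', hsk⟩ := exists_natural_of_three hK (t := ![t, f i₁ t, f i₂ t]) hs
    (fun a => by fin_cases a; exacts [hf.ne ht, hf.ne hm1, hf.ne hm2])
    (fun a => by
      fin_cases a
      exacts [hst.symm, (hf.side hm1 ht).trans hst.symm, (hf.side hm2 ht).trans hst.symm])
    h1 h2 h3
  have hyf : ∀ a, (a = 0 ∨ a = 1 ∨ a = 2) → y a ∈ supp f := by
    rintro a (rfl | rfl | rfl)
    · exact h0 ▸ ht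
    · exact h1' ▸ hm1
    · exact h2' ▸ hm2
  refine ⟨k, y, hk, hsk, hk.not_comm hf (hk.y_mem 0) (hyf 0 (Or.inl rfl)), ?_, fun i => ?_⟩
  · have hb : ∀ i, Based (conjTuple (k i) f) x := fun i => by
      have := hf.conj (k i)
      rwa [hk.based.fixed] at this
    -- three of the five cones of `k` are moved by `f`, so `f` and its conjugates share a cone
    have hsupp : ∀ i, Comm f (conjTuple (k i) f) → supp f = supp (conjTuple (k i) f) := by
      intro i hc
      obtain ⟨a, b, ha, hb', hab⟩ := A5.exists_three_meet i
      have hu1 : k i (y a) ∈ supp f := by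
        refine hf.cone _ _ (hyf b hb') fun h => hk.move i (y a) a (hk.self a) ?_
        rw [hab]
        exact h.symm
      have hu2 : k i (y a) ∈ supp (conjTuple (k i) f) := mem_supp_conj.2 (hyf a ha)
      exact (hc.supp_subset hf (hb i) hu1 hu2).antisymm (hc.symm.supp_subset (hb i) hf hu2 hu1)
    rintro ⟨i, j, hi, hj, hij⟩
    exact no_three_commuting hf (hb i) (hb j) hi hj hij (hsupp i hi) (hsupp j hj)
  · obtain ⟨u, hu, hus⟩ := exists_other_side hK x s
    obtain ⟨e, ye, he, hue⟩ := exists_natural_of_mem hK hu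
    have hb : Based (conjTuple (f i) k) x := by
      have := hk.based.conj (f i)
      rwa [hf.fixed] at this
    refine ⟨e, he.indec, comm_of_side he.based hk.based hue hsk hus,
      comm_of_side he.based hb hue (mem_supp_conj.2 hsk) fun h => hus (h.trans ?_)⟩
    nth_rewrite 1 [← hf.fixed i]
    exact above_map (f i)

end Existence

/-! ### Representing pairs -/

section Represent

variable {M : Type u} [PartialOrder M] [Pretree M] {f g h k : A5 → (M ≃o M)} {x y z s t : M}
  {p q r : Fin 2 → A5 → (M ≃o M)}

/-- The two members of `p` are indecomposable tuples with base `x` that act on different sides. -/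
structure RepAt (p : Fin 2 → A5 → (M ≃o M)) (x : M) : Prop where
  indec : ∀ m, Indec (p m)
  based : ∀ m, Based (p m) x
  side : ∀ s ∈ supp (p 0), ∀ t ∈ supp (p 1), ¬ (Above x s ↔ Above x t)

theorem Based.of_isBase (hf : Indec f) (hx : IsBase f x) : Based f x := by
  obtain ⟨y, hy⟩ := hf.exists_based
  have h := hy.isBase
  rw [IsBase, hx] at h
  rwa [Set.singleton_eq_singleton_iff.1 h]

/-- Representing pairs in terms of sides of the base. -/
theorem represents_iff : Represents p x ↔ RepAt p x := by
  constructor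
  · have key : ∀ {f g : A5 → (M ≃o M)}, ActsUpAt f x → ActsDownAt g x → Based f x ∧ Based g x ∧
        ∀ s ∈ supp f, ∀ t ∈ supp g, ¬ (Above x s ↔ Above x t) := by
      rintro f g ⟨hf, hf', u, hu, hxu⟩ ⟨hg, hg', v, hv, hxv⟩
      have hf'' := Based.of_isBase hf hf'
      have hg'' := Based.of_isBase hg hg'
      refine ⟨hf'', hg'', fun s hs t ht h => ?_⟩
      have h1 := (hf''.side hu hs).1 (above_of_lt hxu)
      exact ((hg''.side ht hv).1 (h.1 h1)).not_below (below_of_lt hxv)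
    rintro (⟨h0, h1⟩ | ⟨h0, h1⟩)
    · obtain ⟨b0, b1, hs⟩ := key h0 h1
      exact ⟨Fin.forall_fin_two.2 ⟨h0.1, h1.1⟩, Fin.forall_fin_two.2 ⟨b0, b1⟩, hs⟩
    · obtain ⟨b1, b0, hs⟩ := key h1 h0
      exact ⟨Fin.forall_fin_two.2 ⟨h0.1, h1.1⟩, Fin.forall_fin_two.2 ⟨b0, b1⟩,
        fun s hs' t ht h => hs t ht s hs' h.symm⟩
  · intro h
    have up : ∀ m, ∀ s ∈ supp (p m), Above x s → ActsUpAt (p m) x := by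
      rintro m s hs ⟨y, hy, hsy⟩
      exact ⟨h.indec m, (h.based m).isBase, y,
        (h.based m).cone s y hs fun h' => hsy h', hy⟩
    have down : ∀ m, ∀ s ∈ supp (p m), ¬ Above x s → ActsDownAt (p m) x := by
      intro m s hs hs'
      obtain ⟨y, hy, hsy⟩ := (not_above_iff ((h.based m).ne hs)).1 hs'
      exact ⟨h.indec m, (h.based m).isBase, y,
        (h.based m).cone s y hs fun h' => hsy h', hy⟩
    obtain ⟨s, hs⟩ := (h.based 0).isA5.supp_nonempty
    obtain ⟨t, ht⟩ := (h.based 1).isA5.supp_nonempty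
    have hst := h.side s hs t ht
    by_cases ha : Above x s
    · exact Or.inl ⟨up 0 s hs ha, down 1 t ht fun h' => hst (iff_of_true ha h')⟩
    · exact Or.inr ⟨down 0 s hs ha, up 1 t ht (by tauto)⟩

theorem RepAt.unique (hp : RepAt p x) (hp' : RepAt p y) : x = y := (hp.based 0).unique (hp'.based 0)

theorem exists_repAt (hK : KCone M) (x : M) : ∃ p, RepAt p x := by
  obtain ⟨s, hs⟩ := exists_gt hK x
  obtain ⟨t, ht⟩ := exists_lt hK x
  obtain ⟨f, y, hf, hsf⟩ := exists_natural_of_mem hK hs.ne'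
  obtain ⟨g, z, hg, htg⟩ := exists_natural_of_mem hK ht.ne
  refine ⟨![f, g], Fin.forall_fin_two.2 ⟨hf.indec, hg.indec⟩,
    Fin.forall_fin_two.2 ⟨hf.based, hg.based⟩, fun u hu v hv h => ?_⟩
  have h1 := (hf.based.side hu hsf).2 (above_of_lt hs)
  exact ((hg.based.side hv htg).1 (h.1 h1)).not_below (below_of_lt ht)

theorem RepAt.conj (hp : RepAt p x) (φ : M ≃o M) :
    RepAt (fun m => conjTuple φ (p m)) (φ x) := by
  refine ⟨fun m => (hp.indec m).conj φ, fun m => (hp.based m).conj φ, fun s hs t ht => ?_⟩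
  obtain ⟨s, rfl⟩ := φ.surjective s
  obtain ⟨t, rfl⟩ := φ.surjective t
  rw [above_map, above_map]
  exact hp.side s (mem_supp_conj.1 hs) t (mem_supp_conj.1 ht)

theorem RepAt.comm (hp : RepAt p x) : Comm (p 0) (p 1) := by
  obtain ⟨s, hs⟩ := (hp.based 0).isA5.supp_nonempty
  obtain ⟨t, ht⟩ := (hp.based 1).isA5.supp_nonempty
  exact comm_of_side (hp.based 0) (hp.based 1) hs ht (hp.side s hs t ht)

/-- An indecomposable tuple commutes with neither member of a representing pair if and only if it
moves the point. -/
theorem RepAt.detects_iff (hp : RepAt p x) : Detects p k ↔ Indec k ∧ x ∈ supp k := by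
  refine ⟨fun ⟨hk, h0, h1⟩ => ⟨hk, ?_⟩, fun ⟨hk, hx⟩ =>
    ⟨hk, fun h => h.notMem (hp.based 0) hx, fun h => h.notMem (hp.based 1) hx⟩⟩
  by_contra hx
  obtain ⟨z, hz⟩ := hk.exists_based
  obtain ⟨s, hs⟩ := (hp.based 0).isA5.supp_nonempty
  obtain ⟨t, ht⟩ := (hp.based 1).isA5.supp_nonempty
  rcases eq_or_ne z x with rfl | hzx
  · obtain ⟨u, hu⟩ := hk.1.supp_nonempty
    have hst := hp.side s hs t ht
    by_cases hus : Above z u ↔ Above z s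
    · exact h1 (comm_of_side hz (hp.based 1) hu ht fun h => hst (hus.symm.trans h))
    · exact h0 (comm_of_side hz (hp.based 0) hu hs hus)
  · by_cases hz0 : z ∈ supp (p 0)
    · exact h1 (comm_of_ne hz (hp.based 1) hzx (fun hz1 => hp.side z hz0 z hz1 Iff.rfl) hx)
    · exact h0 (comm_of_ne hz (hp.based 0) hzx hz0 hx)

/-- Points that an unmoved point `z` separates from the base of `f` are not moved. -/
theorem Based.notMem_of_onPath (hf : Based f x) (hz : z ∉ supp f) (hxz : x ≠ z)
    (ht : OnPath z t x) : t ∉ supp f :=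
  fun h => hxz (eq_of_onPath_of_onPath (hf.onPath h hz) ht)

/-- Let `k`, with base `z`, move the point `x`. If `p m` fixes `z`, then `p m` and two conjugates
under `k` have their bases in different cones of `z`, so they commute. If `p m` moves `z` to a point
`z'` in another cone of `x`, then no tuple commutes both with `k` and with its conjugate based at
`z'`: both would fix its base, so `z` and `z'` would separate that base from `x`, whereas `x`
separates `z` from `z'`. -/
theorem RepAt.isRep (hp : RepAt p x) : IsRep p := by
  refine ⟨hp.indec 0, hp.indec 1, hp.comm, fun h k _ hh hk i hc => ?_, fun k hk m => ?_⟩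
  · have hb := (hp.based 1).conj (h i)
    rw [notMem_supp.1 (hh.notMem (hp.based 0))] at hb
    exact hc.notMem hb (hp.detects_iff.1 hk).2
  · obtain ⟨hk, hx⟩ := hp.detects_iff.1 hk
    obtain ⟨z, hz⟩ := hk.exists_based
    have hxz : x ≠ z := hz.ne hx
    have hf := hp.based m
    by_cases hzf : z ∈ supp (p m)
    · right
      obtain ⟨i, hi⟩ := hf.moved z hzf
      refine ⟨i, fun e he ⟨h1, h2⟩ => ?_⟩
      obtain ⟨w, hw⟩ := he.exists_based
      have hz' := hz.conj (p m i)
      have hx' : x ∈ supp (conjTuple (p m i) k) := by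
        have := (mem_supp_conj (φ := p m i)).2 hx
        rwa [hf.fixed] at this
      have h3 := hz.onPath hx (h1.symm.notMem hw)
      have h4 := hz'.onPath hx' (h2.symm.notMem hw)
      -- `x` separates the two bases, and both separate `x` from the base of `e`
      rcases hi.trans_or w with h5 | h5
      · exact hxz (eq_of_onPath_of_onPath h5.symm h3.symm)
      · exact hz'.ne hx' (eq_of_onPath_of_onPath h5 h4.symm)
    · left
      obtain ⟨i, j, h1, h2, h3⟩ := hz.three hx
      have hne : ∀ i, k i x ≠ z := fun i => hz.ne (hz.isA5.apply_mem_supp hx i)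
      have hnz : ∀ i, z ∉ supp (conjTuple (k i) (p m)) := by
        intro i h
        rw [← hz.fixed i] at h
        exact hzf (mem_supp_conj.1 h)
      have hd : ∀ {u v : M}, OnPath z u v → u ≠ z → u ≠ v := by
        rintro u v h hu rfl
        exact hu (onPath_self.1 h).symm
      have hb : ∀ i, Based (conjTuple (k i) (p m)) (k i x) := fun i => hf.conj (k i)
      exact ⟨i, j,
        comm_of_ne hf (hb i) (hd h1 hxz) ((hb i).notMem_of_onPath (hnz i) (hne i) h1)
          (hf.notMem_of_onPath hzf hxz h1.symm),
        comm_of_ne hf (hb j) (hd h2 hxz) ((hb j).notMem_of_onPath (hnz j) (hne j) h2)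
          (hf.notMem_of_onPath hzf hxz h2.symm),
        comm_of_ne (hb i) (hb j) (hd h3 (hne i)) ((hb j).notMem_of_onPath (hnz j) (hne j) h3)
          ((hb i).notMem_of_onPath (hnz i) (hne i) h3.symm)⟩

/-- In each wrong configuration of bases and sides a natural tuple violates one of the clauses. -/
theorem IsRep.exists_repAt (hK : KCone M) (hp : IsRep p) : ∃ x, RepAt p x := by
  obtain ⟨h0, h1, hc, R1, R2⟩ := hp
  obtain ⟨x, hx⟩ := h0.exists_based
  obtain ⟨y, hy⟩ := h1.exists_based
  obtain ⟨s, hs⟩ := hx.isA5.supp_nonempty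
  obtain ⟨t, ht⟩ := hy.isA5.supp_nonempty
  rcases eq_or_ne x y with rfl | hxy
  · by_cases hst : Above x s ↔ Above x t
    · obtain ⟨k, u, hk, htk, hk0, hk', he⟩ := exists_bad_natural hK hx (hy.ne ht) hs hst.symm
      refine absurd (R2 k ⟨hk.indec, hk0, hk.not_comm hy htk ht⟩ 0) ?_
      push Not
      exact ⟨hk', he⟩
    · refine ⟨x, Fin.forall_fin_two.2 ⟨h0, h1⟩, Fin.forall_fin_two.2 ⟨hx, hy⟩,
        fun u hu v hv h => hst ?_⟩
      exact ((hx.side hs hu).trans h).trans (hy.side hv ht)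
  · exfalso
    by_cases hyx : Above y x ↔ Above y t
    · obtain ⟨k, u, hk, hxk, hk1, hk', he⟩ := exists_bad_natural hK hy hxy ht hyx
      refine absurd (R2 k ⟨hk.indec, fun h => h.notMem hx hxk, hk1⟩ 1) ?_
      push Not
      exact ⟨hk', he⟩
    by_cases hxy' : Above x y ↔ Above x s
    · obtain ⟨k, u, hk, hyk, hk0, hk', he⟩ := exists_bad_natural hK hx hxy.symm hs hxy'
      refine absurd (R2 k ⟨hk.indec, hk0, fun h => h.notMem hy hyk⟩ 0) ?_
      push Not
      exact ⟨hk', he⟩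
    -- both members act away from the other base
    obtain ⟨h, u, hh, hyh⟩ := exists_natural_of_mem hK hxy.symm
    obtain ⟨i, hi⟩ := hh.based.moved y hyh
    have hix : h i x = x := hh.based.fixed i
    have hiy : h i y ≠ x := fun h' => hxy (by
      rw [← hix] at h'
      exact ((h i).injective h').symm)
    obtain ⟨k, v, hk, hxk⟩ := exists_natural_of_mem hK hiy.symm
    have hyk : y ∈ supp k := by
      refine hk.based.cone x y hxk fun h' => hiy ?_
      exact eq_of_onPath_of_onPath h'.symm hi
    refine R1 h k hh.indec (comm_of_side hh.based hx hyh hs hxy')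
      ⟨hk.indec, fun h => h.notMem hx hxk, fun h => h.notMem hy hyk⟩ i ?_
    refine comm_of_side hk.based (hy.conj (h i)) hxk (mem_supp_conj.2 ht) fun h' => hyx ?_
    rw [above_map] at h'
    rw [← h', ← above_map (h i), hix]

theorem isRep_iff (hK : KCone M) : IsRep p ↔ ∃ x, RepAt p x :=
  ⟨fun h => h.exists_repAt hK, fun ⟨_, h⟩ => h.isRep⟩

theorem sameRep_iff (hK : KCone M) (hp : RepAt p x) (hq : RepAt q y) : SameRep p q ↔ x = y := by
  constructor
  · intro h
    by_contra hxy
    obtain ⟨k, u, hk, hyk⟩ := exists_natural_of_mem hK (Ne.symm hxy)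
    have := (hp.detects_iff.1 ((h k).2 (hq.detects_iff.2 ⟨hk.indec, hyk⟩))).2
    exact hk.based.notMem this
  · rintro rfl k
    rw [hp.detects_iff, hq.detects_iff]

theorem repFixed_iff (hK : KCone M) (hp : RepAt p x) {φ : M ≃o M} : RepFixed p φ ↔ φ x = x :=
  (sameRep_iff hK hp (hp.conj φ)).trans eq_comm

/-- The path from `x` to `y` consists of the common fixed points of the automorphisms of order three
that fix both `x` and `y`. -/
theorem onPath_iff_forall_fixed (hK : KCone M) :
    OnPath z x y ↔ ∀ φ : M ≃o M, φ * φ * φ = 1 → φ x = x → φ y = y → φ z = z := by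
  classical
  refine ⟨fun h φ hφ hx hy => fixed_of_onPath (n := 3) (by norm_num)
    (by rw [pow_succ, pow_two, hφ]) hx hy h, fun h => ?_⟩
  obtain ⟨p, h1, h2, h3⟩ := exists_median z x y
  rcases eq_or_ne z p with rfl | hz
  · exact h2
  exfalso
  -- a three-cycle of cones of the median `p` moves the cone of `z` and fixes `x` and `y`
  obtain ⟨u, hu, hus, hut⟩ := exists_avoiding hK p z {z, x, y}
    (Finset.card_le_three.trans (by norm_num))
  simp only [Finset.mem_insert, Finset.mem_singleton, forall_eq_or_imp, forall_eq] at hut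
  obtain ⟨v, hv, hvs, hvt⟩ := exists_avoiding hK p z {z, x, y, u} Finset.card_le_four
  simp only [Finset.mem_insert, Finset.mem_singleton, forall_eq_or_imp, forall_eq] at hvt
  obtain ⟨f, w, hf, h0, h1', h2', -⟩ := exists_natural_of_three hK (t := ![z, u, v]) hz
    (fun a => by fin_cases a; exacts [hz, hu, hv])
    (fun a => by fin_cases a; exacts [Iff.rfl, hus, hvs])
    hut.1.symm hvt.1.symm hvt.2.2.2.symm
  simp only [Matrix.cons_val] at h0 h1' h2'
  let c : A5 := threeCycle 0 1 2 (by decide) (by decide)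
  have hc : c * c * c = 1 := by decide
  have hcfix : ∀ a : Fin 5, a ≠ 0 → a ≠ 1 → a ≠ 2 → c.1 a = a := by decide
  have hfix : ∀ t, OnPath p t z → OnPath p t u → OnPath p t v → f c t = t := by
    intro t h0' h1'' h2''
    by_cases ht : ∀ a, OnPath p t (w a)
    · exact hf.off c t ht
    · push Not at ht
      obtain ⟨a, ha⟩ := ht
      refine hf.fix c t a ha (hcfix a ?_ ?_ ?_)
      · rintro rfl
        exact ha (h0 ▸ h0')
      · rintro rfl
        exact ha (h1' ▸ h1'')
      · rintro rfl
        exact ha (h2' ▸ h2'')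
  have hfc : f c * f c * f c = 1 := by
    rw [hf.isA5.mul, hf.isA5.mul, hc, hf.isA5.one]
  refine hf.moved (i := c) (a := 0) (hf.self 0) (by decide) ?_
  have := h (f c) hfc (hfix x h1.symm hut.2.1.symm hvt.2.1.symm)
    (hfix y h3.symm hut.2.2.symm hvt.2.2.1.symm)
  rw [h0, this]

theorem repPath_iff (hK : KCone M) (hr : RepAt r z) (hp : RepAt p x) (hq : RepAt q y) :
    RepPath r p q ↔ OnPath z x y := by
  rw [onPath_iff_forall_fixed hK]
  simp only [RepPath, repFixed_iff hK hr, repFixed_iff hK hp, repFixed_iff hK hq]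

/-- Two points are incomparable if and only if the path between them has an inner point `w` at which
it turns, and then some tuple based at `w` acts on both points. -/
theorem between_iff (hK : KCone M) : Between z x y ↔ z ≠ x ∧ z ≠ y ∧ OnPath z x y ∧
    ∀ w, OnPath w x y → ∀ h, Indec h → x ∈ supp h → y ∈ supp h → w ∈ supp h := by
  have key : ∀ {x y z : M}, x < z → z < y → z ≠ x ∧ z ≠ y ∧ OnPath z x y ∧
      ∀ w, OnPath w x y → ∀ h, Indec h → x ∈ supp h → y ∈ supp h → w ∈ supp h := by
    intro x y z hxz hzy
    refine ⟨hxz.ne', hzy.ne, (Pretree.of_le (hxz.trans hzy).le).2 ⟨hxz.le, hzy.le⟩,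
      fun w hw h hh hx hy => ?_⟩
    obtain ⟨v, hv⟩ := hh.exists_based
    obtain ⟨hxw, hwy⟩ := (Pretree.of_le (hxz.trans hzy).le).1 hw
    by_contra hwh
    obtain rfl : w = v := le_antisymm ((Pretree.of_le hwy).1 (hv.onPath hy hwh).symm).1
      ((Pretree.of_le hxw).1 (hv.onPath hx hwh)).2
    have h1 := above_of_lt (lt_of_le_of_ne hwy (hv.ne hy).symm)
    exact ((hv.side hy hx).1 h1).not_below (below_of_lt (lt_of_le_of_ne hxw (hv.ne hx)))
  constructor
  · rintro (⟨h1, h2⟩ | ⟨h1, h2⟩)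
    · exact key h1 h2
    · obtain ⟨h3, h4, h5, h6⟩ := key h1 h2
      exact ⟨h4, h3, h5.symm, fun w hw h hh hx hy => h6 w hw.symm h hh hy hx⟩
  · rintro ⟨hzx, hzy, hz, hw⟩
    by_cases hxy : x ≤ y
    · obtain ⟨h1, h2⟩ := (Pretree.of_le hxy).1 hz
      exact Or.inl ⟨lt_of_le_of_ne h1 hzx.symm, lt_of_le_of_ne h2 hzy⟩
    by_cases hyx : y ≤ x
    · obtain ⟨h1, h2⟩ := (Pretree.of_le hyx).1 hz.symm
      exact Or.inr ⟨lt_of_le_of_ne h1 hzy.symm, lt_of_le_of_ne h2 hzx⟩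
    obtain ⟨w, hwp, hwx, hwy, hside⟩ := Pretree.turn hxy hyx
    have hiff : Above w x ↔ Above w y := by
      rcases hside with h | h
      · exact iff_of_true h.1 h.2
      · exact iff_of_false (fun h' => h'.not_below h.1) fun h' => h'.not_below h.2
    obtain ⟨f, v, hf, hxf, hyf⟩ := exists_natural_of_two hK hwx.symm hwy.symm hiff
    exact absurd (hw w hwp f hf.indec hxf hyf) hf.based.notMem

theorem repBetween_iff (hK : KCone M) (hr : RepAt r z) (hp : RepAt p x) (hq : RepAt q y) :
    RepBetween r p q ↔ Between z x y := by
  rw [between_iff hK, RepBetween, sameRep_iff hK hr hp, sameRep_iff hK hr hq,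
    repPath_iff hK hr hp hq]
  refine and_congr_right fun _ => and_congr_right fun _ => and_congr_right fun _ => ?_
  constructor
  · intro h w hw k hk hx hy
    obtain ⟨s, hs⟩ := CFPO.exists_repAt hK w
    exact (hs.detects_iff.1 (h s hs.isRep ((repPath_iff hK hs hp hq).2 hw) k
      (hp.detects_iff.2 ⟨hk, hx⟩) (hq.detects_iff.2 ⟨hk, hy⟩))).2
  · intro h s hs hs' k hk hk'
    obtain ⟨w, hw⟩ := hs.exists_repAt hK
    obtain ⟨hk, hx⟩ := hp.detects_iff.1 hk
    exact hw.detects_iff.2 ⟨hk, h w ((repPath_iff hK hw hp hq).1 hs') k hk hx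
      (hq.detects_iff.1 hk').2⟩

end Represent

/-! ### Properties expressed by group formulas -/

section Expressible

open FirstOrder

variable {α β : Type}

/-- The property `P` of assignments is expressed by one group formula in all groups. -/
def Expressible (P : ∀ (G : Type u) [Group G], (α → G) → Prop) : Prop :=
  ∃ φ : groupLang.Formula α, ∀ (G : Type u) [Group G] (v : α → G), φ.Realize v ↔ P G v

/-- The function `t` of assignments is given by one group term in all groups. -/
def IsTerm (t : ∀ (G : Type u) [Group G], (α → G) → G) : Prop :=
  ∃ τ : groupLang.Term α, ∀ (G : Type u) [Group G] (v : α → G), τ.realize v = t G v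

variable {s t : ∀ (G : Type u) [Group G], (α → G) → G}
  {P Q : ∀ (G : Type u) [Group G], (α → G) → Prop}

theorem isTerm_var (a : α) : IsTerm.{u} fun _ _ v => v a := ⟨.var a, fun _ _ _ => rfl⟩

theorem isTerm_one : IsTerm.{u} fun (G : Type u) [Group G] (_ : α → G) => (1 : G) :=
  ⟨.func GroupFunc.one Fin.elim0, fun _ _ _ => rfl⟩

theorem IsTerm.inv (hs : IsTerm.{u} s) : IsTerm.{u} fun G _ v => (s G v)⁻¹ := by
  obtain ⟨σ, hσ⟩ := hs
  exact ⟨.func GroupFunc.inv ![σ], fun G _ v => congrArg Inv.inv (hσ G v)⟩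

theorem IsTerm.mul (hs : IsTerm.{u} s) (ht : IsTerm.{u} t) :
    IsTerm.{u} fun G _ v => s G v * t G v := by
  obtain ⟨σ, hσ⟩ := hs
  obtain ⟨τ, hτ⟩ := ht
  exact ⟨.func GroupFunc.mul ![σ, τ], fun G _ v => congrArg₂ (· * ·) (hσ G v) (hτ G v)⟩

theorem IsTerm.comp (hs : IsTerm.{u} s) (b : α → β) :
    IsTerm.{u} fun G _ v => s G fun a => v (b a) := by
  obtain ⟨σ, hσ⟩ := hs
  refine ⟨σ.relabel b, fun G _ v => ?_⟩
  rw [Language.Term.realize_relabel, hσ]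
  rfl

theorem IsTerm.eq (hs : IsTerm.{u} s) (ht : IsTerm.{u} t) :
    Expressible.{u} fun G _ v => s G v = t G v := by
  obtain ⟨σ, hσ⟩ := hs
  obtain ⟨τ, hτ⟩ := ht
  refine ⟨σ.equal τ, fun G _ v => ?_⟩
  rw [Language.Formula.realize_equal, hσ, hτ]

theorem Expressible.not (hP : Expressible.{u} P) : Expressible.{u} fun G _ v => ¬ P G v := by
  obtain ⟨φ, hφ⟩ := hP
  exact ⟨φ.not, fun G _ v => not_congr (hφ G v)⟩

theorem Expressible.imp (hP : Expressible.{u} P) (hQ : Expressible.{u} Q) :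
    Expressible.{u} fun G _ v => P G v → Q G v := by
  obtain ⟨φ, hφ⟩ := hP
  obtain ⟨ψ, hψ⟩ := hQ
  exact ⟨φ.imp ψ, fun G _ v => Language.Formula.realize_imp.trans
    (imp_congr (hφ G v) (hψ G v))⟩

theorem Expressible.and (hP : Expressible.{u} P) (hQ : Expressible.{u} Q) :
    Expressible.{u} fun G _ v => P G v ∧ Q G v := by
  obtain ⟨φ, hφ⟩ := hP
  obtain ⟨ψ, hψ⟩ := hQ
  exact ⟨φ ⊓ ψ, fun G _ v => Language.Formula.realize_inf.trans
    (and_congr (hφ G v) (hψ G v))⟩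

theorem Expressible.congr (hP : Expressible.{u} P)
    (h : ∀ (G : Type u) [Group G] (v : α → G), P G v ↔ Q G v) : Expressible.{u} Q := by
  obtain ⟨φ, hφ⟩ := hP
  exact ⟨φ, fun G _ v => (hφ G v).trans (h G v)⟩

theorem Expressible.or (hP : Expressible.{u} P) (hQ : Expressible.{u} Q) :
    Expressible.{u} fun G _ v => P G v ∨ Q G v :=
  (hP.not.imp hQ).congr fun _ _ _ => or_iff_not_imp_left.symm

theorem Expressible.iff (hP : Expressible.{u} P) (hQ : Expressible.{u} Q) :
    Expressible.{u} fun G _ v => P G v ↔ Q G v :=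
  ((hP.imp hQ).and (hQ.imp hP)).congr fun _ _ _ => iff_iff_implies_and_implies.symm

section Finite

variable {ι : Type} [Finite ι] {R : ι → ∀ (G : Type u) [Group G], (α → G) → Prop}

theorem Expressible.all (hR : ∀ i, Expressible.{u} (R i)) :
    Expressible.{u} fun G _ v => ∀ i, R i G v := by
  choose φ hφ using hR
  exact ⟨Language.Formula.iInf φ, fun G _ v => Language.Formula.realize_iInf.trans
    (forall_congr' fun i => hφ i G v)⟩

theorem Expressible.ex (hR : ∀ i, Expressible.{u} (R i)) :
    Expressible.{u} fun G _ v => ∃ i, R i G v :=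
  (Expressible.all fun i => (hR i).not).not.congr fun _ _ _ => by push Not; rfl

end Finite

/-- Quantification over a finite block of variables. -/
theorem Expressible.allBlock [Finite β]
    {R : ∀ (G : Type u) [Group G], (α → G) → (β → G) → Prop}
    (hR : Expressible.{u} fun G _ (v : α ⊕ β → G) =>
      R G (fun a => v (.inl a)) fun b => v (.inr b)) :
    Expressible.{u} fun G _ v => ∀ w, R G v w := by
  obtain ⟨φ, hφ⟩ := hR
  refine ⟨φ.iAlls β, fun G _ v => ?_⟩
  rw [Language.Formula.realize_iAlls]
  exact forall_congr' fun w => hφ G _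

end Expressible

/-! ### The formulas of the interpretation -/

section Formulas

variable {α : Type} {f g h k f' g' : ∀ (G : Type u) [Group G], (α → G) → A5 → G}
  {a : ∀ (G : Type u) [Group G], (α → G) → G}
  {p q r : ∀ (G : Type u) [Group G], (α → G) → Fin 2 → A5 → G}

/-- All members of a tuple are given by terms. -/
def IsTermTuple (f : ∀ (G : Type u) [Group G], (α → G) → A5 → G) : Prop :=
  ∀ i, IsTerm.{u} fun G _ v => f G v i

theorem IsTermTuple.comp {β : Type} (hf : IsTermTuple.{u} f) (b : α → β) :
    IsTermTuple.{u} fun G _ (v : β → G) => f G fun a => v (b a) := fun i => (hf i).comp b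

theorem IsTermTuple.conj (hf : IsTermTuple.{u} f) (ha : IsTerm.{u} a) :
    IsTermTuple.{u} fun G _ v => conjTuple (a G v) (f G v) := fun i => (ha.mul (hf i)).mul ha.inv

theorem expressible_isA5 (hf : IsTermTuple.{u} f) : Expressible.{u} fun G _ v => IsA5 (f G v) := by
  refine Expressible.all fun i => Expressible.all fun j => Expressible.all fun k => ?_
  by_cases h : i * j = k
  · exact (((hf i).mul (hf j)).eq (hf k)).congr fun _ _ _ => (iff_true_right h).symm
  · exact (((hf i).mul (hf j)).eq (hf k)).not.congr fun _ _ _ => (iff_false_right h).symm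

theorem expressible_comm (hf : IsTermTuple.{u} f) (hg : IsTermTuple.{u} g) :
    Expressible.{u} fun G _ v => Comm (f G v) (g G v) :=
  (expressible_isA5 hf).and ((expressible_isA5 hg).and (Expressible.all fun i =>
    Expressible.all fun j => ((hf i).mul (hg j)).eq ((hg j).mul (hf i))))

theorem isTermTuple_inr : IsTermTuple.{u} fun _ _ (v : α ⊕ A5 → _) i => v (.inr i) :=
  fun i => isTerm_var (Sum.inr i)

theorem expressible_indec (hf : IsTermTuple.{u} f) :
    Expressible.{u} fun G _ v => Indec (f G v) := by
  refine ((expressible_isA5 hf).and (Expressible.allBlock (R := fun G _ v g => ∀ h : A5 → G,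
    ¬ ((∀ i, g i * h i = f G v i) ∧ Comm g h)) (Expressible.allBlock (Expressible.not
      (Expressible.and (Expressible.all fun i => ?_) (expressible_comm ?_ ?_)))))).congr
    fun G _ v => and_congr_right fun _ => by push Not; rfl
  · exact ((isTerm_var (.inl (.inr i))).mul (isTerm_var (.inr i))).eq
      (((hf i).comp Sum.inl).comp Sum.inl)
  · exact isTermTuple_inr.comp Sum.inl
  · exact isTermTuple_inr

theorem expressible_detects (hp : ∀ m, IsTermTuple.{u} fun G _ v => p G v m)
    (hk : IsTermTuple.{u} k) : Expressible.{u} fun G _ v => Detects (p G v) (k G v) :=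
  (expressible_indec hk).and ((expressible_comm hk (hp 0)).not.and (expressible_comm hk (hp 1)).not)

theorem expressible_commConj (hf : IsTermTuple.{u} f) (hk : IsTermTuple.{u} k) :
    Expressible.{u} fun G _ v => CommConj (f G v) (k G v) :=
  Expressible.ex fun i => Expressible.ex fun j =>
    (expressible_comm hf (hf.conj (hk i))).and ((expressible_comm hf (hf.conj (hk j))).and
      (expressible_comm (hf.conj (hk i)) (hf.conj (hk j))))

theorem expressible_isRep (hp : ∀ m, IsTermTuple.{u} fun G _ v => p G v m) :
    Expressible.{u} fun G _ v => IsRep (p G v) := by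
  refine (expressible_indec (hp 0)).and ((expressible_indec (hp 1)).and
    ((expressible_comm (hp 0) (hp 1)).and (Expressible.and ?_ ?_)))
  · have hp' := fun m => ((hp m).comp (Sum.inl (β := A5))).comp (Sum.inl (β := A5))
    refine Expressible.allBlock (Expressible.allBlock ?_)
    have hh : IsTermTuple.{u} fun _ _ (v : (α ⊕ A5) ⊕ A5 → _) i => v (.inl (.inr i)) :=
      isTermTuple_inr.comp Sum.inl
    exact (expressible_indec hh).imp ((expressible_comm hh (hp' 0)).imp
      ((expressible_detects hp' isTermTuple_inr).imp (Expressible.all fun i =>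
        (expressible_comm isTermTuple_inr ((hp' 1).conj (hh i))).not)))
  · have hp' := fun m => (hp m).comp (Sum.inl (β := A5))
    have hp'' := fun m => (hp' m).comp (Sum.inl (β := A5))
    have hk : IsTermTuple.{u} fun _ _ (v : (α ⊕ A5) ⊕ A5 → _) i => v (.inl (.inr i)) :=
      isTermTuple_inr.comp Sum.inl
    refine Expressible.allBlock ((expressible_detects hp' isTermTuple_inr).imp
      (Expressible.all fun m => (expressible_commConj (hp' m) isTermTuple_inr).or
        (Expressible.ex fun i => Expressible.allBlock ?_)))
    exact (expressible_indec isTermTuple_inr).imp ((expressible_comm isTermTuple_inr hk).and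
      (expressible_comm isTermTuple_inr (hk.conj (hp'' m i)))).not

theorem expressible_sameRep (hp : ∀ m, IsTermTuple.{u} fun G _ v => p G v m)
    (hq : ∀ m, IsTermTuple.{u} fun G _ v => q G v m) :
    Expressible.{u} fun G _ v => SameRep (p G v) (q G v) :=
  Expressible.allBlock <|
    (expressible_detects (fun m => (hp m).comp Sum.inl) isTermTuple_inr).iff
      (expressible_detects (fun m => (hq m).comp Sum.inl) isTermTuple_inr)

theorem expressible_repFixed (hp : ∀ m, IsTermTuple.{u} fun G _ v => p G v m) (ha : IsTerm.{u} a) :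
    Expressible.{u} fun G _ v => RepFixed (p G v) (a G v) :=
  expressible_sameRep hp fun m => (hp m).conj ha

theorem expressible_repPath (hr : ∀ m, IsTermTuple.{u} fun G _ v => r G v m)
    (hp : ∀ m, IsTermTuple.{u} fun G _ v => p G v m)
    (hq : ∀ m, IsTermTuple.{u} fun G _ v => q G v m) :
    Expressible.{u} fun G _ v => RepPath (r G v) (p G v) (q G v) := by
  have ha : IsTerm.{u} fun _ _ (v : α ⊕ Unit → _) => v (.inr ()) := isTerm_var _
  have h : Expressible.{u} fun G _ (v : α → G) => ∀ w : Unit → G, w () * w () * w () = 1 →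
      RepFixed (p G v) (w ()) → RepFixed (q G v) (w ()) → RepFixed (r G v) (w ()) :=
    Expressible.allBlock <| (((ha.mul ha).mul ha).eq isTerm_one).imp <|
      (expressible_repFixed (fun m => (hp m).comp Sum.inl) ha).imp <|
      (expressible_repFixed (fun m => (hq m).comp Sum.inl) ha).imp
        (expressible_repFixed (fun m => (hr m).comp Sum.inl) ha)
  exact h.congr fun G _ v => ⟨fun h b => h fun _ => b, fun h w => h (w ())⟩

theorem expressible_repBetween (hr : ∀ m, IsTermTuple.{u} fun G _ v => r G v m)
    (hp : ∀ m, IsTermTuple.{u} fun G _ v => p G v m)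
    (hq : ∀ m, IsTermTuple.{u} fun G _ v => q G v m) :
    Expressible.{u} fun G _ v => RepBetween (r G v) (p G v) (q G v) := by
  refine (expressible_sameRep hr hp).not.and ((expressible_sameRep hr hq).not.and
    ((expressible_repPath hr hp hq).and ?_))
  have hs : ∀ m, IsTermTuple.{u} fun _ _ (v : α ⊕ (Fin 2 × A5) → _) i => v (.inr (m, i)) :=
    fun m i => isTerm_var _
  have hp' := fun m => (hp m).comp (Sum.inl (β := Fin 2 × A5))
  have hq' := fun m => (hq m).comp (Sum.inl (β := Fin 2 × A5))
  have h : Expressible.{u} fun G _ (v : α → G) => ∀ w : Fin 2 × A5 → G,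
      IsRep (fun m i => w (m, i)) → RepPath (fun m i => w (m, i)) (p G v) (q G v) →
      ∀ h, Detects (p G v) h → Detects (q G v) h → Detects (fun m i => w (m, i)) h :=
    Expressible.allBlock <| (expressible_isRep hs).imp <| (expressible_repPath hs hp' hq').imp <|
      Expressible.allBlock <|
      (expressible_detects (fun m => (hp' m).comp Sum.inl) isTermTuple_inr).imp <|
      (expressible_detects (fun m => (hq' m).comp Sum.inl) isTermTuple_inr).imp <|
      expressible_detects (fun m => (hs m).comp Sum.inl) isTermTuple_inr
  exact h.congr fun G _ v => ⟨fun h s => h fun b => s b.1 b.2, fun h w => h fun m i => w (m, i)⟩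

theorem exists_formulas : ∃ (rep : groupLang.Formula (Vars 1)) (eqRep : groupLang.Formula (Vars 2))
    (btw : groupLang.Formula (Vars 3)),
    (∀ (G : Type u) [Group G] (p : Fin 2 → A5 → G), Holds rep ![p] ↔ IsRep p) ∧
    (∀ (G : Type u) [Group G] (p q : Fin 2 → A5 → G), Holds eqRep ![p, q] ↔ SameRep p q) ∧
    ∀ (G : Type u) [Group G] (r p q : Fin 2 → A5 → G),
      Holds btw ![r, p, q] ↔ RepBetween r p q := by
  have hv : ∀ {n : ℕ} (a : Fin n) (m : Fin 2),
      IsTermTuple.{u} fun _ _ (v : Vars n → _) i => v (a, m, i) := fun a m i => isTerm_var _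
  obtain ⟨rep, h1⟩ := expressible_isRep (p := fun _ _ (v : Vars 1 → _) m i => v (0, m, i)) (hv 0)
  obtain ⟨eqRep, h2⟩ := expressible_sameRep (p := fun _ _ (v : Vars 2 → _) m i => v (0, m, i))
    (q := fun _ _ (v : Vars 2 → _) m i => v (1, m, i)) (hv 0) (hv 1)
  obtain ⟨btw, h3⟩ := expressible_repBetween (r := fun _ _ (v : Vars 3 → _) m i => v (0, m, i))
    (p := fun _ _ (v : Vars 3 → _) m i => v (1, m, i))
    (q := fun _ _ (v : Vars 3 → _) m i => v (2, m, i)) (hv 0) (hv 1) (hv 2)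
  exact ⟨rep, eqRep, btw, fun G _ p => h1 G _, fun G _ p q => h2 G _, fun G _ r p q => h3 G _⟩

end Formulas

/-! ### The interpretation and isomorphisms of automorphism groups -/

section Interpretation

theorem interpretsBetweenness {rep : groupLang.Formula (Vars 1)}
    {eqRep : groupLang.Formula (Vars 2)} {btw : groupLang.Formula (Vars 3)} {M : Type u}
    [PartialOrder M] (hK : KCone M)
    (hrep : ∀ p : Fin 2 → A5 → (M ≃o M), Holds rep ![p] ↔ IsRep p)
    (heq : ∀ p q : Fin 2 → A5 → (M ≃o M), Holds eqRep ![p, q] ↔ SameRep p q)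
    (hbtw : ∀ r p q : Fin 2 → A5 → (M ≃o M), Holds btw ![r, p, q] ↔ RepBetween r p q) :
    InterpretsBetweenness rep eqRep btw M := by
  have := pretree hK.cfpo hK.pathComplete
  choose r hr using fun q : {q : Fin 2 → A5 → (M ≃o M) // Holds rep ![q]} =>
    (isRep_iff hK).1 ((hrep q.1).1 q.2)
  refine ⟨r, fun x => ?_, fun p => represents_iff.2 (hr p),
    fun p x h => (hrep p).2 (represents_iff.1 h).isRep,
    fun p q => (heq _ _).trans (sameRep_iff hK (hr p) (hr q)),
    fun s p q => (hbtw _ _ _).trans (repBetween_iff hK (hr s) (hr p) (hr q))⟩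
  obtain ⟨p, hp⟩ := exists_repAt hK x
  exact ⟨⟨p, (hrep p).2 hp.isRep⟩, (hr _).unique hp⟩

theorem holds_map {G H : Type u} [Group G] [Group H] (e : G ≃* H) {n : ℕ}
    (φ : groupLang.Formula (Vars n)) (p : Fin n → Fin 2 → A5 → G) :
    Holds φ (fun a m i => e (p a m i)) ↔ Holds φ p := by
  let e' : groupLang.Equiv G H :=
    { e.toEquiv with
      map_fun' := fun F v => by
        cases F with
        | one => exact e.map_one
        | inv => exact e.map_inv _
        | mul => exact e.map_mul _ _
      map_rel' := fun R => nomatch R }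
  exact FirstOrder.Language.StrongHomClass.realize_formula e' φ

theorem betweennessIso_of_interprets {rep : groupLang.Formula (Vars 1)}
    {eqRep : groupLang.Formula (Vars 2)} {btw : groupLang.Formula (Vars 3)} {M N : Type u}
    [PartialOrder M] [PartialOrder N] (hM : InterpretsBetweenness rep eqRep btw M)
    (hN : InterpretsBetweenness rep eqRep btw N) (e : (M ≃o M) ≃* (N ≃o N)) :
    BetweennessIso M N := by
  obtain ⟨r, hr, -, -, heq, hbtw⟩ := hM
  obtain ⟨s, hs, -, -, heq', hbtw'⟩ := hN
  have h1 : ∀ p : Fin 2 → A5 → (M ≃o M), Holds rep ![fun m i => e (p m i)] ↔ Holds rep ![p] := by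
    intro p
    rw [← holds_map e]
    refine iff_of_eq (congrArg _ ?_)
    funext a
    fin_cases a
    rfl
  have h2 : ∀ p q : Fin 2 → A5 → (M ≃o M), Holds eqRep ![fun m i => e (p m i),
      fun m i => e (q m i)] ↔ Holds eqRep ![p, q] := by
    intro p q
    rw [← holds_map e]
    refine iff_of_eq (congrArg _ ?_)
    funext a
    fin_cases a <;> rfl
  have h3 : ∀ t p q : Fin 2 → A5 → (M ≃o M), Holds btw ![fun m i => e (t m i),
      fun m i => e (p m i), fun m i => e (q m i)] ↔ Holds btw ![t, p, q] := by
    intro t p q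
    rw [← holds_map e]
    refine iff_of_eq (congrArg _ ?_)
    funext a
    fin_cases a <;> rfl
  let E : {q : Fin 2 → A5 → (M ≃o M) // Holds rep ![q]} →
      {q : Fin 2 → A5 → (N ≃o N) // Holds rep ![q]} :=
    fun p => ⟨fun m i => e (p.1 m i), (h1 p.1).2 p.2⟩
  have hE : ∀ p q, s (E p) = s (E q) ↔ r p = r q := fun p q => by
    rw [← heq, ← heq']
    exact h2 p.1 q.1
  choose c hc using hr
  have hbij : Function.Bijective fun x => s (E (c x)) := by
    refine ⟨fun x y hxy => ?_, fun y => ?_⟩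
    · have := (hE _ _).1 hxy
      rwa [hc, hc] at this
    · obtain ⟨q, rfl⟩ := hs y
      have hq : (fun m i => e (e.symm (q.1 m i))) = q.1 := by simp
      let p : {q : Fin 2 → A5 → (M ≃o M) // Holds rep ![q]} :=
        ⟨fun m i => e.symm (q.1 m i), (h1 _).1 (hq.symm ▸ q.2)⟩
      refine ⟨r p, ((hE _ _).2 (hc _)).trans (congrArg s (Subtype.ext hq))⟩
  refine ⟨Equiv.ofBijective _ hbij, fun z x y => ?_⟩
  have h4 : Between z x y ↔ Between (r (c z)) (r (c x)) (r (c y)) := by rw [hc, hc, hc]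
  rw [h4, ← hbtw, ← h3]
  exact hbtw' (E (c z)) (E (c x)) (E (c y))

end Interpretation

/-! ### Betweenness isomorphisms and orders -/

section Isomorphisms

theorem mk_le_of_preimage {M N : Type u} {P : Set M → Prop} {Q : Set N → Prop} (e : M ≃ N)
    (h : ∀ C, Q C → P (e ⁻¹' C)) :
    Cardinal.mk {C : Set N // Q C} ≤ Cardinal.mk {C : Set M // P C} :=
  Cardinal.mk_le_of_injective (f := fun C => ⟨e ⁻¹' C.1, h C.1 C.2⟩) fun _ _ hCD =>
    Subtype.ext (e.surjective.preimage_injective (congrArg Subtype.val hCD))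

variable {M N : Type u} [PartialOrder M] [PartialOrder N]

theorem aut_mulEquiv_of_orderIso (e : M ≃o N) : Nonempty ((M ≃o M) ≃* (N ≃o N)) :=
  ⟨{ toFun := fun φ => (e.symm.trans φ).trans e
     invFun := fun φ => (e.trans φ).trans e.symm
     left_inv := fun φ => by ext; simp
     right_inv := fun φ => by ext; simp
     map_mul' := fun φ ψ => by ext; simp }⟩

theorem aut_mulEquiv_dual : Nonempty ((Mᵒᵈ ≃o Mᵒᵈ) ≃* (M ≃o M)) :=
  ⟨{ toFun := fun φ => φ.dual
     invFun := fun φ => φ.dual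
     left_inv := fun _ => rfl
     right_inv := fun _ => rfl
     map_mul' := fun _ _ => rfl }⟩

/-- An isomorphism of the betweenness relations preserves comparability, as there are no end points;
by connectedness it preserves the order everywhere or reverses it everywhere. -/
theorem orderIso_or_dual_of_betweennessIso (hM : KCone M) (hN : KCone N)
    (h : BetweennessIso M N) : Nonempty (M ≃o N) ∨ Nonempty (M ≃o Nᵒᵈ) := by
  have := pretree hM.cfpo hM.pathComplete
  obtain ⟨e, he⟩ := h
  have hup : ∀ a : M, ∃ b, a < b := exists_gt hM
  have hdown : ∀ a : M, ∃ b, b < a := exists_lt hM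
  have hmid : ∀ {x z y : M}, x < z → z < y → (e x < e z ∧ e z < e y) ∨ (e y < e z ∧ e z < e x) :=
    fun h1 h2 => (he _ _ _).1 (Or.inl ⟨h1, h2⟩)
  have hcomp : ∀ {x y : M}, e x < e y → x < y ∨ y < x := by
    intro x y hxy
    obtain ⟨d, hd⟩ := exists_gt hN (e y)
    obtain ⟨d, rfl⟩ := e.surjective d
    exact ((he _ _ _).2 (Or.inl ⟨hxy, hd⟩)).imp And.left And.right
  let Pos : M → Prop := fun x => (∀ y, x < y → e x < e y) ∧ ∀ y, y < x → e y < e x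
  let Neg : M → Prop := fun x => (∀ y, x < y → e y < e x) ∧ ∀ y, y < x → e x < e y
  have hor : ∀ x, Pos x ∨ Neg x := by
    intro x
    obtain ⟨a, ha⟩ := hdown x
    obtain ⟨b, hb⟩ := hup x
    rcases hmid ha hb with ⟨h1, h2⟩ | ⟨h1, h2⟩
    · refine Or.inl ⟨fun y hy => ?_, fun y hy => ?_⟩
      · exact (hmid ha hy).elim And.right fun h => absurd h.2 h1.asymm
      · exact (hmid hy hb).elim And.left fun h => absurd h.1 h2.asymm
    · refine Or.inr ⟨fun y hy => ?_, fun y hy => ?_⟩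
      · exact (hmid ha hy).elim (fun h => absurd h.1 h2.asymm) And.left
      · exact (hmid hy hb).elim (fun h => absurd h.2 h1.asymm) And.right
  have hstep : ∀ {x y : M}, x ≤ y ∨ y ≤ x → (Pos x → Pos y) ∧ (Neg x → Neg y) := by
    intro x y hxy
    rcases eq_or_ne x y with rfl | hne
    · exact ⟨id, id⟩
    rcases hxy with hxy | hxy
    · have hlt := lt_of_le_of_ne hxy hne
      exact ⟨fun hx => (hor y).resolve_right fun hy => (hx.1 y hlt).asymm (hy.2 x hlt),
        fun hx => (hor y).resolve_left fun hy => (hx.1 y hlt).asymm (hy.2 x hlt)⟩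
    · have hlt := lt_of_le_of_ne hxy hne.symm
      exact ⟨fun hx => (hor y).resolve_right fun hy => (hx.2 y hlt).asymm (hy.1 x hlt),
        fun hx => (hor y).resolve_left fun hy => (hx.2 y hlt).asymm (hy.1 x hlt)⟩
  have hconn : ∀ x y : M, (Pos x → Pos y) ∧ (Neg x → Neg y) := by
    intro x y
    induction Pretree.connected x y with
    | refl => exact ⟨id, id⟩
    | tail _ h ih => exact ⟨(hstep h).1 ∘ ih.1, (hstep h).2 ∘ ih.2⟩
  obtain ⟨x₀⟩ := hM.nonempty
  rcases hor x₀ with h0 | h0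
  · have hlt : ∀ x y, e x < e y ↔ x < y := fun x y =>
      ⟨fun h => (hcomp h).resolve_right fun h' => h.asymm (((hconn x₀ y).1 h0).1 x h'),
        ((hconn x₀ x).1 h0).1 y⟩
    refine Or.inl ⟨⟨e, fun {x y} => ?_⟩⟩
    rw [le_iff_lt_or_eq, le_iff_lt_or_eq, hlt, e.apply_eq_iff_eq]
  · have hlt : ∀ x y, e y < e x ↔ x < y := fun x y =>
      ⟨fun h => (hcomp h).resolve_left fun h' => h.asymm (((hconn x₀ y).2 h0).1 x h'),
        ((hconn x₀ x).2 h0).1 y⟩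
    refine Or.inr ⟨⟨e.trans OrderDual.toDual, fun {x y} => ?_⟩⟩
    rw [Equiv.trans_apply, Equiv.trans_apply, OrderDual.toDual_le_toDual, le_iff_lt_or_eq,
      le_iff_lt_or_eq, hlt, e.apply_eq_iff_eq, @eq_comm _ y]

/-- Reversing the order exchanges the ramification orders. -/
theorem roDown_le_roUp_of_dual [Pretree M] [Pretree N] (e : M ≃o Nᵒᵈ) (x : M) :
    roDown (M := N) (e x) ≤ roUp x ∧ roDown x ≤ roUp (M := N) (e x) := by
  let e' : M ≃ N := e.toEquiv.trans OrderDual.ofDual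
  have key : ∀ s t : M, e' s < e' t ↔ t < s := fun s t => e.lt_iff_lt
  have hpath : ∀ {x a b : M}, OnPath (e' x) (e' a) (e' b) ↔ OnPath x a b :=
    onPath_map_iff (e := e') (adj_map_dual e) (adj_map_dual_symm e)
  have hcone : ∀ x y, e' ⁻¹' cone (e' x) (e' y) = cone x y := fun x y =>
    Set.ext fun t => not_congr hpath
  refine ⟨mk_le_of_preimage e' ?_, mk_le_of_preimage e'.symm ?_⟩
  · rintro _ ⟨y, hy, rfl⟩
    obtain ⟨y, rfl⟩ := e'.surjective y
    exact ⟨y, (key _ _).1 hy, hcone x y⟩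
  · rintro _ ⟨y, hy, rfl⟩
    refine ⟨e' y, (key _ _).2 hy, ?_⟩
    rw [← hcone, ← Set.preimage_comp, Equiv.self_comp_symm, Set.preimage_id]
    rfl

end Isomorphisms

end CFPO

theorem mainTheorem1 :
    (∃ (RepPoint : CFPO.groupLang.Formula (CFPO.Vars 1))
      (EqRepPoint : CFPO.groupLang.Formula (CFPO.Vars 2))
      (B : CFPO.groupLang.Formula (CFPO.Vars 3)),
      ∀ (M : Type u) [PartialOrder M], CFPO.KCone M →
        CFPO.InterpretsBetweenness RepPoint EqRepPoint B M) ∧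
    (∀ (M N : Type u) [PartialOrder M] [PartialOrder N], CFPO.KCone M → CFPO.KCone N →
      (Nonempty ((M ≃o M) ≃* (N ≃o N)) ↔ CFPO.BetweennessIso M N) ∧
      (Nonempty ((M ≃o M) ≃* (N ≃o N)) ↔ (Nonempty (M ≃o N) ∨ Nonempty (M ≃o Nᵒᵈ))) ∧
      ((∃ x : M, CFPO.roUp x < CFPO.roDown x) → Nonempty ((M ≃o M) ≃* (N ≃o N)) →
        Nonempty (M ≃o N))) := by
  obtain ⟨rep, eqRep, btw, h1, h2, h3⟩ := CFPO.exists_formulas.{u}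
  have hint : ∀ (M : Type u) [PartialOrder M], CFPO.KCone M →
      CFPO.InterpretsBetweenness rep eqRep btw M :=
    fun M _ hM => CFPO.interpretsBetweenness hM (h1 _) (h2 _) (h3 _)
  refine ⟨⟨rep, eqRep, btw, hint⟩, fun M N _ _ hM hN => ?_⟩
  have hbtw : Nonempty ((M ≃o M) ≃* (N ≃o N)) → CFPO.BetweennessIso M N := fun ⟨e⟩ =>
    CFPO.betweennessIso_of_interprets (hint M hM) (hint N hN) e
  have hord := CFPO.orderIso_or_dual_of_betweennessIso hM hN
  have haut : Nonempty (M ≃o N) ∨ Nonempty (M ≃o Nᵒᵈ) → Nonempty ((M ≃o M) ≃* (N ≃o N)) := by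
    rintro (⟨⟨e⟩⟩ | ⟨⟨e⟩⟩)
    · exact CFPO.aut_mulEquiv_of_orderIso e
    · obtain ⟨f⟩ := CFPO.aut_mulEquiv_of_orderIso e
      obtain ⟨g⟩ := CFPO.aut_mulEquiv_dual (M := N)
      exact ⟨f.trans g⟩
  refine ⟨⟨hbtw, haut ∘ hord⟩, ⟨hord ∘ hbtw, haut⟩, fun ⟨x, hx⟩ h => ?_⟩
  refine (hord (hbtw h)).resolve_right fun ⟨e⟩ => ?_
  have := CFPO.pretree hM.cfpo hM.pathComplete
  have := CFPO.pretree hN.cfpo hN.pathComplete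
  obtain ⟨hd, hu⟩ := CFPO.roDown_le_roUp_of_dual e x
  exact hx.not_ge (hu.trans ((hN.up_le_down _).trans hd))
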